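/- **Labeled graphs and queries.** Let $\Sigma$ be a finite set of labels. A finite $\Sigma$-labeled digraph $G=(V,(V_a)_{a\in\Sigma},(E_a)_{a\in\Sigma})$ has a finite set $V$ of nodes, sets $V_a\subseteq V$ of $a$-labeled nodes and sets $E_a\subseteq V\times V$ of $a$-labeled edges. Filters $F$ and nested regular path queries $P$ are given by $$F::=[P]\mid node\mid node_a\mid F\wedge F'\mid F\vee F'\mid\neg F,\qquad P::=F?\mid edge_a\mid edge_a^{-1}\mid P/P'\mid P\cup P'\mid P^+\mid goto(F).$$ $|P|$ is the number of nodes of the syntax tree of $P$. The semantics $[\![F]\!]\subseteq V$, $[\![P]\!]\subseteq V\times V$ is: $[\![[P]]\!]=\{v\mid\exists v'.\,(v,v')\in[\![P]\!]\}$, $[\![node]\!]=V$, $[\![node_a]\!]=V_a$, with $\wedge,\vee,\neg$ as intersection, union, complement; $[\![F?]\!]=\{(v,v)\mid v\in[\![F]\!]\}$, $[\![edge_a]\!]=E_a$, $[\![edge_a^{-1}]\!]=E_a^{-1}$, with $/,\cup,{}^+$ as relation composition, union, transitive closure; $[\![goto(F)]\!]=\{(v,v')\mid v'\in[\![F]\!]\}$.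 For $S\subseteq V$ let $[\![P]\!](S)=\{v\mid\exists s\in S.\,(s,v)\in[\![P]\!]\}$ and $[\![F]\!](S)=[\![F]\!]\cap S$. **Top-down needed subgraph.** For negation-free queries, the sets of facts $tdn_{G,S}$ (with start set $S$) and $tdn_G$ (without start set) are defined by mutual recursion. Write $node(A)=\{node(v)\mid v\in A\}$. - $tdn_{G,S}(node)=node(S)$; $tdn_{G,S}(node_a)=node(S)\cup\{node_a(v)\mid v\in V_a\cap S\}$; $tdn_{G,S}([P])=node(S)\cup tdn_{G,S}(P)$; $tdn_{G,S}(F\wedge F')=tdn_{G,S}(F)\cup tdn_{G,[\![F]\!](S)}(F')$; $tdn_{G,S}(F\vee F')=tdn_{G,S}(F)\cup tdn_{G,S}(F')$. - $tdn_{G,S}(F?)=tdn_{G,S}(F)$; $tdn_{G,S}(edge_a)=node(S)\cup\{edge_a(v,v'),node(v')\mid v\in S,(v,v')\in E_a\}$; $tdn_{G,S}(edge_a^{-1})=node(S)\cup\{edge_a(v,v'),node(v)\mid v'\in S,(v,v')\in E_a\}$; $tdn_{G,S}(P/P')=tdn_{G,S}(P)\cup tdn_{G,[\![P]\!](S)}(P')$;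 $tdn_{G,S}(P\cup P')=tdn_{G,S}(P)\cup tdn_{G,S}(P')$; $tdn_{G,S}(P^+)=tdn_{G,\,S\cup[\![P^+]\!](S)}(P)$; $tdn_{G,S}(goto(F))=tdn_G(F)$. - $tdn_G(node)=node(V)$; $tdn_G(node_a)=\{node_a(v)\mid v\in V_a\}$; $tdn_G([P])=node([\![[P]]\!])\cup tdn_G(P)$; $tdn_G(F\wedge F')=tdn_G(F)\cup tdn_{G,[\![F]\!]}(F')$; $tdn_G(F\vee F')=tdn_G(F)\cup tdn_G(F')$. - $tdn_G(F?)=tdn_G(F)$; $tdn_G(edge_a)=tdn_G(edge_a^{-1})=\{edge_a(v,v')\mid (v,v')\in E_a\}$; $tdn_G(P/P')=tdn_G(P)\cup tdn_{G,[\![P]\!](V)}(P')$; $tdn_G(P\cup P')=tdn_G(P)\cup tdn_G(P')$; $tdn_G(P^+)=tdn_G(P)\cup tdn_{G,[\![P^+]\!](V)}(P)$; $tdn_G(goto(F))=tdn_G(F)$. $|tdn_{G,S}(P)|$ is the number of facts in this set. **Machine model.** A random access machine with unit cost: memory cells indexed by $\mathbb N$ and holding natural numbers, initially $0$; instructions for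 loading constants, addition, truncated subtraction, indirect loads and stores, jumps, jumps on zero, reading an entry of the input, appending a number to the output, and halting. The input is read-only and available by constant-time lookups. Nodes and labels are numbered from $0$ on (arbitrarily). The input consists of the syntax tree of the query as an array of nodes with pointers to their children, a list of the start nodes, the number of nodes of the graph, the test whether a node is in $V_a$, and, for every label $a$ and node $v$, lists of the nodes of $V_a$, of the edges of $E_a$, of the $a$-successors of $v$ and of the $a$-predecessors of $v$ (all lists in arbitrary order, without repetitions). **Theorem.** There are a single program for this machine and a constant $C$ such that for every finite label set $\Sigma$, every finite $\Sigma$-labeled digraph $G$, every set $S$ of nodes of $G$, every negation-free nested regular path query $P$, and every presentation of $G$, $S$ and $P$ as an input as above, the program halts after at most $C\cdot|P|\cdot\max(1,|tdn_{G,S}(P)|)$ steps, and its output is a list without repetitions of exactly the numbers of the nodes in $[\![P]\!](S)$. That is, the answer set $[\![P]\!](S)$ can be computed in time $\mathcal O(|P|\,|tdn_{G,S}(P)|)$. -/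

import Mathlib

universe u

/-! ### Labeled graphs and nested regular path queries -/

/-- A labeled digraph with label set `L` and node set `V`: a set of `a`-labeled nodes and a set of
`a`-labeled edges for every label `a`. -/
structure LabeledGraph (L V : Type*) where
  nodeLab : L → Set V
  edge : L → Set (V × V)

mutual

/-- Filters. -/
inductive NFilter (L : Type u) where
  | ex : NPath L → NFilter L
  | node : NFilter L
  | lab : L → NFilter L
  | and : NFilter L → NFilter L → NFilter L
  | or : NFilter L → NFilter L → NFilter L
  | not : NFilter L → NFilter L

/-- Nested regular path queries. `test F` is the path `F?`, and `inv a` is the inverse of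
`edge a`. -/
inductive NPath (L : Type u) where
  | test : NFilter L → NPath L
  | edge : L → NPath L
  | inv : L → NPath L
  | seq : NPath L → NPath L → NPath L
  | union : NPath L → NPath L → NPath L
  | plus : NPath L → NPath L
  | goto : NFilter L → NPath L

end

mutual

/-- The size of a filter: the number of nodes of its syntax tree. -/
def NFilter.size {L : Type*} : NFilter L → ℕ
  | .ex P => P.size + 1
  | .node => 1
  | .lab _ => 1
  | .and F F' => F.size + F'.size + 1
  | .or F F' => F.size + F'.size + 1
  | .not F => F.size + 1

/-- The size of a path query: the number of nodes of its syntax tree. -/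
def NPath.size {L : Type*} : NPath L → ℕ
  | .test F => F.size + 1
  | .edge _ => 1
  | .inv _ => 1
  | .seq P P' => P.size + P'.size + 1
  | .union P P' => P.size + P'.size + 1
  | .plus P => P.size + 1
  | .goto F => F.size + 1

end

mutual

/-- The filter contains no negation, at any depth. -/
def NFilter.NegFree {L : Type*} : NFilter L → Prop
  | .ex P => P.NegFree
  | .node => True
  | .lab _ => True
  | .and F F' => F.NegFree ∧ F'.NegFree
  | .or F F' => F.NegFree ∧ F'.NegFree
  | .not _ => False

/-- The path query contains no negation, at any depth. -/
def NPath.NegFree {L : Type*} : NPath L → Prop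
  | .test F => F.NegFree
  | .edge _ => True
  | .inv _ => True
  | .seq P P' => P.NegFree ∧ P'.NegFree
  | .union P P' => P.NegFree ∧ P'.NegFree
  | .plus P => P.NegFree
  | .goto F => F.NegFree

end

mutual

/-- The set of nodes selected by a filter. -/
def NFilter.sem {L V : Type*} (G : LabeledGraph L V) : NFilter L → Set V
  | .ex P => {v | ∃ v', P.sem G v v'}
  | .node => Set.univ
  | .lab a => G.nodeLab a
  | .and F F' => F.sem G ∩ F'.sem G
  | .or F F' => F.sem G ∪ F'.sem G
  | .not F => (F.sem G)ᶜ

/-- The binary relation on nodes defined by a path query. -/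
def NPath.sem {L V : Type*} (G : LabeledGraph L V) : NPath L → V → V → Prop
  | .test F => fun v v' => v = v' ∧ v ∈ F.sem G
  | .edge a => fun v v' => (v, v') ∈ G.edge a
  | .inv a => fun v v' => (v', v) ∈ G.edge a
  | .seq P P' => fun v v' => ∃ w, P.sem G v w ∧ P'.sem G w v'
  | .union P P' => fun v v' => P.sem G v v' ∨ P'.sem G v v'
  | .plus P => Relation.TransGen (P.sem G)
  | .goto F => fun _ v' => v' ∈ F.sem G

end

/-- The answer set of the path query `P` for the start set `S`: the nodes that are reached from
some node of `S` over `P`. -/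
def NPath.answers {L V : Type*} (G : LabeledGraph L V) (P : NPath L) (S : Set V) : Set V :=
  {v | ∃ s ∈ S, P.sem G s v}

/-! ### Top-down needed subgraphs -/

/-- Database facts over nodes `V` and labels `L`. -/
inductive GFact (L V : Type*) where
  | node : V → GFact L V
  | lab : L → V → GFact L V
  | edge : L → V → V → GFact L V

mutual

/-- Facts of the top-down needed subgraph of a filter tested at the nodes of `S`. (Only used for
negation-free filters.) -/
def NFilter.tdn {L V : Type*} (G : LabeledGraph L V) : NFilter L → Set V → Set (GFact L V)
  | .ex P, S => GFact.node '' S ∪ P.tdn G S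
  | .node, S => GFact.node '' S
  | .lab a, S => GFact.node '' S ∪ GFact.lab a '' (G.nodeLab a ∩ S)
  | .and F F', S => F.tdn G S ∪ F'.tdn G (F.sem G ∩ S)
  | .or F F', S => F.tdn G S ∪ F'.tdn G S
  | .not _, _ => ∅

/-- Facts of the top-down needed subgraph of a path query started at the nodes of `S`. (Only used
for negation-free path queries.) -/
def NPath.tdn {L V : Type*} (G : LabeledGraph L V) : NPath L → Set V → Set (GFact L V)
  | .test F, S => F.tdn G S
  | .edge a, S => GFact.node '' S ∪
      {f | ∃ v v', v ∈ S ∧ (v, v') ∈ G.edge a ∧ (f = .edge a v v' ∨ f = .node v')}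
  | .inv a, S => GFact.node '' S ∪
      {f | ∃ v v', v' ∈ S ∧ (v, v') ∈ G.edge a ∧ (f = .edge a v v' ∨ f = .node v)}
  | .seq P P', S => P.tdn G S ∪ P'.tdn G (P.answers G S)
  | .union P P', S => P.tdn G S ∪ P'.tdn G S
  | .plus P, S => P.tdn G (S ∪ {v | ∃ s ∈ S, Relation.TransGen (P.sem G) s v})
  | .goto F, _ => F.tdnAll G

/-- Facts of the top-down needed subgraph of a filter evaluated without a start set, for
enumerating all the nodes that it selects. -/
def NFilter.tdnAll {L V : Type*} (G : LabeledGraph L V) : NFilter L → Set (GFact L V)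
  | .ex P => GFact.node '' {v | ∃ v', P.sem G v v'} ∪ P.tdnAll G
  | .node => Set.range GFact.node
  | .lab a => GFact.lab a '' G.nodeLab a
  | .and F F' => F.tdnAll G ∪ F'.tdn G (F.sem G)
  | .or F F' => F.tdnAll G ∪ F'.tdnAll G
  | .not _ => ∅

/-- Facts of the top-down needed subgraph of a path query evaluated without a start set. -/
def NPath.tdnAll {L V : Type*} (G : LabeledGraph L V) : NPath L → Set (GFact L V)
  | .test F => F.tdnAll G
  | .edge a => {f | ∃ v v', (v, v') ∈ G.edge a ∧ f = .edge a v v'}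
  | .inv a => {f | ∃ v v', (v, v') ∈ G.edge a ∧ f = .edge a v v'}
  | .seq P P' => P.tdnAll G ∪ P'.tdn G (P.answers G Set.univ)
  | .union P P' => P.tdnAll G ∪ P'.tdnAll G
  | .plus P => P.tdnAll G ∪ P.tdn G {v | ∃ s, Relation.TransGen (P.sem G) s v}
  | .goto F => F.tdnAll G

end

/-! ### The machine model: a random access machine with unit cost

The memory is an array of natural numbers, initially all `0`. The arithmetic operations are addition
and truncated subtraction. The input is read-only and is read through the tables `RAM.Table`. -/

namespace RAM

/-- The tables through which a machine reads its input: the syntax tree of the query, the start set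
and the indexed graph. `Input.ofQuery` says what they contain. -/
inductive Table where
  | tag | left | right
  | start
  | nodeCount | hasLab | labeled | edgeSrc | edgeTgt | succ | pred

/-- The input of a machine: the content of every table, at up to three arguments. -/
abbrev Input := Table → ℕ → ℕ → ℕ → ℕ

/-- Instructions. Arguments `d x y z` are memory addresses, `k` is a constant and `l` is a program
line. -/
inductive Instr where
  /-- `mem[d] := k` -/
  | const (d k : ℕ)
  /-- `mem[d] := mem[x] + mem[y]` -/
  | add (d x y : ℕ)
  /-- `mem[d] := max (mem[x] - mem[y]) 0` -/
  | sub (d x y : ℕ)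
  /-- `mem[d] := mem[mem[x]]` -/
  | load (d x : ℕ)
  /-- `mem[mem[d]] := mem[x]` -/
  | store (d x : ℕ)
  /-- `mem[d] := ` entry of table `t` at `mem[x], mem[y], mem[z]` -/
  | read (t : Table) (d x y z : ℕ)
  /-- append `mem[x]` to the output -/
  | output (x : ℕ)
  /-- continue at line `l` -/
  | jump (l : ℕ)
  /-- if `mem[x] = 0` then continue at line `l` -/
  | jumpZero (x l : ℕ)
  | halt

/-- Programs are finite lists of instructions. -/
abbrev Program := List Instr

/-- Configurations: program counter, memory, and the output written so far. -/
structure Config where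
  pc : ℕ
  mem : ℕ → ℕ
  out : List ℕ

/-- The initial configuration. -/
def Config.init : Config := ⟨0, fun _ => 0, []⟩

/-- The effect of one instruction; `none` means that the machine halts. -/
def Instr.exec (inp : Input) (c : Config) : Instr → Option Config
  | .const d k => some ⟨c.pc + 1, Function.update c.mem d k, c.out⟩
  | .add d x y => some ⟨c.pc + 1, Function.update c.mem d (c.mem x + c.mem y), c.out⟩
  | .sub d x y => some ⟨c.pc + 1, Function.update c.mem d (c.mem x - c.mem y), c.out⟩
  | .load d x => some ⟨c.pc + 1, Function.update c.mem d (c.mem (c.mem x)), c.out⟩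
  | .store d x => some ⟨c.pc + 1, Function.update c.mem (c.mem d) (c.mem x), c.out⟩
  | .read t d x y z =>
      some ⟨c.pc + 1, Function.update c.mem d (inp t (c.mem x) (c.mem y) (c.mem z)), c.out⟩
  | .output x => some ⟨c.pc + 1, c.mem, c.out ++ [c.mem x]⟩
  | .jump l => some ⟨l, c.mem, c.out⟩
  | .jumpZero x l => some ⟨if c.mem x = 0 then l else c.pc + 1, c.mem, c.out⟩
  | .halt => none

/-- One step of the machine; `none` means that it has halted (at `halt` or by leaving the
program). -/
def step (prog : Program) (inp : Input) (c : Config) : Option Config :=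
  prog[c.pc]?.bind (Instr.exec inp c)

/-- The configuration after `t` steps; a halted machine stays where it is. -/
def run (prog : Program) (inp : Input) (t : ℕ) : Config :=
  (fun c => (step prog inp c).getD c)^[t] Config.init

/-- The machine halts after at most `t` steps, with output `l`. -/
def HaltsWithin (prog : Program) (inp : Input) (t : ℕ) (l : List ℕ) : Prop :=
  step prog inp (run prog inp t) = none ∧ (run prog inp t).out = l

end RAM

/-! ### The input of the machine -/

/-- A presentation of a labeled graph with a start set as an indexed database: numberings of the
nodes and of the labels, and, in arbitrary order and without repetition, lists of the start nodes,
of the `a`-labeled nodes, of the `a`-labeled edges, and of the `a`-successors and the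
`a`-predecessors of every node. -/
structure Presentation {L V : Type*} (G : LabeledGraph L V) (S : Set V) where
  nodeCount : ℕ
  nodeId : V ≃ Fin nodeCount
  labelCount : ℕ
  labelId : L ≃ Fin labelCount
  start : List V
  labeled : L → List V
  edges : L → List (V × V)
  succ : L → V → List V
  pred : L → V → List V
  start_nodup : start.Nodup
  labeled_nodup : ∀ a, (labeled a).Nodup
  edges_nodup : ∀ a, (edges a).Nodup
  succ_nodup : ∀ a v, (succ a v).Nodup
  pred_nodup : ∀ a v, (pred a v).Nodup
  mem_start : ∀ v, v ∈ start ↔ v ∈ S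
  mem_labeled : ∀ a v, v ∈ labeled a ↔ v ∈ G.nodeLab a
  mem_edges : ∀ a e, e ∈ edges a ↔ e ∈ G.edge a
  mem_succ : ∀ a v w, w ∈ succ a v ↔ (v, w) ∈ G.edge a
  mem_pred : ∀ a v w, w ∈ pred a v ↔ (w, v) ∈ G.edge a

mutual

/-- The syntax tree of a filter, its nodes being numbered from `k` on in prefix order: for every node
its tag and the numbers of its left and right children. At a leaf with a label, the number of the
label stands in place of the left child; unused entries are `0`. -/
def NFilter.code {L : Type*} (lab : L → ℕ) : NFilter L → ℕ → List (ℕ × ℕ × ℕ)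
  | .ex P, k => (1, k + 1, 0) :: P.code lab (k + 1)
  | .node, _ => [(2, 0, 0)]
  | .lab a, _ => [(3, lab a, 0)]
  | .and F F', k =>
      (4, k + 1, k + 1 + F.size) :: (F.code lab (k + 1) ++ F'.code lab (k + 1 + F.size))
  | .or F F', k =>
      (5, k + 1, k + 1 + F.size) :: (F.code lab (k + 1) ++ F'.code lab (k + 1 + F.size))
  | .not F, k => (6, k + 1, 0) :: F.code lab (k + 1)

/-- The syntax tree of a path query, with the same conventions. -/
def NPath.code {L : Type*} (lab : L → ℕ) : NPath L → ℕ → List (ℕ × ℕ × ℕ)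
  | .test F, k => (7, k + 1, 0) :: F.code lab (k + 1)
  | .edge a, _ => [(8, lab a, 0)]
  | .inv a, _ => [(9, lab a, 0)]
  | .seq P P', k =>
      (10, k + 1, k + 1 + P.size) :: (P.code lab (k + 1) ++ P'.code lab (k + 1 + P.size))
  | .union P P', k =>
      (11, k + 1, k + 1 + P.size) :: (P.code lab (k + 1) ++ P'.code lab (k + 1 + P.size))
  | .plus P, k => (12, k + 1, 0) :: P.code lab (k + 1)
  | .goto F, k => (13, k + 1, 0) :: F.code lab (k + 1)

end

namespace RAM

/-- The entry of a list at position `i`, plus `1`, and `0` beyond the end of the list. -/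
def entry (l : List ℕ) (i : ℕ) : ℕ := (l[i]?.map (· + 1)).getD 0

/-- The node with a given number, if there is one. -/
def nodeOf {L V : Type*} {G : LabeledGraph L V} {S : Set V} (D : Presentation G S) (x : ℕ) :
    Option V :=
  if h : x < D.nodeCount then some (D.nodeId.symm ⟨x, h⟩) else none

/-- The label with a given number, if there is one. -/
def labelOf {L V : Type*} {G : LabeledGraph L V} {S : Set V} (D : Presentation G S) (x : ℕ) :
    Option L :=
  if h : x < D.labelCount then some (D.labelId.symm ⟨x, h⟩) else none

open Classical in
/-- The input for the query `P` on a presented graph with start set. Every table returns `0` at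
arguments that are out of range. -/
noncomputable def Input.ofQuery {L V : Type*} {G : LabeledGraph L V} {S : Set V}
    (D : Presentation G S) (P : NPath L) : Input
  | .tag, i, _, _ => ((P.code (fun a => (D.labelId a : ℕ)) 0)[i]?.map fun c => c.1).getD 0
  | .left, i, _, _ => ((P.code (fun a => (D.labelId a : ℕ)) 0)[i]?.map fun c => c.2.1).getD 0
  | .right, i, _, _ => ((P.code (fun a => (D.labelId a : ℕ)) 0)[i]?.map fun c => c.2.2).getD 0
  | .start, i, _, _ => entry (D.start.map fun v => (D.nodeId v : ℕ)) i
  | .nodeCount, _, _, _ => D.nodeCount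
  | .hasLab, x, y, _ =>
      match labelOf D x, nodeOf D y with
      | some a, some v => if v ∈ G.nodeLab a then 1 else 0
      | _, _ => 0
  | .labeled, x, i, _ =>
      match labelOf D x with
      | some a => entry ((D.labeled a).map fun v => (D.nodeId v : ℕ)) i
      | none => 0
  | .edgeSrc, x, i, _ =>
      match labelOf D x with
      | some a => entry ((D.edges a).map fun e => (D.nodeId e.1 : ℕ)) i
      | none => 0
  | .edgeTgt, x, i, _ =>
      match labelOf D x with
      | some a => entry ((D.edges a).map fun e => (D.nodeId e.2 : ℕ)) i
      | none => 0
  | .succ, x, y, i =>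
      match labelOf D x, nodeOf D y with
      | some a, some v => entry ((D.succ a v).map fun w => (D.nodeId w : ℕ)) i
      | _, _ => 0
  | .pred, x, y, i =>
      match labelOf D x, nodeOf D y with
      | some a, some v => entry ((D.pred a v).map fun w => (D.nodeId w : ℕ)) i
      | _, _ => 0

end RAM

/-!
The program is an inference engine for a fixed finite list of rules (`RAM.queryRules`). It derives
*items*: statements about one position `q` of the syntax tree and at most one node `v` of the graph,
such as "the subquery at `q` is to be evaluated from `v`" or "`v` is an answer of the subquery at `q`".
Filters are treated as path queries that stay at a node (`Query`), so that conjunction becomes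
composition and disjunction becomes union.

*What is derived.* Requests (`req`) run from a subquery to its children, answers (`ans`) run back, and a
composition requests its second part at the answers of its first part. A filter `[P]` must not return
every pair of a start and an end of `P`, which could be quadratically many; therefore the items do not
relate starts to answers. Instead, an answer of `P` is declared *good* as an end, and goodness is
propagated backwards through the subqueries (`endGood`, `startGood`) to the nodes from which a good end
is reached. Below `goto` there is no start set (`all`), and `goto` itself may make every node good at
once (`every`), which is recorded by a single item and unfolded only when a filter `[P]` without start
set selects every node (`everyEx`); then all nodes are needed facts. Finally, the start set of the whole
query may be too large to be read, as `goto(F)` does not need it; the items of kind `spine` find out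
whether a leftmost subquery needs all start nodes, and otherwise a single one is loaded.

*Time.* An implication between two items is considered when the item that triggers its rule is
processed, and is put on the watch list of its premise if this is not derived yet. So every
implication costs a constant number of steps (`RAM.tri_engineCmd`), and the number of implications at an
item is at most a constant plus the number of edges that are enumerated there. Soundness
(`RAM.ruleOK_queryRules`) says that whatever is derived is correct, and licensed: requests are made only
where the facts they need belong to the top-down needed subgraph. Hence all nodes of items occur in
this subgraph, up to the first start node, and so do all enumerated edges; for each of the `|P|`
positions there are `O(max 1 |tdn|)` items and implications (`RAM.exists_items`).

The meaning of an item depends on its surroundings: an answer of a subquery of a filter is good only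
relative to that filter. Soundness is therefore stated with a *context* for every position
(`Query.Ctx`, `Query.IsKid`): which nodes may be answers, which may be good as ends, and which may be
good as starts, such that the three sets for a child are computed from those of its parent.

*Correctness.* Completeness (`RAM.complete`) is an induction on the subquery: a set of items that is
closed under the rules and contains a request contains all answers, and if the end of a path is good,
then so is its start. For `P⁺` this is an induction along the path, forwards for the answers and
backwards for the good nodes.

The engine is written in a small structured language with variables and arrays, whose commands are
translated to machine code with exactly known running times (`RAM.Exec.haltsWithin`).
-/

/-! ### A structured language and its translation to machine code -/

namespace RAM

/-- Variables of the structured language, kept in the low memory cells. -/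
inductive Var where
  | zero | one | stride | hd | tl | cells | cur
  | kind | pos | node | tag | left | right | par | ptag | side | pleft | pright
  | idx | fst | snd | go | t1 | t2 | t3 | prem | concl
  deriving DecidableEq

/-- Arrays of the structured language; all of them are infinite and initially `0`. -/
inductive Arr where
  | base | rpar | mark | head | queue | cellKey | cellNext | itemKind | itemPos | itemNode
  deriving DecidableEq

/-- The memory cell of a variable. -/
def Var.addr : Var → ℕ
  | .zero => 0 | .one => 1 | .stride => 2 | .hd => 3 | .tl => 4 | .cells => 5 | .cur => 6
  | .kind => 7 | .pos => 8 | .node => 9 | .tag => 10 | .left => 11 | .right => 12 | .par => 13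
  | .ptag => 14 | .side => 15 | .pleft => 16 | .pright => 17 | .idx => 18 | .fst => 19
  | .snd => 20 | .go => 21 | .t1 => 22 | .t2 => 23 | .t3 => 24 | .prem => 25 | .concl => 26

/-- The residue class modulo `64` of the memory cells of an array. -/
def Arr.addr : Arr → ℕ
  | .base => 0 | .rpar => 1 | .mark => 2 | .head => 3 | .queue => 4 | .cellKey => 5
  | .cellNext => 6 | .itemKind => 7 | .itemPos => 8 | .itemNode => 9

theorem Var.addr_lt (x : Var) : x.addr < 60 := by cases x <;> simp [Var.addr]

theorem Arr.addr_lt (A : Arr) : A.addr < 64 := by cases A <;> simp [Arr.addr]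

theorem Var.addr_injective : Function.Injective Var.addr := by
  intro x y h
  cases x <;> cases y <;> first | rfl | (simp [Var.addr] at h)

theorem Arr.addr_injective : Function.Injective Arr.addr := by
  intro x y h
  cases x <;> cases y <;> first | rfl | (simp [Arr.addr] at h)

/-- States of the structured language. -/
structure St where
  v : Var → ℕ
  a : Arr → ℕ → ℕ
  out : List ℕ

/-- Assignments of the structured language. -/
inductive Op where
  | const (d : Var) (k : ℕ)
  | add (d x y : Var)
  | sub (d x y : Var)
  | get (d : Var) (A : Arr) (x : Var)
  | put (A : Arr) (x y : Var)
  | read (t : Table) (d x y z : Var)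
  | out (x : Var)

/-- Setting a variable. -/
def St.set (s : St) (d : Var) (k : ℕ) : St := { s with v := Function.update s.v d k }

/-- Setting an array entry. -/
def St.setArr (s : St) (A : Arr) (i k : ℕ) : St :=
  { s with a := Function.update s.a A (Function.update (s.a A) i k) }

/-- The effect of an assignment. -/
def Op.run (inp : Input) (s : St) : Op → St
  | .const d k => s.set d k
  | .add d x y => s.set d (s.v x + s.v y)
  | .sub d x y => s.set d (s.v x - s.v y)
  | .get d A x => s.set d (s.a A (s.v x))
  | .put A x y => s.setArr A (s.v x) (s.v y)
  | .read t d x y z => s.set d (inp t (s.v x) (s.v y) (s.v z))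
  | .out x => { s with out := s.out ++ [s.v x] }

/-- Machine code that writes the memory address of `A[x]` to cell `62`: the entry number `i` of an
array is kept in the cell `64 * (i + 1) + A.addr`, and the cells below `64` are left to the variables and
to auxiliary values. -/
def addrCode (A : Arr) (x : Var) : List Instr :=
  [.add 62 x.addr x.addr, .add 62 62 62, .add 62 62 62, .add 62 62 62, .add 62 62 62,
   .add 62 62 62, .const 63 (64 + A.addr), .add 62 62 63]

/-- Machine code of an assignment. -/
def Op.code : Op → List Instr
  | .const d k => [.const d.addr k]
  | .add d x y => [.add d.addr x.addr y.addr]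
  | .sub d x y => [.sub d.addr x.addr y.addr]
  | .get d A x => addrCode A x ++ [.load d.addr 62]
  | .put A x y => addrCode A x ++ [.store 62 y.addr]
  | .read t d x y z => [.read t d.addr x.addr y.addr z.addr]
  | .out x => [.output x.addr]

/-- Commands of the structured language. -/
inductive Cmd where
  | ops (l : List Op)
  | seq (c c' : Cmd)
  /-- `c` if `x` is not `0`, otherwise `c'` -/
  | ite (x : Var) (c c' : Cmd)
  /-- repeat `c` as long as `x` is not `0` -/
  | loop (x : Var) (c : Cmd)

/-- The effect of a list of assignments. -/
def runOps (inp : Input) (l : List Op) (s : St) : St := l.foldl (Op.run inp) s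

/-- The length of the machine code of a list of assignments, which is also its running time. -/
def opsCost (l : List Op) : ℕ := (l.map fun o => o.code.length).sum

/-- Length of the machine code of a command. -/
def Cmd.len : Cmd → ℕ
  | .ops l => opsCost l
  | .seq c c' => c.len + c'.len
  | .ite _ c c' => c.len + c'.len + 2
  | .loop _ c => c.len + 2

/-- Machine code of a command, to be placed at line `k`. -/
def Cmd.code : Cmd → ℕ → List Instr
  | .ops l, _ => l.flatMap Op.code
  | .seq c c', k => c.code k ++ c'.code (k + c.len)
  | .ite x c c', k =>
      .jumpZero x.addr (k + c.len + 2) ::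
        (c.code (k + 1) ++ (.jump (k + c.len + c'.len + 2) :: c'.code (k + c.len + 2)))
  | .loop x c, k => .jumpZero x.addr (k + c.len + 2) :: (c.code (k + 1) ++ [.jump k])

theorem Cmd.length_code (c : Cmd) (k : ℕ) : (c.code k).length = c.len := by
  induction c generalizing k with
  | ops l => simp [Cmd.code, Cmd.len, opsCost, List.length_flatMap]
  | seq c c' h h' => simp [Cmd.code, Cmd.len, h, h']
  | ite x c c' h h' => simp [Cmd.code, Cmd.len, h, h']; omega
  | loop x c h => simp [Cmd.code, Cmd.len, h]

/-- Big-step semantics: `Exec inp c s t s'` says that `c` leads from `s` to `s'`, and that its machine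
code takes `t` steps for this. -/
inductive Exec (inp : Input) : Cmd → St → ℕ → St → Prop where
  | ops (l s) : Exec inp (.ops l) s (opsCost l) (runOps inp l s)
  | seq {c c' s s' s'' t t'} : Exec inp c s t s' → Exec inp c' s' t' s'' →
      Exec inp (.seq c c') s (t + t') s''
  | iteTrue {x c c' s s' t} : s.v x ≠ 0 → Exec inp c s t s' → Exec inp (.ite x c c') s (t + 2) s'
  | iteFalse {x c c' s s' t} : s.v x = 0 → Exec inp c' s t s' →
      Exec inp (.ite x c c') s (t + 1) s'
  | loopTrue {x c s s' s'' t t'} : s.v x ≠ 0 → Exec inp c s t s' →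
      Exec inp (.loop x c) s' t' s'' → Exec inp (.loop x c) s (t + 2 + t') s''
  | loopFalse {x c s} : s.v x = 0 → Exec inp (.loop x c) s 1 s

/-- The machine configuration `c` represents the state `s`. -/
structure Config.Reps (c : Config) (s : St) : Prop where
  var : ∀ x : Var, c.mem x.addr = s.v x
  arr : ∀ (A : Arr) (i : ℕ), c.mem (64 * i + (64 + A.addr)) = s.a A i
  out : c.out = s.out

/-- The list `prog` contains the list `l` from position `k` on. -/
def HasCode {α : Type*} (prog : List α) (k : ℕ) (l : List α) : Prop :=
  ∀ i, i < l.length → prog[k + i]? = l[i]?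

theorem hasCode_append {α : Type*} {prog : List α} {k : ℕ} {l l' : List α} :
    HasCode prog k (l ++ l') ↔ HasCode prog k l ∧ HasCode prog (k + l.length) l' := by
  constructor
  · intro h
    refine ⟨fun i hi => ?_, fun i hi => ?_⟩
    · rw [h i (by simp; omega), List.getElem?_append_left hi]
    · rw [add_assoc, h _ (by simp; omega), List.getElem?_append_right (by omega)]
      simp
  · rintro ⟨h, h'⟩ i hi
    by_cases hl : i < l.length
    · rw [h i hl, List.getElem?_append_left hl]
    · have := h' (i - l.length) (by simp at hi; omega)
      rw [List.getElem?_append_right (by omega), ← this]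
      congr 1; omega

theorem hasCode_cons {α : Type*} {prog : List α} {k : ℕ} {o : α} {l : List α} :
    HasCode prog k (o :: l) ↔ prog[k]? = some o ∧ HasCode prog (k + 1) l := by
  rw [show o :: l = [o] ++ l from rfl, hasCode_append]
  simp [HasCode]

/-- One step of the machine, where a halted machine stays where it is. -/
def next (prog : Program) (inp : Input) (c : Config) : Config := (step prog inp c).getD c

/-- The machine goes from `c` to `c'` in `t` steps. -/
def Goes (prog : Program) (inp : Input) (t : ℕ) (c c' : Config) : Prop :=
  (next prog inp)^[t] c = c'

theorem Goes.trans {prog : Program} {inp : Input} {t t' : ℕ} {c c' c'' : Config}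
    (h : Goes prog inp t c c') (h' : Goes prog inp t' c' c'') : Goes prog inp (t + t') c c'' := by
  unfold Goes at *
  rw [add_comm, Function.iterate_add_apply, h, h']

theorem goes_one {prog : Program} {inp : Input} {c c' : Config} {o : Instr}
    (h : prog[c.pc]? = some o) (h' : o.exec inp c = some c') : Goes prog inp 1 c c' := by
  simp [Goes, next, step, h, h']

theorem Config.Reps.set {c : Config} {s : St} (h : c.Reps s) (d : Var) (k p : ℕ) :
    Config.Reps ⟨p, Function.update c.mem d.addr k, c.out⟩ (s.set d k) := by
  refine ⟨fun x => ?_, fun A i => ?_, h.out⟩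
  · simp only [St.set, Function.update_apply, Var.addr_injective.eq_iff, h.var]
  · have := d.addr_lt
    simp only [St.set, Function.update_apply]
    rw [if_neg (by omega), h.arr]

theorem Config.Reps.setArr {c : Config} {s : St} (h : c.Reps s) (A : Arr) (i k p : ℕ) :
    Config.Reps ⟨p, Function.update c.mem (64 * i + (64 + A.addr)) k, c.out⟩ (s.setArr A i k) := by
  refine ⟨fun x => ?_, fun B j => ?_, h.out⟩
  · have := x.addr_lt
    simp only [St.setArr, Function.update_apply]
    rw [if_neg (by omega), h.var]
  · have hA := A.addr_lt
    have hB := B.addr_lt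
    simp only [St.setArr, Function.update_apply]
    by_cases hAB : B = A
    · subst hAB
      by_cases hij : j = i
      · simp [hij]
      · rw [if_neg (by omega), h.arr]; simp [hij]
    · have : B.addr ≠ A.addr := fun e => hAB (Arr.addr_injective e)
      rw [if_neg (by omega), h.arr]; simp [hAB]

theorem goes_addrCode {prog : Program} {inp : Input} {c : Config} {s : St} {A : Arr} {x : Var}
    (hc : HasCode prog c.pc (addrCode A x)) (h : c.Reps s) :
    ∃ c', Goes prog inp 8 c c' ∧ c'.Reps s ∧ c'.pc = c.pc + 8 ∧
      c'.mem 62 = 64 * s.v x + (64 + A.addr) := by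
  simp only [addrCode, hasCode_cons, add_assoc, Nat.reduceAdd] at hc
  obtain ⟨h0, h1, h2, h3, h4, h5, h6, h7, -⟩ := hc
  refine ⟨_, ((((((((goes_one h0 rfl).trans (goes_one h1 rfl)).trans (goes_one h2 rfl)).trans
    (goes_one h3 rfl)).trans (goes_one h4 rfl)).trans (goes_one h5 rfl)).trans
    (goes_one h6 rfl)).trans (goes_one h7 rfl)), ⟨fun y => ?_, fun B j => ?_, h.out⟩, rfl, ?_⟩
  · have := y.addr_lt
    simp only [Function.update_apply]
    simp only [if_neg (show y.addr ≠ 62 by omega), if_neg (show y.addr ≠ 63 by omega), h.var]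
  · simp only [Function.update_apply]
    simp only [if_neg (show 64 * j + (64 + B.addr) ≠ 62 by omega),
      if_neg (show 64 * j + (64 + B.addr) ≠ 63 by omega), h.arr]
  · simp [h.var]
    omega

/-- Variables, arrays and the cells `62` and `63` of `addrCode` occupy different memory cells, so
that the code of an assignment changes nothing else in the represented state. -/
theorem goes_op {prog : Program} {inp : Input} {c : Config} {s : St} (o : Op)
    (hc : HasCode prog c.pc o.code) (h : c.Reps s) :
    ∃ c', Goes prog inp o.code.length c c' ∧ c'.Reps (o.run inp s) ∧
      c'.pc = c.pc + o.code.length := by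
  cases o with
  | const d k =>
    exact ⟨_, goes_one (hasCode_cons.1 hc).1 rfl, h.set _ _ _, rfl⟩
  | add d x y =>
    refine ⟨_, goes_one (hasCode_cons.1 hc).1 rfl, ?_, rfl⟩
    simp only [h.var]
    exact h.set _ _ _
  | sub d x y =>
    refine ⟨_, goes_one (hasCode_cons.1 hc).1 rfl, ?_, rfl⟩
    simp only [h.var]
    exact h.set _ _ _
  | get d A x =>
    obtain ⟨hc1, hc2⟩ := hasCode_append.1 hc
    obtain ⟨c', hg, hr, hp, hm⟩ := goes_addrCode (inp := inp) hc1 h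
    refine ⟨_, hg.trans (goes_one (o := .load d.addr 62) ?_ rfl), ?_, ?_⟩
    · rw [hp]; exact (hasCode_cons.1 hc2).1
    · simp only [hm, hr.arr]
      exact hr.set _ _ _
    · simp [hp, Op.code, addrCode]
  | put A x y =>
    obtain ⟨hc1, hc2⟩ := hasCode_append.1 hc
    obtain ⟨c', hg, hr, hp, hm⟩ := goes_addrCode (inp := inp) hc1 h
    refine ⟨_, hg.trans (goes_one (o := .store 62 y.addr) ?_ rfl), ?_, ?_⟩
    · rw [hp]; exact (hasCode_cons.1 hc2).1
    · simp only [hm, hr.var]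
      exact hr.setArr _ _ _ _
    · simp [hp, Op.code, addrCode]
  | read t d x y z =>
    refine ⟨_, goes_one (hasCode_cons.1 hc).1 rfl, ?_, rfl⟩
    simp only [h.var]
    exact h.set _ _ _
  | out x =>
    exact ⟨_, goes_one (hasCode_cons.1 hc).1 rfl,
      ⟨h.var, h.arr, by simp [Op.run, h.out, h.var]⟩, rfl⟩

theorem goes_ops {prog : Program} {inp : Input} (l : List Op) {c : Config} {s : St}
    (hc : HasCode prog c.pc (l.flatMap Op.code)) (h : c.Reps s) :
    ∃ c', Goes prog inp (opsCost l) c c' ∧ c'.Reps (runOps inp l s) ∧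
      c'.pc = c.pc + opsCost l := by
  induction l generalizing c s with
  | nil => exact ⟨c, rfl, h, rfl⟩
  | cons o l ih =>
    rw [List.flatMap_cons, hasCode_append] at hc
    obtain ⟨c', hg, hr, hp⟩ := goes_op (inp := inp) o hc.1 h
    obtain ⟨c'', hg', hr', hp'⟩ := ih (by rw [hp]; exact hc.2) hr
    refine ⟨c'', ?_, hr', ?_⟩
    · simpa [opsCost] using hg.trans hg'
    · rw [hp', hp]; simp [opsCost, add_assoc]

/-- The machine code of a command does what the command does, in the time stated by `Exec`. -/
theorem Exec.goes {prog : Program} {inp : Input} {c : Cmd} {s s' : St} {t : ℕ}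
    (he : Exec inp c s t s') {f : Config} (hc : HasCode prog f.pc (c.code f.pc)) (h : f.Reps s) :
    ∃ f', Goes prog inp t f f' ∧ f'.Reps s' ∧ f'.pc = f.pc + c.len := by
  induction he generalizing f with
  | ops l s => exact goes_ops l hc h
  | @seq c c' s s' s'' t t' _ _ ih ih' =>
    rw [Cmd.code, hasCode_append, Cmd.length_code] at hc
    obtain ⟨f1, hg, hr, hp⟩ := ih hc.1 h
    obtain ⟨f2, hg', hr', hp'⟩ := ih' (by rw [hp]; exact hc.2) hr
    exact ⟨f2, hg.trans hg', hr', by rw [hp', hp, Cmd.len]; omega⟩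
  | @iteTrue x c c' s s' t hx _ ih =>
    rw [Cmd.code, hasCode_cons, hasCode_append, hasCode_cons, Cmd.length_code] at hc
    obtain ⟨h0, h1, h2, -⟩ := hc
    have hx' : f.mem x.addr ≠ 0 := by rwa [h.var]
    obtain ⟨f1, hg, hr, hp⟩ := ih (f := ⟨f.pc + 1, f.mem, f.out⟩) h1 ⟨h.var, h.arr, h.out⟩
    refine ⟨⟨f.pc + c.len + c'.len + 2, f1.mem, f1.out⟩, ?_, ⟨hr.var, hr.arr, hr.out⟩, ?_⟩
    · rw [show t + 2 = 1 + t + 1 by omega]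
      refine ((goes_one h0 ?_).trans hg).trans (goes_one (by rw [hp]; exact h2) rfl)
      simp [Instr.exec, hx']
    · simp [Cmd.len]; omega
  | @iteFalse x c c' s s' t hx _ ih =>
    rw [Cmd.code, hasCode_cons, hasCode_append, hasCode_cons, Cmd.length_code] at hc
    obtain ⟨h0, h1, h2, h3⟩ := hc
    have hx' : f.mem x.addr = 0 := by rwa [h.var]
    obtain ⟨f1, hg, hr, hp⟩ := ih (f := ⟨f.pc + c.len + 2, f.mem, f.out⟩)
      (by convert h3 using 1; simp; omega) ⟨h.var, h.arr, h.out⟩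
    refine ⟨f1, ?_, hr, ?_⟩
    · rw [add_comm]
      refine (goes_one h0 ?_).trans hg
      simp [Instr.exec, hx']
    · rw [hp]; simp [Cmd.len]; omega
  | @loopTrue x c s s' s'' t t' hx _ _ ih ih' =>
    have hc0 := hc
    rw [Cmd.code, hasCode_cons, hasCode_append, hasCode_cons, Cmd.length_code] at hc
    obtain ⟨h0, h1, h2, -⟩ := hc
    have hx' : f.mem x.addr ≠ 0 := by rwa [h.var]
    obtain ⟨f1, hg, hr, hp⟩ := ih (f := ⟨f.pc + 1, f.mem, f.out⟩) h1 ⟨h.var, h.arr, h.out⟩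
    obtain ⟨f2, hg', hr', hp'⟩ := ih' (f := ⟨f.pc, f1.mem, f1.out⟩) hc0
      ⟨hr.var, hr.arr, hr.out⟩
    refine ⟨f2, ?_, hr', hp'⟩
    rw [show t + 2 + t' = 1 + t + 1 + t' by omega]
    refine (((goes_one h0 ?_).trans hg).trans (goes_one (by rw [hp]; exact h2) rfl)).trans hg'
    simp [Instr.exec, hx']
  | @loopFalse x c s hx =>
    rw [Cmd.code, hasCode_cons] at hc
    have hx' : f.mem x.addr = 0 := by rwa [h.var]
    refine ⟨⟨f.pc + c.len + 2, f.mem, f.out⟩, goes_one hc.1 ?_, ⟨h.var, h.arr, h.out⟩, ?_⟩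
    · simp [Instr.exec, hx']
    · simp [Cmd.len]; omega

/-- The state in which all variables and array entries are `0`. -/
def St.init : St := ⟨fun _ => 0, fun _ _ => 0, []⟩

/-- The machine halts by running off the end of the translated command. -/
theorem Exec.haltsWithin {inp : Input} {c : Cmd} {s : St} {t t' : ℕ}
    (he : Exec inp c St.init t s) (ht : t ≤ t') : HaltsWithin (c.code 0) inp t' s.out := by
  obtain ⟨f, hg, hr, hp⟩ := he.goes (prog := c.code 0) (f := Config.init)
    (fun i _ => by simp [Config.init]) ⟨fun _ => rfl, fun _ _ => rfl, rfl⟩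
  have hs : step (c.code 0) inp f = none := by
    have : (c.code 0)[f.pc]? = none := by
      rw [List.getElem?_eq_none_iff, hp, Cmd.length_code]; simp [Config.init]
    simp [step, this]
  have hstay : ∀ k, (next (c.code 0) inp)^[k] f = f := fun k =>
    Function.iterate_fixed (by simp [next, hs]) k
  have hrun : run (c.code 0) inp t' = f := by
    obtain ⟨k, rfl⟩ := Nat.exists_eq_add_of_le ht
    exact hg.trans (hstay k)
  exact ⟨by rw [hrun, hs], by rw [hrun, hr.out]⟩

/-! ### Verification of commands -/

/-- From `s`, the command `c` terminates after at most `B` steps in a state satisfying `Q`. -/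
def Tri (inp : Input) (c : Cmd) (s : St) (B : ℕ) (Q : St → Prop) : Prop :=
  ∃ t s', Exec inp c s t s' ∧ t ≤ B ∧ Q s'

variable {inp : Input} {c c' : Cmd} {s : St} {B B' : ℕ} {Q Q' : St → Prop}

theorem Tri.mono (h : Tri inp c s B Q) (hB : B ≤ B') (hQ : ∀ s', Q s' → Q' s') :
    Tri inp c s B' Q' := by
  obtain ⟨t, s', he, ht, hq⟩ := h
  exact ⟨t, s', he, ht.trans hB, hQ _ hq⟩

theorem Tri.ops (l : List Op) (hB : opsCost l ≤ B) (h : Q (runOps inp l s)) :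
    Tri inp (.ops l) s B Q := ⟨_, _, .ops l s, hB, h⟩

theorem Tri.seq (h : Tri inp c s B fun s' => Tri inp c' s' B' Q) :
    Tri inp (.seq c c') s (B + B') Q := by
  obtain ⟨t, s', he, ht, t', s'', he', ht', hq⟩ := h
  exact ⟨_, _, .seq he he', by omega, hq⟩

theorem Tri.ite {x : Var} (h : s.v x ≠ 0 → Tri inp c s B Q) (h' : s.v x = 0 → Tri inp c' s B Q) :
    Tri inp (.ite x c c') s (B + 2) Q := by
  by_cases hx : s.v x = 0
  · obtain ⟨t, s', he, ht, hq⟩ := h' hx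
    exact ⟨_, _, .iteFalse hx he, by omega, hq⟩
  · obtain ⟨t, s', he, ht, hq⟩ := h hx
    exact ⟨_, _, .iteTrue hx he, by omega, hq⟩

end RAM

/-! ### Items, inference rules and the inference engine -/

namespace RAM

/-- Kinds of items. An item consists of a kind, a position `q` of the syntax tree and a node `v`
(which is `0` if the kind does not need a node).
* `req`: the query at `q` is to be evaluated from `v`;
* `ans`: `v` is an answer of the query at `q`;
* `endGood`: a path that ends at `q` in `v` can be completed to a witness of the enclosing filter;
* `startGood`: from `v`, the query at `q` leads to a node that is good as an end;
* `all`: the query at `q` is to be evaluated without start set;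
* `every`: every node is good as a start of the query at `q`;
* `everyEx`: every node satisfies the filter `[P]` at `q`;
* `spine`: the query at `q` is to be evaluated from the start set of the whole query. -/
inductive Kind where
  | req | ans | endGood | startGood | all | every | everyEx | spine
  deriving DecidableEq

/-- The number of a kind. -/
def Kind.code : Kind → ℕ
  | .req => 0 | .ans => 1 | .endGood => 2 | .startGood => 3
  | .all => 4 | .every => 5 | .everyEx => 6 | .spine => 7

theorem Kind.code_lt (k : Kind) : k.code < 8 := by cases k <;> simp [Kind.code]

theorem Kind.code_injective : Function.Injective Kind.code := by
  intro x y h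
  cases x <;> cases y <;> first | rfl | (simp [Kind.code] at h)

/-- Items: the facts that the machine derives. -/
@[ext]
structure Item where
  k : Kind
  q : ℕ
  v : ℕ
  deriving DecidableEq

/-- The range of the positions and nodes of items. -/
def Item.Valid (N n : ℕ) (x : Item) : Prop := x.q < N ∧ x.v ≤ n

/-- The number of an item. -/
def Item.key (n : ℕ) (x : Item) : ℕ := 8 * (x.q * (n + 1) + x.v) + x.k.code

theorem Item.key_injective {N n : ℕ} {x y : Item} (hx : x.Valid N n) (hy : y.Valid N n)
    (h : x.key n = y.key n) : x = y := by
  have h1 := x.k.code_lt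
  have h2 := y.k.code_lt
  have hx := hx.2
  have hy := hy.2
  unfold Item.key at h
  have hk : x.k.code = y.k.code := by omega
  have hm : x.q * (n + 1) + x.v = y.q * (n + 1) + y.v := by omega
  have hq : x.q = y.q := by
    have e1 : (x.q * (n + 1) + x.v) / (n + 1) = x.q := by
      rw [mul_comm, Nat.mul_add_div (by omega), Nat.div_eq_of_lt (by omega), add_zero]
    have e2 : (y.q * (n + 1) + y.v) / (n + 1) = y.q := by
      rw [mul_comm, Nat.mul_add_div (by omega), Nat.div_eq_of_lt (by omega), add_zero]
    rw [← e1, ← e2, hm]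
  have hv : x.v = y.v := by rw [hq] at hm; omega
  exact Item.ext (Kind.code_injective hk) hq hv

/-- An enumeration of the entries of a table at the arguments `x`, `y`, `z`, one of which may be the
counter `Var.idx`. The value of `sub` is subtracted from the entries. The enumeration ends before the
first entry `0`, and already after the first entry if `once` holds. -/
structure Loop where
  tbl : Table
  x : Var
  y : Var
  z : Var
  sub : Var
  once : Bool

/-- Inference rules. A rule applies to items of kind `kind` whose position has a suitable tag (of
itself or of its parent) and is on a suitable side of its parent. For every element of the enumeration
`loop`, the conclusion may be derived if the premise is derived. -/
structure Rule where
  kind : Kind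
  tagVar : Var
  tags : List ℕ
  sides : List ℕ
  loop : Loop
  premKind : Kind
  premPos : Var
  premNode : Var
  conKind : Kind
  conPos : Var
  conNode : Var

/-- The content of the variables when an item is processed; `rp` tells right children from left ones
(see `IsRightParent`). -/
def env (inp : Input) (rp : ℕ → ℕ) (x : Item) : Var → ℕ
  | .kind => x.k.code
  | .pos => x.q
  | .node => x.v
  | .tag => inp .tag x.q 0 0
  | .left => inp .left x.q 0 0
  | .right => inp .right x.q 0 0
  | .par => if rp x.q = 0 then x.q - 1 else rp x.q - 1
  | .side => if rp x.q = 0 then 0 else 1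
  | .ptag => inp .tag (if rp x.q = 0 then x.q - 1 else rp x.q - 1) 0 0
  | .pleft => inp .left (if rp x.q = 0 then x.q - 1 else rp x.q - 1) 0 0
  | .pright => inp .right (if rp x.q = 0 then x.q - 1 else rp x.q - 1) 0 0
  | _ => 0

/-- `rp` maps every right child to the number of its parent plus `1`, every other position to `0`, and
the root to the number of a fictitious parent without tag, plus `1`. -/
structure IsRightParent (inp : Input) (N : ℕ) (rp : ℕ → ℕ) : Prop where
  root : rp 0 = N + 1
  right : ∀ i, i < N → inp .right i 0 0 ≠ 0 → rp (inp .right i 0 0) = i + 1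
  left : ∀ x, x ≠ 0 → (∀ i, i < N → inp .right i 0 0 ≠ x) → rp x = 0

/-- The entry number `j` of an enumeration. -/
def Loop.val (inp : Input) (e : Var → ℕ) (l : Loop) (j : ℕ) : ℕ :=
  inp l.tbl (Function.update e .idx j l.x) (Function.update e .idx j l.y)
    (Function.update e .idx j l.z) - Function.update e .idx j l.sub

/-- The second component of the entry number `j` of an enumeration; only meaningful for
enumerations of edges. -/
def Loop.val' (inp : Input) (e : Var → ℕ) (l : Loop) (j : ℕ) : ℕ :=
  inp .edgeTgt (Function.update e .idx j l.x) (Function.update e .idx j l.y)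
    (Function.update e .idx j l.z)

/-- The number of elements of an enumeration. -/
noncomputable def Loop.length (inp : Input) (e : Var → ℕ) (l : Loop) : ℕ :=
  if l.once then (if l.val inp e 0 = 0 then 0 else 1) else sInf {j | l.val inp e j = 0}

/-- The enumeration ends. -/
def Loop.Ends (inp : Input) (e : Var → ℕ) (l : Loop) : Prop :=
  l.once = true ∨ ∃ j, l.val inp e j = 0

/-- The variables while an element of an enumeration is processed. -/
def Loop.env (inp : Input) (e : Var → ℕ) (l : Loop) (j : ℕ) : Var → ℕ :=
  Function.update (Function.update e .fst (l.val inp e j - 1)) .snd (l.val' inp e j - 1)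

/-- The pair of premise and conclusion of a rule at an element of the enumeration. -/
def Rule.inst (inp : Input) (e : Var → ℕ) (r : Rule) (j : ℕ) : Item × Item :=
  (⟨r.premKind, r.loop.env inp e j r.premPos, r.loop.env inp e j r.premNode⟩,
    ⟨r.conKind, r.loop.env inp e j r.conPos, r.loop.env inp e j r.conNode⟩)

/-- The rule is applicable. -/
def Rule.Fires (e : Var → ℕ) (r : Rule) : Prop :=
  e .kind = r.kind.code ∧ e r.tagVar ∈ r.tags ∧ e .side ∈ r.sides

instance (e : Var → ℕ) (r : Rule) : Decidable (r.Fires e) := by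
  unfold Rule.Fires; infer_instance

/-- The implications between items that are given by a rule. -/
noncomputable def Rule.acts (inp : Input) (e : Var → ℕ) (r : Rule) : List (Item × Item) :=
  if r.Fires e then (List.range (r.loop.length inp e)).map (r.inst inp e) else []

/-- Variables that hold the data of the item that is being processed. -/
def Var.IsReg : Var → Bool
  | .zero | .kind | .pos | .node | .tag | .left | .right | .par | .ptag | .side | .pleft
  | .pright => true
  | _ => false

/-- A rule refers only to variables that hold data of the current item or of the enumeration. -/
def Rule.WF (r : Rule) : Bool :=
  r.tagVar.IsReg && (r.loop.x.IsReg || r.loop.x = .idx) && (r.loop.y.IsReg || r.loop.y = .idx) &&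
    (r.loop.z.IsReg || r.loop.z = .idx) && (r.loop.sub.IsReg || r.loop.sub = .idx) &&
    (r.premPos.IsReg) && (r.premNode.IsReg || r.premNode = .fst || r.premNode = .snd) &&
    (r.conPos.IsReg) && (r.conNode.IsReg || r.conNode = .fst || r.conNode = .snd)

/-- The progress of the machine: the processed items, the items that are derived but not processed,
and the implications that wait for their premise. -/
structure Progress where
  done : List Item
  pend : List Item
  wait : List (Item × Item)

/-- The items that have been derived. -/
def Progress.Marked (g : Progress) (x : Item) : Prop := x ∈ g.done ++ g.pend

instance (g : Progress) (x : Item) : Decidable (g.Marked x) := by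
  unfold Progress.Marked; infer_instance

/-- Deriving an item. -/
def Progress.derive (g : Progress) (y : Item) : Progress :=
  if g.Marked y then g else { g with pend := g.pend ++ [y] }

/-- Adding an implication. -/
def Progress.watch (g : Progress) (py : Item × Item) : Progress :=
  if g.Marked py.1 then g.derive py.2 else { g with wait := py :: g.wait }

/-- The conclusions that wait for `x`. -/
def Progress.waiting (g : Progress) (x : Item) : List Item :=
  (g.wait.filter fun py => py.1 = x).map Prod.snd

/-- Taking the first item from the queue. -/
def Progress.pop (g : Progress) (x : Item) (rest : List Item) : Progress :=
  ⟨g.done ++ [x], rest, g.wait.filter fun py => py.1 ≠ x⟩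

/-- The linked list that starts at `ptr` has the entries `l`. -/
def Chain (ck cn : ℕ → ℕ) (bound : ℕ) : ℕ → List ℕ → Prop
  | ptr, [] => ptr = 0
  | ptr, y :: l => ptr ≠ 0 ∧ ptr < bound ∧ ck ptr = y ∧ Chain ck cn bound (cn ptr) l

/-- Adding list cells beyond `b` does not affect a linked list below `b`. -/
theorem Chain.congr {ck cn ck' cn' : ℕ → ℕ} {b b' : ℕ} (hb : b ≤ b')
    (h : ∀ i, i < b → ck' i = ck i ∧ cn' i = cn i) {ptr : ℕ} {l : List ℕ}
    (hc : Chain ck cn b ptr l) : Chain ck' cn' b' ptr l := by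
  induction l generalizing ptr with
  | nil => exact hc
  | cons y l ih =>
    obtain ⟨h1, h2, h3, h4⟩ := hc
    refine ⟨h1, by omega, by rw [(h _ h2).1, h3], ?_⟩
    rw [(h _ h2).2]
    exact ih h4

/-- The components of the item `x` are stored under its number. -/
def Stored (n : ℕ) (s : St) (x : Item) : Prop :=
  s.a .itemKind (x.key n) = x.k.code ∧ s.a .itemPos (x.key n) = x.q ∧
    s.a .itemNode (x.key n) = x.v

/-- The state `s` represents the progress `g`. -/
structure Rep (N n : ℕ) (rp : ℕ → ℕ) (s : St) (g : Progress) : Prop where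
  zero : s.v .zero = 0
  one : s.v .one = 1
  stride : s.v .stride = n + 1
  hd : s.v .hd = g.done.length
  tl : s.v .tl = (g.done ++ g.pend).length
  base : ∀ q, q < N → s.a .base q = q * (n + 1)
  rpar : ∀ q, q < N → s.a .rpar q = rp q
  queue : ∀ i x, (g.done ++ g.pend)[i]? = some x → s.a .queue i = x.key n
  mark : ∀ x : Item, x.Valid N n → (s.a .mark (x.key n) ≠ 0 ↔ g.Marked x)
  stored : ∀ x, g.Marked x → Stored n s x
  storedWait : ∀ py ∈ g.wait, Stored n s py.2
  valid : ∀ x, g.Marked x → x.Valid N n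
  validWait : ∀ py ∈ g.wait, py.2.Valid N n
  cells : s.v .cells ≠ 0
  chain : ∀ x : Item, x.Valid N n → x ∉ g.done →
    Chain (s.a .cellKey) (s.a .cellNext) (s.v .cells) (s.a .head (x.key n))
      ((g.waiting x).map (Item.key n))
  out : s.out = (g.done.filter fun x => x.k = .ans ∧ x.q = 0).map Item.v

/-- The code for `Progress.derive`. -/
def deriveCmd : Cmd :=
  .seq (.ops [.get .t1 .mark .concl])
    (.ite .t1 (.ops []) (.ops [.put .mark .concl .one, .put .queue .tl .concl, .add .tl .tl .one]))

theorem tri_deriveCmd {inp : Input} {N n : ℕ} {rp : ℕ → ℕ} {s : St} {g : Progress} {y : Item}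
    (h : Rep N n rp s g) (hy : y.Valid N n) (hc : s.v .concl = y.key n) (hs : Stored n s y) :
    Tri inp deriveCmd s 40 fun s' => Rep N n rp s' (g.derive y) ∧
      (∀ x, x ≠ .t1 → x ≠ .tl → s'.v x = s.v x) ∧
      (∀ A, A ≠ .mark → A ≠ .queue → s'.a A = s.a A) := by
  have hm := h.mark y hy
  refine Tri.mono (B := 9 + (29 + 2)) (Tri.seq (Tri.ops _ (by simp [opsCost, Op.code, addrCode])
    (Tri.ite ?_ ?_))) (by norm_num) (fun s' h => h)
  · intro ht
    refine Tri.ops _ (by simp [opsCost]) ?_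
    simp [runOps, Op.run, St.set, hc] at ht
    have hmk : g.Marked y := hm.1 ht
    simp only [runOps, List.foldl, Op.run, St.set, Progress.derive, if_pos hmk]
    refine ⟨⟨h.zero, h.one, h.stride, h.hd, h.tl, h.base, h.rpar, h.queue, h.mark, h.stored,
      h.storedWait, h.valid, h.validWait, h.cells, h.chain, h.out⟩, ?_, ?_⟩
    · intro x hx _; simp [hx]
    · intros; trivial
  · intro ht
    refine Tri.ops _ (by simp [opsCost, Op.code, addrCode]) ?_
    simp [runOps, Op.run, St.set, hc] at ht
    have hmk : ¬ g.Marked y := fun h => (hm.2 h) ht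
    have hmk' : ∀ x, Progress.Marked { g with pend := g.pend ++ [y] } x ↔ g.Marked x ∨ x = y := by
      intro x; simp [Progress.Marked, or_assoc]
    simp only [runOps, List.foldl, Op.run, St.set, St.setArr, Progress.derive, if_neg hmk]
    refine ⟨⟨by simp [h.zero], by simp [h.one], by simp [h.stride], by simp [h.hd], ?_,
      by simpa using h.base, by simpa using h.rpar, ?_, ?_, ?_, ?_, ?_,
      h.validWait, by simpa using h.cells, ?_, h.out⟩, ?_, ?_⟩
    · simp [h.tl, h.one]; omega
    · intro i x hx
      rw [← List.append_assoc] at hx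
      have htl := h.tl
      simp only [Function.update_apply]
      simp only [reduceCtorEq, if_false, if_true, htl]
      by_cases hi : i < (g.done ++ g.pend).length
      · rw [List.getElem?_append_left hi] at hx
        rw [Function.update_of_ne (by omega)]
        exact h.queue i x hx
      · rw [List.getElem?_append_right (by simpa using hi)] at hx
        have hi' : i = (g.done ++ g.pend).length := by
          have := (List.getElem?_eq_some_iff.1 hx).1
          simp at this hi ⊢; omega
        subst hi'
        simp at hx
        simp [hx, hc]
    · intro x hx
      rw [hmk']
      simp only [Function.update_apply]
      simp only [reduceCtorEq, if_false, if_true, hc]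
      by_cases hxy : x = y
      · subst hxy; simp [h.one]
      · rw [Function.update_of_ne (fun e => hxy (Item.key_injective hx hy e))]
        rw [h.mark x hx]; simp [hxy]
    · intro x hx
      rcases (hmk' x).1 hx with hx | rfl
      · simpa [Stored] using h.stored x hx
      · simpa [Stored] using hs
    · simpa [Stored] using h.storedWait
    · intro x hx
      rcases (hmk' x).1 hx with hx | rfl
      · exact h.valid x hx
      · exact hy
    · simpa [Progress.waiting] using h.chain
    · intro x h1 h2; simp [h1, h2]
    · intro A h1 h2; simp [h1, h2]

/-- The code for `Progress.watch`. -/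
def watchCmd : Cmd :=
  .seq (.ops [.get .t1 .mark .prem])
    (.ite .t1 deriveCmd
      (.ops [.get .t2 .head .prem, .put .cellKey .cells .concl, .put .cellNext .cells .t2,
        .put .head .prem .cells, .add .cells .cells .one]))

/-- Variables that are not changed while an implication is added. -/
def Var.Kept (x : Var) : Bool := x.IsReg || x = .idx || x = .fst || x = .snd || x = .go

/-- Adding an implication takes constant time, whether its premise is derived or not. -/
theorem tri_watchCmd {inp : Input} {N n : ℕ} {rp : ℕ → ℕ} {s : St} {g : Progress} {p y : Item}
    (h : Rep N n rp s g) (hp : p.Valid N n) (hy : y.Valid N n) (hpk : s.v .prem = p.key n)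
    (hc : s.v .concl = y.key n) (hs : Stored n s y) :
    Tri inp watchCmd s 60 fun s' => Rep N n rp s' (g.watch (p, y)) ∧
      (∀ x : Var, x.Kept → s'.v x = s.v x) := by
  have hm := h.mark p hp
  refine Tri.mono (B := 9 + (49 + 2)) (Tri.seq (Tri.ops _ (by simp [opsCost, Op.code, addrCode])
    (Tri.ite ?_ ?_))) (by norm_num) (fun s' h => h)
  · intro ht
    simp [runOps, Op.run, St.set, hpk] at ht
    have hmk : g.Marked p := hm.1 ht
    simp only [Progress.watch, if_pos hmk]
    refine Tri.mono (tri_deriveCmd (rp := rp) (g := g) (y := y) ?_ hy ?_ ?_) (by norm_num) ?_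
    · simp only [runOps, List.foldl, Op.run, St.set]
      exact ⟨h.zero, h.one, h.stride, h.hd, h.tl, h.base, h.rpar, h.queue, h.mark, h.stored,
        h.storedWait, h.valid, h.validWait, h.cells, h.chain, h.out⟩
    · simp [runOps, Op.run, St.set, hc]
    · exact hs
    · rintro s' ⟨h1, h2, h3⟩
      refine ⟨h1, fun x hx => ?_⟩
      have e1 : x ≠ .t1 := by rintro rfl; simp [Var.Kept, Var.IsReg] at hx
      have e2 : x ≠ .tl := by rintro rfl; simp [Var.Kept, Var.IsReg] at hx
      rw [h2 x e1 e2]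
      simp [runOps, Op.run, St.set, e1]
  · intro ht
    refine Tri.ops _ (by simp [opsCost, Op.code, addrCode]) ?_
    simp [runOps, Op.run, St.set, hpk] at ht
    have hmk : ¬ g.Marked p := fun h => (hm.2 h) ht
    simp only [runOps, List.foldl, Op.run, St.set, St.setArr, Progress.watch, if_neg hmk]
    refine ⟨⟨by simp [h.zero], by simp [h.one], by simp [h.stride], by simp [h.hd], by simp [h.tl],
      by simpa using h.base, by simpa using h.rpar, by simpa using h.queue,
      by simpa [Progress.Marked] using h.mark,
      by simpa [Stored, Progress.Marked] using h.stored, ?_, h.valid, ?_, by simp [h.one], ?_, h.out⟩, ?_⟩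
    · intro py hpy
      rcases List.mem_cons.1 hpy with rfl | hpy
      · simpa [Stored] using hs
      · simpa [Stored] using h.storedWait py hpy
    · intro py hpy
      rcases List.mem_cons.1 hpy with rfl | hpy
      · exact hy
      · exact h.validWait py hpy
    · intro x hx hxd
      have hch := h.chain x hx hxd
      have hcong : ∀ i, i < s.v .cells →
          Function.update (s.a .cellKey) (s.v .cells) (y.key n) i = s.a .cellKey i ∧
          Function.update (s.a .cellNext) (s.v .cells) (s.a .head (p.key n)) i =
            s.a .cellNext i := by
        intro i hi
        rw [Function.update_of_ne (by omega), Function.update_of_ne (by omega)]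
        exact ⟨rfl, rfl⟩
      simp [h.one, hpk, hc]
      by_cases hxp : x = p
      · subst hxp
        rw [Progress.waiting, List.map_map] at hch
        simp [Progress.waiting, Chain, h.cells]
        exact Chain.congr (by omega) hcong hch
      · rw [Function.update_of_ne (fun e => hxp (Item.key_injective hx hp e))]
        simp only [Progress.waiting, List.filter_cons, decide_eq_true_eq, if_neg (Ne.symm hxp)]
        exact Chain.congr (by omega) hcong hch
    · intro x hx
      cases x <;> simp [Var.Kept, Var.IsReg] at hx <;> simp

end RAM

namespace RAM

/-! ### Code for the inference engine -/

/-- `s'` differs from `s` only in temporary variables. -/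
structure St.Sim (s s' : St) : Prop where
  arr : s'.a = s.a
  out : s'.out = s.out
  var : ∀ x, x ≠ .t1 → x ≠ .t2 → x ≠ .t3 → s'.v x = s.v x

theorem St.Sim.trans {s s' s'' : St} (h : s.Sim s') (h' : s'.Sim s'') : s.Sim s'' :=
  ⟨h'.arr.trans h.arr, h'.out.trans h.out, fun x h1 h2 h3 => by
    rw [h'.var x h1 h2 h3, h.var x h1 h2 h3]⟩

/-- Global variables of the engine. -/
def Var.IsGlobal : Var → Bool
  | .zero | .one | .stride | .hd | .tl | .cells => true
  | _ => false

theorem Rep.congr {N n : ℕ} {rp : ℕ → ℕ} {s s' : St} {g : Progress} (h : Rep N n rp s g)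
    (ha : s'.a = s.a) (ho : s'.out = s.out) (hv : ∀ x : Var, x.IsGlobal → s'.v x = s.v x) :
    Rep N n rp s' g := by
  obtain ⟨v, a, o⟩ := s
  obtain ⟨v', a', o'⟩ := s'
  simp only at ha ho hv
  subst ha ho
  exact ⟨(hv _ rfl).trans h.zero, (hv _ rfl).trans h.one, (hv _ rfl).trans h.stride,
    (hv _ rfl).trans h.hd, (hv _ rfl).trans h.tl, h.base, h.rpar, h.queue, h.mark, h.stored,
    h.storedWait, h.valid, h.validWait, (hv .cells rfl).trans_ne h.cells,
    by simp only [hv .cells rfl]; exact h.chain, h.out⟩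

theorem Rep.sim {N n : ℕ} {rp : ℕ → ℕ} {s s' : St} {g : Progress} (h : Rep N n rp s g)
    (hs : s.Sim s') : Rep N n rp s' g :=
  h.congr hs.arr hs.out fun x hx => hs.var x (by rintro rfl; simp [Var.IsGlobal] at hx)
    (by rintro rfl; simp [Var.IsGlobal] at hx) (by rintro rfl; simp [Var.IsGlobal] at hx)

/-- The variables with data of the current item have the values `e`. -/
def Regs (s : St) (e : Var → ℕ) : Prop := ∀ x : Var, x.IsReg → s.v x = e x

theorem Regs.sim {s s' : St} {e : Var → ℕ} (h : Regs s e) (hs : s.Sim s') : Regs s' e :=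
  fun x hx => (hs.var x (by rintro rfl; simp [Var.IsReg] at hx)
    (by rintro rfl; simp [Var.IsReg] at hx) (by rintro rfl; simp [Var.IsReg] at hx)).trans (h x hx)

/-- Execute `c` if the value of `x` is in `l`. -/
def memCmd (x : Var) (l : List ℕ) (c : Cmd) : Cmd :=
  l.foldr (fun k rest => .seq (.ops [.const .t1 k, .sub .t2 x .t1, .sub .t3 .t1 x,
    .add .t1 .t2 .t3]) (.ite .t1 rest c)) (.ops [])

/-- The three subtractions in `memCmd` compute the distance between the values of `x` and `t1`, which
is `0` exactly if they are equal. -/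
theorem tri_memCmd {inp : Input} {x : Var} {l : List ℕ} {c : Cmd} {s : St} {B : ℕ} {Q : St → Prop}
    (hx : x.IsReg) (h1 : s.v x ∈ l → ∀ s', s.Sim s' → Tri inp c s' B Q)
    (h2 : s.v x ∉ l → ∀ s', s.Sim s' → Q s') : Tri inp (memCmd x l c) s (B + 6 * l.length) Q := by
  induction l generalizing s with
  | nil => exact Tri.ops _ (by simp [opsCost]) (h2 (by simp) _ ⟨rfl, rfl, fun _ _ _ _ => rfl⟩)
  | cons k l ih =>
    have e1 : x ≠ .t1 := by rintro rfl; simp [Var.IsReg] at hx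
    have e2 : x ≠ .t2 := by rintro rfl; simp [Var.IsReg] at hx
    have e3 : x ≠ .t3 := by rintro rfl; simp [Var.IsReg] at hx
    set s1 := runOps inp [.const .t1 k, .sub .t2 x .t1, .sub .t3 .t1 x, .add .t1 .t2 .t3] s with hs1
    have hsim : s.Sim s1 := by
      refine ⟨rfl, rfl, fun y h1 h2 h3 => ?_⟩
      simp [hs1, runOps, Op.run, St.set, h1, h2, h3]
    have ht : s1.v .t1 = (s.v x - k) + (k - s.v x) := by
      simp [hs1, runOps, Op.run, St.set, e1, e2]
    have hv : s1.v x = s.v x := hsim.var x e1 e2 e3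
    refine Tri.mono (B := 4 + (B + 6 * l.length + 2)) (Tri.seq (Tri.ops _
      (by simp [opsCost, Op.code]) (Tri.ite ?_ ?_))) (by simp; omega) (fun _ h => h)
    · intro hne
      rw [← hs1, ht] at hne
      have hne : s.v x ≠ k := by omega
      refine ih (fun hm s' hs' => ?_) (fun hm s' hs' => ?_)
      · rw [← hs1, hv] at hm
        exact h1 (List.mem_cons_of_mem _ hm) _ (hsim.trans hs')
      · rw [← hs1, hv] at hm
        exact h2 (by simp [hm, hne]) _ (hsim.trans hs')
    · intro heq
      rw [← hs1, ht] at heq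
      have heq : s.v x = k := by omega
      exact (h1 (by simp [heq]) _ hsim).mono (by omega) fun _ h => h

theorem Tri.loopTrue {inp : Input} {x : Var} {c : Cmd} {s : St} {B B' : ℕ} {Q : St → Prop}
    (hx : s.v x ≠ 0) (h : Tri inp c s B fun s' => Tri inp (.loop x c) s' B' Q) :
    Tri inp (.loop x c) s (B + 2 + B') Q := by
  obtain ⟨t, s', he, ht, t', s'', he', ht', hq⟩ := h
  exact ⟨_, _, .loopTrue hx he he', by omega, hq⟩

theorem Tri.loopFalse {inp : Input} {x : Var} {c : Cmd} {s : St} {Q : St → Prop}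
    (hx : s.v x = 0) (h : Q s) : Tri inp (.loop x c) s 1 Q :=
  ⟨_, _, .loopFalse hx, le_rfl, h⟩

/-- Derive the items of a linked list. -/
def waitCmd : Cmd :=
  .loop .cur (.seq (.ops [.get .concl .cellKey .cur, .get .cur .cellNext .cur]) deriveCmd)

/-- The list may be traversed while items are derived, since deriving changes neither list cells nor
the components that are stored for an item. -/
theorem tri_waitCmd {inp : Input} {N n : ℕ} {rp : ℕ → ℕ} {e : Var → ℕ} (l : List Item) {s : St}
    {g : Progress} (h : Rep N n rp s g) (hr : Regs s e)
    (hl : ∀ y ∈ l, y.Valid N n ∧ Stored n s y)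
    (hc : Chain (s.a .cellKey) (s.a .cellNext) (s.v .cells) (s.v .cur) (l.map (Item.key n))) :
    Tri inp waitCmd s (60 * l.length + 1)
      fun s' => Rep N n rp s' (l.foldl Progress.derive g) ∧ Regs s' e := by
  induction l generalizing s g with
  | nil => exact Tri.loopFalse hc ⟨h, hr⟩
  | cons y l ih =>
    obtain ⟨h1, h2, h3, h4⟩ := hc
    refine Tri.mono (B := (18 + 40) + 2 + (60 * l.length + 1)) (Tri.loopTrue h1 (Tri.seq
      (Tri.ops _ (by simp [opsCost, Op.code, addrCode]) ?_))) (by simp; omega) (fun _ h => h)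
    set s1 := runOps inp [.get .concl .cellKey .cur, .get .cur .cellNext .cur] s with hs1
    have ha : s1.a = s.a := rfl
    have hv : ∀ x, x ≠ .concl → x ≠ .cur → s1.v x = s.v x := by
      intro x h1 h2
      simp [hs1, runOps, Op.run, St.set, h1, h2]
    have hrep : Rep N n rp s1 g := h.congr rfl rfl fun x hx =>
      hv x (by rintro rfl; simp [Var.IsGlobal] at hx) (by rintro rfl; simp [Var.IsGlobal] at hx)
    have hconcl : s1.v .concl = y.key n := by
      rw [← h3]; simp [hs1, runOps, Op.run, St.set]
    have hcur : s1.v .cur = s.a .cellNext (s.v .cur) := by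
      simp [hs1, runOps, Op.run, St.set]
    refine (tri_deriveCmd hrep (hl y (by simp)).1 hconcl (hl y (by simp)).2).mono le_rfl ?_
    rintro s2 ⟨hr2, hv2, ha2⟩
    refine ih hr2 ?_ ?_ ?_
    · intro x hx
      rw [hv2 x (by rintro rfl; simp [Var.IsReg] at hx) (by rintro rfl; simp [Var.IsReg] at hx),
        hv x (by rintro rfl; simp [Var.IsReg] at hx) (by rintro rfl; simp [Var.IsReg] at hx),
        hr x hx]
    · intro z hz
      have := hl z (by simp [hz])
      refine ⟨this.1, ?_⟩
      simpa [Stored, ha2, ha] using this.2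
    · rw [ha2 _ (by simp) (by simp), ha2 _ (by simp) (by simp), hv2 _ (by simp) (by simp),
        hv2 _ (by simp) (by simp), ha, hcur, hv _ (by simp) (by simp)]
      exact h4

/-- Compute the number of an item. -/
def keyOps (d : Var) (k : Kind) (x y : Var) : List Op :=
  [.get .t1 .base x, .add .t1 .t1 y, .add .t1 .t1 .t1, .add .t1 .t1 .t1, .add .t1 .t1 .t1,
    .const .t2 k.code, .add d .t1 .t2]

/-- Compute the numbers of the premise and of the conclusion, and store the conclusion under its
number. -/
def Rule.instOps (r : Rule) : List Op :=
  keyOps .prem r.premKind r.premPos r.premNode ++ (keyOps .concl r.conKind r.conPos r.conNode ++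
    [.const .t2 r.conKind.code, .put .itemKind .concl .t2, .put .itemPos .concl r.conPos,
      .put .itemNode .concl r.conNode])

/-- One round of the enumeration of a rule. -/
def Rule.bodyCmd (r : Rule) : Cmd :=
  .seq (.ops [.read r.loop.tbl .t1 r.loop.x r.loop.y r.loop.z, .sub .fst .t1 r.loop.sub,
    .read .edgeTgt .t1 r.loop.x r.loop.y r.loop.z, .sub .snd .t1 .one])
    (.ite .fst
      (.seq (.ops [.sub .fst .fst .one]) (.seq (.ops r.instOps) (.seq watchCmd
        (.ops (if r.loop.once then [.const .go 0] else [.add .idx .idx .one])))))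
      (.ops [.const .go 0]))

/-- Apply a rule to the current item. -/
def Rule.cmd (r : Rule) : Cmd :=
  memCmd .kind [r.kind.code] (memCmd r.tagVar r.tags (memCmd .side r.sides
    (.seq (.ops [.const .idx 0, .const .go 1]) (.loop .go r.bodyCmd))))

/-- Running time of a rule apart from the rounds of its enumeration. -/
def Rule.cost (r : Rule) : ℕ := 200 + 6 * r.tags.length + 6 * r.sides.length

/-- Storing the components of the conclusion before it is derived does no harm, as they are determined
by its number. -/
theorem tri_instOps {inp : Input} {N n : ℕ} {rp : ℕ → ℕ} {s : St} {g : Progress} {r : Rule}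
    {p y : Item} (h : Rep N n rp s g) (hp : p.Valid N n) (hy : y.Valid N n)
    (hk : p.k = r.premKind) (hk' : y.k = r.conKind)
    (hpp : r.premPos.Kept ∧ s.v r.premPos = p.q) (hpn : r.premNode.Kept ∧ s.v r.premNode = p.v)
    (hcp : r.conPos.Kept ∧ s.v r.conPos = y.q) (hcn : r.conNode.Kept ∧ s.v r.conNode = y.v) :
    Tri inp (.ops r.instOps) s 60 fun s' => Rep N n rp s' g ∧
      (∀ x : Var, x.Kept → s'.v x = s.v x) ∧ s'.v .prem = p.key n ∧ s'.v .concl = y.key n ∧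
      Stored n s' y := by
  have hne : ∀ x : Var, x.Kept → x ≠ .t1 ∧ x ≠ .t2 ∧ x ≠ .prem ∧ x ≠ .concl := by
    intro x hx
    cases x <;> simp [Var.Kept, Var.IsReg] at hx <;> simp
  refine Tri.ops _ (by simp [opsCost, Op.code, addrCode, Rule.instOps, keyOps]) ?_
  obtain ⟨a1, a2, a3, a4⟩ := hne _ hpp.1
  obtain ⟨b1, b2, b3, b4⟩ := hne _ hpn.1
  obtain ⟨c1, c2, c3, c4⟩ := hne _ hcp.1
  obtain ⟨d1, d2, d3, d4⟩ := hne _ hcn.1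
  have ep : s.a .base p.q = p.q * (n + 1) := h.base _ hp.1
  have ey : s.a .base y.q = y.q * (n + 1) := h.base _ hy.1
  have kp : (s.a .base p.q + p.v + (s.a .base p.q + p.v) +
      (s.a .base p.q + p.v + (s.a .base p.q + p.v)) +
      (s.a .base p.q + p.v + (s.a .base p.q + p.v) +
      (s.a .base p.q + p.v + (s.a .base p.q + p.v))) + r.premKind.code) = p.key n := by
    rw [ep, Item.key, hk]; ring
  have ky : (s.a .base y.q + y.v + (s.a .base y.q + y.v) +
      (s.a .base y.q + y.v + (s.a .base y.q + y.v)) +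
      (s.a .base y.q + y.v + (s.a .base y.q + y.v) +
      (s.a .base y.q + y.v + (s.a .base y.q + y.v))) + r.conKind.code) = y.key n := by
    rw [ey, Item.key, hk']; ring
  simp only [Rule.instOps, keyOps, List.cons_append, List.nil_append, runOps, List.foldl, Op.run,
    St.set, St.setArr]
  simp [b1, c1, c2, c3, c4, d1, d2, d3, d4, hpp.2, hpn.2, hcp.2,
    hcn.2, kp, ky]
  refine ⟨⟨by simp [h.zero], by simp [h.one], by simp [h.stride], by simp [h.hd], by simp [h.tl],
      by simpa using h.base, by simpa using h.rpar, by simpa using h.queue,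
      by simpa using h.mark, ?_, ?_, h.valid, h.validWait, by simpa using h.cells,
      by simpa using h.chain, h.out⟩, ?_, ?_⟩
  · intro x hx
    have hs := h.stored x hx
    by_cases hxy : x = y
    · subst hxy; simp [Stored, hk']
    · have : x.key n ≠ y.key n := fun e => hxy (Item.key_injective (h.valid x hx) hy e)
      simpa [Stored, this] using hs
  · intro py hpy
    have hs := h.storedWait py hpy
    by_cases hxy : py.2 = y
    · rw [hxy]; simp [Stored, hk']
    · have : py.2.key n ≠ y.key n := fun e => hxy (Item.key_injective (h.validWait py hpy) hy e)
      simpa [Stored, this] using hs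
  · intro x hx
    obtain ⟨e1, e2, e3, e4⟩ := hne x hx
    simp [e1, e2, e3, e4]
  · simp [Stored, hk']

theorem Rule.regs_of_wf {r : Rule} (h : r.WF) : r.tagVar.IsReg ∧
    (r.loop.x.IsReg ∨ r.loop.x = .idx) ∧ (r.loop.y.IsReg ∨ r.loop.y = .idx) ∧
    (r.loop.z.IsReg ∨ r.loop.z = .idx) ∧ (r.loop.sub.IsReg ∨ r.loop.sub = .idx) ∧
    r.premPos.IsReg ∧ (r.premNode.IsReg ∨ r.premNode = .fst ∨ r.premNode = .snd) ∧
    r.conPos.IsReg ∧ (r.conNode.IsReg ∨ r.conNode = .fst ∨ r.conNode = .snd) := by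
  simpa [Rule.WF, and_assoc, or_assoc] using h

theorem Var.kept_of_isReg {x : Var} (h : x.IsReg) : x.Kept := by simp [Var.Kept, h]

/-- The start of a round reads the next entry; the second component is read even if the enumeration
is not one of edges, since it is not used then. -/
theorem tri_loopHead {inp : Input} {N n : ℕ} {rp : ℕ → ℕ} {e : Var → ℕ} {r : Rule}
    (hloop : ∀ x : Var, (x.IsReg ∨ x = .idx) → x ≠ .t1 ∧ x ≠ .fst)
    (w2 : r.loop.x.IsReg ∨ r.loop.x = .idx) (w3 : r.loop.y.IsReg ∨ r.loop.y = .idx)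
    (w4 : r.loop.z.IsReg ∨ r.loop.z = .idx) (w5 : r.loop.sub.IsReg ∨ r.loop.sub = .idx)
    {j : ℕ} {s : St} {g : Progress} (h : Rep N n rp s g) (hs : Regs s e) (hj : s.v .idx = j) :
    ∃ s1, s1 = runOps inp [.read r.loop.tbl .t1 r.loop.x r.loop.y r.loop.z,
        .sub .fst .t1 r.loop.sub, .read .edgeTgt .t1 r.loop.x r.loop.y r.loop.z,
        .sub .snd .t1 .one] s ∧ Rep N n rp s1 g ∧ Regs s1 e ∧ s1.v .idx = j ∧
      s1.v .go = s.v .go ∧ s1.v .fst = r.loop.val inp e j ∧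
      s1.v .snd = r.loop.val' inp e j - 1 := by
  have hval : ∀ x : Var, (x.IsReg ∨ x = .idx) → s.v x = Function.update e .idx j x := by
    rintro x (hx | rfl)
    · rw [Function.update_of_ne (by rintro rfl; simp [Var.IsReg] at hx), hs x hx]
    · simp [hj]
  obtain ⟨a1, a2⟩ := hloop _ w2
  obtain ⟨b1, b2⟩ := hloop _ w3
  obtain ⟨c1, c2⟩ := hloop _ w4
  obtain ⟨d1, d2⟩ := hloop _ w5
  have hone := h.one
  refine ⟨_, rfl, h.congr rfl rfl fun x hx => ?_, fun x hx => ?_, ?_, ?_, ?_, ?_⟩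
  · cases x <;> simp [Var.IsGlobal] at hx <;> simp [runOps, Op.run, St.set]
  · rw [← hs x hx]
    cases x <;> simp [Var.IsReg] at hx <;> simp [runOps, Op.run, St.set]
  · simp [runOps, Op.run, St.set, hj]
  · simp [runOps, Op.run, St.set]
  · simp [runOps, Op.run, St.set, d1, Loop.val, hval _ w2, hval _ w3, hval _ w4, hval _ w5]
  · simp [runOps, Op.run, St.set, a1, a2, b1, b2, c1, c2, Loop.val', hval _ w2, hval _ w3,
      hval _ w4, hone]

/-- The loop of a rule, when `j` elements have been processed and `m` are left. -/
theorem tri_ruleLoop {inp : Input} {N n : ℕ} {rp : ℕ → ℕ} {e : Var → ℕ} {r : Rule} (hr : r.WF)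
    (hends : r.loop.Ends inp e)
    (hv : ∀ j < r.loop.length inp e, (r.inst inp e j).1.Valid N n ∧ (r.inst inp e j).2.Valid N n)
    (m j : ℕ) (hm : j + m = r.loop.length inp e) {s : St} {g : Progress} (h : Rep N n rp s g)
    (hs : Regs s e) (hj : s.v .idx = j) (hgo : s.v .go ≠ 0) (ho : r.loop.once → j = 0) :
    Tri inp (.loop .go r.bodyCmd) s (200 * m + 100)
      fun s' => Rep N n rp s' (((List.range' j m).map (r.inst inp e)).foldl Progress.watch g) ∧
        Regs s' e := by
  obtain ⟨w1, w2, w3, w4, w5, w6, w7, w8, w9⟩ := Rule.regs_of_wf hr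
  have hloop : ∀ x : Var, (x.IsReg ∨ x = .idx) → x ≠ .t1 ∧ x ≠ .fst := by
    intro x hx
    rcases hx with hx | rfl
    · cases x <;> simp [Var.IsReg] at hx <;> simp
    · simp
  induction m generalizing s g j with
  | zero =>
    have hval : r.loop.val inp e j = 0 := by
      unfold Loop.length at hm
      by_cases hon : r.loop.once
      · rw [if_pos hon] at hm
        have := ho hon
        subst this
        by_contra hne
        rw [if_neg hne] at hm; omega
      · rw [if_neg hon] at hm
        have : sInf {j | r.loop.val inp e j = 0} ∈ {j | r.loop.val inp e j = 0} :=
          Nat.sInf_mem (hends.resolve_left hon)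
        rw [← hm] at this
        exact this
    obtain ⟨s1, hs1, hrep, hregs, -, -, hfst, -⟩ := tri_loopHead (r := r) hloop w2 w3 w4 w5 h hs hj
    refine Tri.mono (B := (4 + (1 + 2)) + 2 + 1) (Tri.loopTrue hgo (Tri.seq (Tri.ops _
      (by simp [opsCost, Op.code]) ?_))) (by omega) (fun _ h => h)
    rw [← hs1]
    refine Tri.ite (fun hne => absurd (hfst.trans hval) hne) fun _ => ?_
    refine Tri.ops _ (by simp [opsCost, Op.code]) (Tri.loopFalse ?_ ⟨?_, ?_⟩)
    · simp [runOps, Op.run, St.set]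
    · refine hrep.congr rfl rfl fun x hx => ?_
      have : x ≠ .go := by rintro rfl; simp [Var.IsGlobal] at hx
      simp [runOps, Op.run, St.set, this]
    · intro x hx
      have : x ≠ .go := by rintro rfl; simp [Var.IsReg] at hx
      simp [runOps, Op.run, St.set, this, hregs x hx]
  | succ m ih =>
    have hval : r.loop.val inp e j ≠ 0 := by
      unfold Loop.length at hm
      by_cases hon : r.loop.once
      · rw [if_pos hon] at hm
        have := ho hon
        subst this
        intro h0
        rw [if_pos h0] at hm; omega
      · rw [if_neg hon] at hm
        exact fun h0 => by
          have := Nat.sInf_le (s := {j | r.loop.val inp e j = 0}) h0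
          omega
    obtain ⟨s1, hs1, hrep, hregs, hidx, hgo1, hfst, hsnd⟩ :=
      tri_loopHead (r := r) hloop w2 w3 w4 w5 h hs hj
    refine Tri.mono (B := (4 + ((1 + (60 + (60 + 1))) + 2)) + 2 + (200 * m + 100))
      (Tri.loopTrue hgo (Tri.seq (Tri.ops _ (by simp [opsCost, Op.code]) ?_))) (by omega)
      (fun _ h => h)
    rw [← hs1]
    refine Tri.ite (fun _ => ?_) fun h0 => absurd (hfst.symm.trans h0) hval
    refine Tri.seq (Tri.ops _ (by simp [opsCost, Op.code]) ?_)
    set s2 := runOps inp [.sub .fst .fst .one] s1 with hs2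
    have hv2 : ∀ x, x ≠ .fst → s2.v x = s1.v x := fun x hx => by
      simp [hs2, runOps, Op.run, St.set, hx]
    have hrep2 : Rep N n rp s2 g := hrep.congr rfl rfl fun x hx =>
      hv2 x (by rintro rfl; simp [Var.IsGlobal] at hx)
    have hregs2 : Regs s2 e := fun x hx => by
      rw [hv2 x (by rintro rfl; simp [Var.IsReg] at hx), hregs x hx]
    have hone : s1.v .one = 1 := hrep.one
    have hfst2 : s2.v .fst = r.loop.val inp e j - 1 := by
      simp [hs2, runOps, Op.run, St.set, hfst, hone]
    have hpos : ∀ x : Var, x.IsReg → x.Kept ∧ s2.v x = r.loop.env inp e j x := fun x hx => by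
      refine ⟨Var.kept_of_isReg hx, ?_⟩
      have h1 : x ≠ .fst := by rintro rfl; simp [Var.IsReg] at hx
      have h2 : x ≠ .snd := by rintro rfl; simp [Var.IsReg] at hx
      simp [Loop.env, h1, h2, hregs2 x hx]
    have hnode : ∀ x : Var, (x.IsReg ∨ x = .fst ∨ x = .snd) →
        x.Kept ∧ s2.v x = r.loop.env inp e j x := by
      rintro x (hx | rfl | rfl)
      · exact hpos x hx
      · exact ⟨rfl, by simp [Loop.env, hfst2]⟩
      · exact ⟨rfl, by rw [hv2 _ (by simp), hsnd]; simp [Loop.env]⟩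
    obtain ⟨hvp, hvy⟩ := hv j (by omega)
    change Tri inp _ s2 (60 + (60 + 1)) _
    refine Tri.seq ((tri_instOps (r := r) hrep2 hvp hvy rfl rfl (hpos _ w6) (hnode _ w7)
      (hpos _ w8) (hnode _ w9)).mono le_rfl ?_)
    rintro s3 ⟨hrep3, hv3, hprem, hconcl, hst⟩
    refine Tri.seq ((tri_watchCmd hrep3 hvp hvy hprem hconcl hst).mono le_rfl ?_)
    rintro s4 ⟨hrep4, hv4⟩
    have hregs4 : Regs s4 e := fun x hx => by
      rw [hv4 x (Var.kept_of_isReg hx), hv3 x (Var.kept_of_isReg hx), hregs2 x hx]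
    have hidx4 : s4.v .idx = j := by
      rw [hv4 _ rfl, hv3 _ rfl, hv2 _ (by simp), hidx]
    have hgo4 : s4.v .go ≠ 0 := by
      rw [hv4 _ rfl, hv3 _ rfl, hv2 _ (by simp), hgo1]; exact hgo
    by_cases hon : r.loop.once
    · have hj0 := ho hon
      have hm0 : m = 0 := by
        unfold Loop.length at hm
        rw [if_pos hon] at hm
        split_ifs at hm
        omega
      subst hm0
      rw [if_pos hon]
      refine Tri.ops _ (by simp [opsCost, Op.code]) ((Tri.loopFalse ?_ ⟨?_, ?_⟩).mono
        (by omega) fun _ h => h)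
      · simp [runOps, Op.run, St.set]
      · change Rep N n rp _ (g.watch (r.inst inp e j))
        refine hrep4.congr rfl rfl fun x hx => ?_
        have : x ≠ .go := by rintro rfl; simp [Var.IsGlobal] at hx
        simp [runOps, Op.run, St.set, this]
      · intro x hx
        have : x ≠ .go := by rintro rfl; simp [Var.IsReg] at hx
        simp [runOps, Op.run, St.set, this, hregs4 x hx]
    · rw [if_neg hon]
      have hone4 : s4.v .one = 1 := hrep4.one
      refine Tri.ops _ (by simp [opsCost, Op.code]) ?_
      rw [List.range'_succ, List.map_cons, List.foldl_cons]
      refine ih (j + 1) (by omega) ?_ ?_ ?_ ?_ (fun h => absurd h hon)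
      · refine hrep4.congr rfl rfl fun x hx => ?_
        have : x ≠ .idx := by rintro rfl; simp [Var.IsGlobal] at hx
        simp [runOps, Op.run, St.set, this]
      · intro x hx
        have : x ≠ .idx := by rintro rfl; simp [Var.IsReg] at hx
        simp [runOps, Op.run, St.set, this, hregs4 x hx]
      · simp [runOps, Op.run, St.set, hidx4, hone4]
      · simpa [runOps, Op.run, St.set] using hgo4

theorem tri_ruleCmd {inp : Input} {N n : ℕ} {rp : ℕ → ℕ} {e : Var → ℕ} {r : Rule} (hr : r.WF)
    (hends : r.Fires e → r.loop.Ends inp e)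
    (hv : ∀ py ∈ r.acts inp e, py.1.Valid N n ∧ py.2.Valid N n) {s : St} {g : Progress}
    (h : Rep N n rp s g) (hs : Regs s e) :
    Tri inp r.cmd s (r.cost + 200 * (r.acts inp e).length)
      fun s' => Rep N n rp s' ((r.acts inp e).foldl Progress.watch g) ∧ Regs s' e := by
  obtain ⟨w1, -⟩ := Rule.regs_of_wf hr
  have hno : ¬ r.Fires e → ∀ s' : St, s.Sim s' →
      Rep N n rp s' ((r.acts inp e).foldl Progress.watch g) ∧ Regs s' e := fun hf s' hs' => by
    rw [Rule.acts, if_neg hf]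
    exact ⟨h.sim hs', hs.sim hs'⟩
  refine Tri.mono (B := 2 + (200 * (r.acts inp e).length + 100) + 6 * r.sides.length +
    6 * r.tags.length + 6 * [r.kind.code].length) (tri_memCmd rfl (fun h1 s1 hs1 => ?_)
    fun h1 => hno fun hf => h1 ?_) (by simp [Rule.cost]; omega) (fun _ h => h)
  swap
  · rw [hs _ rfl, hf.1]; simp
  refine tri_memCmd w1 (fun h2 s2 hs2 => ?_) fun h2 s2 hs2 => hno (fun hf => h2 ?_) _
    (hs1.trans hs2)
  swap
  · rw [hs.sim hs1 _ w1]; exact hf.2.1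
  refine tri_memCmd rfl (fun h3 s3 hs3 => ?_) fun h3 s3 hs3 => hno (fun hf => h3 ?_) _
    ((hs1.trans hs2).trans hs3)
  swap
  · rw [hs.sim (hs1.trans hs2) _ rfl]; exact hf.2.2
  have hf : r.Fires e := by
    rw [hs _ rfl] at h1
    rw [hs.sim hs1 _ w1] at h2
    rw [hs.sim (hs1.trans hs2) _ rfl] at h3
    exact ⟨by simpa using h1, h2, h3⟩
  have hacts : r.acts inp e =
      (List.range' 0 (r.loop.length inp e)).map (r.inst inp e) := by
    rw [Rule.acts, if_pos hf, List.range_eq_range']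
  have hlen : (r.acts inp e).length = r.loop.length inp e := by simp [hacts]
  rw [hlen, hacts]
  have hsim := (hs1.trans hs2).trans hs3
  have hne : ∀ x : Var, x.IsReg ∨ x.IsGlobal → x ≠ .idx ∧ x ≠ .go := by
    intro x hx
    cases x <;> simp [Var.IsReg, Var.IsGlobal] at hx <;> simp
  refine Tri.seq (Tri.ops _ (by simp [opsCost, Op.code]) ?_)
  refine tri_ruleLoop hr (hends hf) (fun j hj => ?_) _ 0 (by simp) ?_ ?_ ?_ ?_ (fun _ => rfl)
  · refine hv _ ?_
    rw [hacts]
    exact List.mem_map.2 ⟨j, by simpa [List.mem_range'_1] using hj, rfl⟩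
  · refine (h.sim hsim).congr rfl rfl fun x hx => ?_
    simp [runOps, Op.run, St.set, hne x (.inr hx)]
  · intro x hx
    rw [← hs.sim hsim x hx]
    simp [runOps, Op.run, St.set, hne x (.inl hx)]
  · simp [runOps, Op.run, St.set]
  · simp [runOps, Op.run, St.set]

/-- Apply a list of rules to the current item. -/
def rulesCmd (l : List Rule) : Cmd := l.foldr (fun r c => .seq r.cmd c) (.ops [])

/-- The implications between items that are given by a list of rules. -/
noncomputable def ruleActs (inp : Input) (e : Var → ℕ) (l : List Rule) : List (Item × Item) :=
  l.flatMap (Rule.acts inp e)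

theorem tri_rulesCmd {inp : Input} {N n : ℕ} {rp : ℕ → ℕ} {e : Var → ℕ} (l : List Rule)
    (hr : ∀ r ∈ l, r.WF) (hends : ∀ r ∈ l, r.Fires e → r.loop.Ends inp e)
    (hv : ∀ py ∈ ruleActs inp e l, py.1.Valid N n ∧ py.2.Valid N n) {s : St} {g : Progress}
    (h : Rep N n rp s g) (hs : Regs s e) :
    Tri inp (rulesCmd l) s ((l.map Rule.cost).sum + 200 * (ruleActs inp e l).length)
      fun s' => Rep N n rp s' ((ruleActs inp e l).foldl Progress.watch g) ∧ Regs s' e := by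
  induction l generalizing s g with
  | nil => exact Tri.ops _ (by simp [opsCost]) ⟨h, hs⟩
  | cons r l ih =>
    simp only [ruleActs, List.flatMap_cons, List.mem_append] at hv ⊢
    refine Tri.mono (B := (r.cost + 200 * (r.acts inp e).length) +
      ((l.map Rule.cost).sum + 200 * (ruleActs inp e l).length)) (Tri.seq ((tri_ruleCmd
        (hr r (by simp)) (hends r (by simp)) (fun py hpy => hv py (.inl hpy)) h hs).mono le_rfl ?_))
      (by simp [ruleActs]; omega) (fun _ h => h)
    rintro s' ⟨h1, h2⟩
    refine (ih (fun r hr' => hr r (by simp [hr'])) (fun r hr' => hends r (by simp [hr']))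
      (fun py hpy => hv py (.inr hpy)) h1 h2).mono le_rfl ?_
    rintro s'' ⟨h1, h2⟩
    rw [List.foldl_append]
    exact ⟨h1, h2⟩

end RAM

namespace RAM

/-! ### Processing an item -/

/-- Take the first item from the queue, load its data, and write it to the output if it is an answer
of the whole query. Afterwards `Var.cur` points to the list of the waiting conclusions. -/
def popCmd : Cmd :=
  .seq (.ops [.get .cur .queue .hd, .get .kind .itemKind .cur, .get .pos .itemPos .cur,
    .get .node .itemNode .cur, .read .tag .tag .pos .zero .zero,
    .read .left .left .pos .zero .zero, .read .right .right .pos .zero .zero,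
    .get .t1 .rpar .pos])
  (.seq (.ite .t1 (.ops [.const .side 1, .sub .par .t1 .one])
    (.ops [.const .side 0, .sub .par .pos .one]))
  (.seq (.ops [.read .tag .ptag .par .zero .zero, .read .left .pleft .par .zero .zero,
    .read .right .pright .par .zero .zero, .add .hd .hd .one, .get .cur .head .cur])
  (memCmd .kind [Kind.ans.code] (memCmd .pos [0] (.ops [.out .node])))))

theorem Progress.marked_pop {g : Progress} {x z : Item} {rest : List Item}
    (hp : g.pend = x :: rest) : (g.pop x rest).Marked z ↔ g.Marked z := by
  simp [Progress.pop, Progress.Marked, hp]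

/-- Taking an item from the queue removes its watch list from the waiting implications; the head of
this list remains in `Var.cur`. -/
theorem tri_popCmd {inp : Input} {N n : ℕ} {rp : ℕ → ℕ} {s : St} {g : Progress} {x : Item}
    {rest : List Item} (h : Rep N n rp s g) (hp : g.pend = x :: rest) (hx : x ∉ g.done) :
    Tri inp popCmd s 150 fun s' => Rep N n rp s' (g.pop x rest) ∧ Regs s' (env inp rp x) ∧
      (∀ y ∈ g.waiting x, y.Valid N n ∧ Stored n s' y) ∧
      Chain (s'.a .cellKey) (s'.a .cellNext) (s'.v .cells) (s'.v .cur)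
        ((g.waiting x).map (Item.key n)) := by
  have hmx : g.Marked x := by simp [Progress.Marked, hp]
  have hvx := h.valid x hmx
  obtain ⟨st1, st2, st3⟩ := h.stored x hmx
  have hq : s.a .queue (s.v .hd) = x.key n := by
    refine h.queue _ _ ?_
    rw [h.hd, hp]; simp
  have hrp : s.a .rpar x.q = rp x.q := h.rpar _ hvx.1
  have hch := h.chain x hvx hx
  have hz := h.zero
  have ho := h.one
  -- the state before the output instruction
  have key : ∀ s4 : St, s4.a = s.a → s4.out = s.out → Regs s4 (env inp rp x) →
      s4.v .hd = s.v .hd + 1 → s4.v .cur = s.a .head (x.key n) →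
      (∀ y : Var, y.IsGlobal → y ≠ .hd → s4.v y = s.v y) →
      Tri inp (memCmd .kind [Kind.ans.code] (memCmd .pos [0] (.ops [.out .node]))) s4 13
        fun s' => Rep N n rp s' (g.pop x rest) ∧ Regs s' (env inp rp x) ∧
        (∀ y ∈ g.waiting x, y.Valid N n ∧ Stored n s' y) ∧
        Chain (s'.a .cellKey) (s'.a .cellNext) (s'.v .cells) (s'.v .cur)
          ((g.waiting x).map (Item.key n)) := by
    intro s4 ha4 ho4 hr4 hhd4 hcur4 hg4
    have main : ∀ s5 : St, s4.Sim s5 → ∀ out, out = ((g.done ++ [x]).filter fun x => x.k = .ans ∧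
        x.q = 0).map Item.v → Rep N n rp { s5 with out := out } (g.pop x rest) ∧
        Regs { s5 with out := out } (env inp rp x) ∧
        (∀ y ∈ g.waiting x, y.Valid N n ∧ Stored n { s5 with out := out } y) ∧
        Chain (s5.a .cellKey) (s5.a .cellNext) (s5.v .cells) (s5.v .cur)
          ((g.waiting x).map (Item.key n)) := by
      intro s5 hs5 out hout
      have ha : s5.a = s.a := hs5.arr.trans ha4
      have hg : ∀ y : Var, y.IsGlobal → y ≠ .hd → s5.v y = s.v y := fun y hy hy' => by
        rw [← hg4 y hy hy']
        exact hs5.var y (by rintro rfl; simp [Var.IsGlobal] at hy)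
          (by rintro rfl; simp [Var.IsGlobal] at hy) (by rintro rfl; simp [Var.IsGlobal] at hy)
      refine ⟨⟨(hg _ rfl (by simp)).trans h.zero, (hg _ rfl (by simp)).trans h.one,
        (hg _ rfl (by simp)).trans h.stride, ?_, ?_, ?_, ?_, ?_, ?_, ?_, ?_, ?_, ?_, ?_, ?_, hout⟩,
        fun y hy => hr4.sim hs5 y hy, ?_, ?_⟩
      · change s5.v .hd = _
        rw [hs5.var _ (by simp) (by simp) (by simp), hhd4, h.hd]; simp [Progress.pop]
      · change s5.v .tl = _
        rw [hg _ rfl (by simp), h.tl, hp]; simp [Progress.pop]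
      · simpa [ha] using h.base
      · simpa [ha] using h.rpar
      · intro i z hi
        simp only [ha]
        refine h.queue i z ?_
        rw [hp]; simpa [Progress.pop] using hi
      · intro z hz
        rw [Progress.marked_pop hp, ← h.mark z hz]
        simp only [ha]
      · intro z hz
        rw [Progress.marked_pop hp] at hz
        simpa [Stored, ha] using h.stored z hz
      · intro py hpy
        simpa [Stored, ha] using h.storedWait py (List.mem_of_mem_filter hpy)
      · intro z hz
        rw [Progress.marked_pop hp] at hz
        exact h.valid z hz
      · intro py hpy
        exact h.validWait py (List.mem_of_mem_filter hpy)
      · rw [hg _ rfl (by simp)]; exact h.cells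
      · intro z hz hzd
        simp only [Progress.pop, List.mem_append, List.mem_singleton, not_or] at hzd
        have := h.chain z hz hzd.1
        have hw : (g.pop x rest).waiting z = g.waiting z := by
          simp only [Progress.waiting, Progress.pop, List.filter_filter]
          congr 1
          refine List.filter_congr fun py _ => ?_
          by_cases hpz : py.1 = z
          · simp [hpz, hzd.2]
          · simp [hpz]
        rw [hw]
        simpa [ha, hg .cells rfl (by simp)] using this
      · intro y hy
        obtain ⟨py, hpy, rfl⟩ := List.mem_map.1 hy
        have hpy := List.mem_of_mem_filter hpy
        exact ⟨h.validWait py hpy, by simpa [Stored, ha] using h.storedWait py hpy⟩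
      · rw [ha, hg .cells rfl (by simp), hs5.var .cur (by simp) (by simp) (by simp), hcur4]
        exact hch
    have hno : ¬ (x.k = .ans ∧ x.q = 0) → ∀ s5 : St, s4.Sim s5 →
        Rep N n rp s5 (g.pop x rest) ∧ Regs s5 (env inp rp x) ∧
        (∀ y ∈ g.waiting x, y.Valid N n ∧ Stored n s5 y) ∧
        Chain (s5.a .cellKey) (s5.a .cellNext) (s5.v .cells) (s5.v .cur)
          ((g.waiting x).map (Item.key n)) := fun hne s5 hs5 => by
      refine main s5 hs5 s5.out ?_
      rw [hs5.out, ho4, h.out, List.filter_append, List.filter_singleton]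
      simp [hne]
    refine (tri_memCmd (B := 7) rfl (fun h1 s5 hs5 => ?_) fun h1 s5 hs5 => hno (fun hc => h1 ?_)
      s5 hs5).mono (by simp) fun _ h => h
    · refine (tri_memCmd (B := 1) rfl (fun h2 s6 hs6 => Tri.ops _ (by simp [opsCost, Op.code]) ?_)
        fun h2 s6 hs6 => hno (fun hc => h2 ?_) s6 (hs5.trans hs6)).mono (by simp) fun _ h => h
      · rw [hr4 _ rfl] at h1
        rw [hr4.sim hs5 _ rfl] at h2
        have hk : x.k = .ans := Kind.code_injective (by simpa [env] using h1)
        have hq0 : x.q = 0 := by simpa [env] using h2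
        refine main s6 (hs5.trans hs6) _ ?_
        rw [(hs5.trans hs6).out, ho4, h.out, List.filter_append, List.filter_singleton,
          hr4.sim (hs5.trans hs6) _ rfl]
        simp [hk, hq0, env]
      · rw [hr4.sim hs5 _ rfl]; simp [env, hc.2]
    · rw [hr4 _ rfl]; simp [env, hc.1]
  refine Tri.mono (B := 48 + ((2 + 2) + (13 + 13))) (Tri.seq (Tri.ops _
    (by simp [opsCost, Op.code, addrCode]) (Tri.seq (Tri.ite (fun ht => ?_) fun ht => ?_))))
    (by norm_num) fun _ h => h
  all_goals
    refine Tri.ops _ (by simp [opsCost, Op.code]) (Tri.seq (Tri.ops _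
      (by simp [opsCost, Op.code, addrCode]) (key _ rfl rfl ?_ ?_ ?_ ?_)))
    · intro y hy
      simp [runOps, Op.run, St.set, hq, st2, hrp] at ht
      cases y <;> simp [Var.IsReg] at hy <;>
        simp [runOps, Op.run, St.set, hq, st1, st2, st3, hrp, hz, ho, env, ht]
    · simp [runOps, Op.run, St.set, ho]
    · simp [runOps, Op.run, St.set, hq]
    · intro y hy hy'
      cases y <;> simp [Var.IsGlobal] at hy hy' <;> simp [runOps, Op.run, St.set]

/-- The implications whose premise is available when `x` is processed. -/
noncomputable def acts (inp : Input) (rp : ℕ → ℕ) (rules : List Rule) (x : Item) :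
    List (Item × Item) := ruleActs inp (env inp rp x) rules

/-- Processing the first item of the queue. -/
noncomputable def Progress.step (inp : Input) (rp : ℕ → ℕ) (rules : List Rule) (g : Progress)
    (x : Item) (rest : List Item) : Progress :=
  (acts inp rp rules x).foldl Progress.watch ((g.waiting x).foldl Progress.derive (g.pop x rest))

/-- The code for `Progress.step`. -/
def stepCmd (rules : List Rule) : Cmd :=
  .seq popCmd (.seq waitCmd (.seq (rulesCmd rules) (.ops [.sub .go .tl .hd])))

/-- The time for processing an item, up to the part that depends on the length of enumerations. -/
def stepCost (rules : List Rule) : ℕ := 160 + (rules.map Rule.cost).sum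

/-- The time for a step: the waiting conclusions and the implications of the item cost a constant each. -/
theorem tri_stepCmd {inp : Input} {N n : ℕ} {rp : ℕ → ℕ} {s : St} {g : Progress} {x : Item}
    {rest : List Item} {rules : List Rule} (h : Rep N n rp s g) (hp : g.pend = x :: rest)
    (hx : x ∉ g.done) (hr : ∀ r ∈ rules, r.WF)
    (hends : ∀ r ∈ rules, r.Fires (env inp rp x) → r.loop.Ends inp (env inp rp x))
    (hv : ∀ py ∈ acts inp rp rules x, py.1.Valid N n ∧ py.2.Valid N n) :
    Tri inp (stepCmd rules) s (stepCost rules + 60 * (g.waiting x).length +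
      200 * (acts inp rp rules x).length)
      fun s' => Rep N n rp s' (g.step inp rp rules x rest) ∧
        s'.v .go = s'.v .tl - s'.v .hd := by
  refine Tri.mono (B := 150 + ((60 * (g.waiting x).length + 1) + (((rules.map Rule.cost).sum +
    200 * (acts inp rp rules x).length) + 1))) (Tri.seq ((tri_popCmd h hp hx).mono le_rfl ?_))
    (by simp [stepCost]; omega) fun _ h => h
  rintro s1 ⟨h1, hr1, hw1, hc1⟩
  refine Tri.seq ((tri_waitCmd _ h1 hr1 hw1 hc1).mono le_rfl ?_)
  rintro s2 ⟨h2, hr2⟩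
  refine Tri.seq ((tri_rulesCmd rules hr hends hv h2 hr2).mono le_rfl ?_)
  rintro s3 ⟨h3, -⟩
  refine Tri.ops _ (by simp [opsCost, Op.code]) ⟨h3.congr rfl rfl fun y hy => ?_, ?_⟩
  · have : y ≠ .go := by rintro rfl; simp [Var.IsGlobal] at hy
    simp [runOps, Op.run, St.set, this]
  · simp [runOps, Op.run, St.set]

/-! ### Progress of the inference engine -/

theorem Progress.derive_spec (g : Progress) (y : Item) :
    (g.derive y).done = g.done ∧ (g.derive y).wait = g.wait ∧
      ∀ z, (g.derive y).Marked z ↔ g.Marked z ∨ z = y := by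
  unfold Progress.derive
  split_ifs with h
  · exact ⟨rfl, rfl, fun z => ⟨.inl, fun hz => hz.elim id (by rintro rfl; exact h)⟩⟩
  · exact ⟨rfl, rfl, fun z => by simp [Progress.Marked, or_assoc]⟩

theorem Progress.derive_nodup {g : Progress} (h : (g.done ++ g.pend).Nodup) (y : Item) :
    ((g.derive y).done ++ (g.derive y).pend).Nodup := by
  unfold Progress.derive
  split_ifs with hy
  · exact h
  · rw [← List.append_assoc]
    exact List.nodup_append.2 ⟨h, by simp, by
      intro a ha b hb hab
      simp at hb
      subst hb hab
      exact hy ha⟩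

theorem Progress.foldl_derive_spec (l : List Item) (g : Progress) :
    (l.foldl derive g).done = g.done ∧ (l.foldl derive g).wait = g.wait ∧
      ∀ z, (l.foldl derive g).Marked z ↔ g.Marked z ∨ z ∈ l := by
  induction l generalizing g with
  | nil => simp
  | cons y l ih =>
    obtain ⟨h1, h2, h3⟩ := ih (g.derive y)
    obtain ⟨h4, h5, h6⟩ := g.derive_spec y
    refine ⟨h1.trans h4, h2.trans h5, fun z => ?_⟩
    rw [List.foldl_cons, h3, h6, List.mem_cons, or_assoc]

theorem Progress.foldl_derive_nodup (l : List Item) {g : Progress}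
    (h : (g.done ++ g.pend).Nodup) :
    ((l.foldl derive g).done ++ (l.foldl derive g).pend).Nodup := by
  induction l generalizing g with
  | nil => exact h
  | cons y l ih => exact ih (derive_nodup h y)

/-- Invariants that concern only the derived items: they are sound, and so are the waiting
implications. -/
structure Progress.Sound (S : Item → Prop) (g : Progress) : Prop where
  nodup : (g.done ++ g.pend).Nodup
  marked : ∀ x, g.Marked x → S x
  wait : ∀ py ∈ g.wait, S py.1 → S py.2

theorem Progress.watch_spec (g : Progress) (py : Item × Item) :
    (g.watch py).done = g.done ∧ (g.watch py).wait.length ≤ g.wait.length + 1 ∧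
      (∀ q ∈ g.wait, q ∈ (g.watch py).wait) ∧ (∀ z, g.Marked z → (g.watch py).Marked z) ∧
      ((g.watch py).Marked py.2 ∨ py ∈ (g.watch py).wait) := by
  unfold Progress.watch
  split_ifs with h
  · obtain ⟨h1, h2, h3⟩ := g.derive_spec py.2
    exact ⟨h1, by rw [h2]; omega, fun q hq => by rwa [h2], fun z hz => (h3 z).2 (.inl hz),
      .inl ((h3 _).2 (.inr rfl))⟩
  · exact ⟨rfl, by simp, fun q hq => List.mem_cons_of_mem _ hq, fun z hz => hz,
      .inr (by simp)⟩

theorem Progress.watch_sound {S : Item → Prop} {g : Progress} (h : g.Sound S) {py : Item × Item}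
    (hpy : S py.1 → S py.2) : (g.watch py).Sound S := by
  unfold Progress.watch
  split_ifs with hm
  · obtain ⟨h1, h2, h3⟩ := g.derive_spec py.2
    refine ⟨derive_nodup h.nodup _, fun x hx => ?_, fun q hq => h.wait q (by rwa [h2] at hq)⟩
    rcases (h3 x).1 hx with hx | rfl
    · exact h.marked x hx
    · exact hpy (h.marked _ hm)
  · refine ⟨h.nodup, h.marked, fun q hq => ?_⟩
    rcases List.mem_cons.1 hq with rfl | hq
    · exact hpy
    · exact h.wait q hq

theorem Progress.foldl_watch_spec (l : List (Item × Item)) (g : Progress) :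
    (l.foldl watch g).done = g.done ∧ (l.foldl watch g).wait.length ≤ g.wait.length + l.length ∧
      (∀ q ∈ g.wait, q ∈ (l.foldl watch g).wait) ∧
      (∀ z, g.Marked z → (l.foldl watch g).Marked z) ∧
      ∀ py ∈ l, (l.foldl watch g).Marked py.2 ∨ py ∈ (l.foldl watch g).wait := by
  induction l generalizing g with
  | nil => simp
  | cons py l ih =>
    obtain ⟨h1, h2, h3, h4, h5⟩ := ih (g.watch py)
    obtain ⟨k1, k2, k3, k4, k5⟩ := g.watch_spec py
    refine ⟨h1.trans k1, ?_, fun q hq => h3 q (k3 q hq), fun z hz => h4 z (k4 z hz), ?_⟩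
    · simp only [List.foldl_cons, List.length_cons]; omega
    · intro q hq
      rcases List.mem_cons.1 hq with rfl | hq
      · exact k5.imp (h4 _) (h3 _)
      · exact h5 q hq

theorem Progress.foldl_watch_sound {S : Item → Prop} (l : List (Item × Item)) {g : Progress}
    (h : g.Sound S) (hl : ∀ py ∈ l, S py.1 → S py.2) : (l.foldl watch g).Sound S := by
  induction l generalizing g with
  | nil => exact h
  | cons py l ih =>
    exact ih (watch_sound h (hl py (by simp))) fun q hq => hl q (by simp [hq])

/-- Invariant of the inference engine: the implications of processed items have been used, or wait
for their premise. -/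
structure Progress.Inv (S : Item → Prop) (A : Item → List (Item × Item)) (g : Progress) : Prop
    extends Progress.Sound S g where
  closed : ∀ x ∈ g.done, ∀ py ∈ A x, g.Marked py.2 ∨ (py.1 ∉ g.done ∧ py ∈ g.wait)
  wait_notMem : ∀ py ∈ g.wait, py.1 ∉ g.done

/-- A step preserves the invariant. The conclusions that had waited for `x` leave the watch lists, so
that they can be paid for when they enter them. -/
theorem Progress.inv_step {inp : Input} {rp : ℕ → ℕ} {rules : List Rule} {S : Item → Prop}
    {g : Progress} (h : g.Inv S (acts inp rp rules)) {x : Item} {rest : List Item}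
    (hp : g.pend = x :: rest) (hS : ∀ py ∈ acts inp rp rules x, S py.1 → S py.2) :
    (g.step inp rp rules x rest).Inv S (acts inp rp rules) ∧
      (g.step inp rp rules x rest).done = g.done ++ [x] ∧
      (g.step inp rp rules x rest).wait.length + (g.waiting x).length ≤
        g.wait.length + (acts inp rp rules x).length := by
  have hx : S x := h.marked x (by simp [Progress.Marked, hp])
  set g1 := g.pop x rest with hg1
  set g2 := (g.waiting x).foldl Progress.derive g1 with hg2
  have hm1 : ∀ z, g1.Marked z ↔ g.Marked z := fun z => marked_pop hp
  obtain ⟨d2, w2, m2⟩ := foldl_derive_spec (g.waiting x) g1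
  rw [← hg2] at d2 w2 m2
  have hmw : ∀ y ∈ g.waiting x, S y := by
    intro y hy
    obtain ⟨py, hpy, rfl⟩ := List.mem_map.1 hy
    obtain ⟨hpy, he⟩ := List.mem_filter.1 hpy
    exact h.wait py hpy (by rw [of_decide_eq_true he]; exact hx)
  have hs2 : g2.Sound S := by
    refine ⟨foldl_derive_nodup _ ?_, fun z hz => ?_, fun py hpy => ?_⟩
    · have := h.nodup
      rw [hp] at this
      simpa [hg1, Progress.pop] using this
    · rcases (m2 z).1 hz with hz | hz
      · exact h.marked z ((hm1 z).1 hz)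
      · exact hmw z hz
    · rw [w2] at hpy
      exact h.wait py (List.mem_of_mem_filter hpy)
  obtain ⟨d3, l3, w3, m3, c3⟩ := foldl_watch_spec (acts inp rp rules x) g2
  have hd : (g.step inp rp rules x rest).done = g.done ++ [x] := d3.trans d2
  have hnot : ∀ (l : List (Item × Item)) (g' : Progress), (∀ py ∈ g'.wait, py.1 ∉ g'.done) →
      ∀ py ∈ (l.foldl watch g').wait, py.1 ∉ g'.done := by
    intro l
    induction l with
    | nil => exact fun g' h' => h'
    | cons q l ih =>
      intro g' h'
      have hq := g'.watch_spec q
      rw [List.foldl_cons, ← hq.1]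
      refine ih _ fun py hpy => ?_
      rw [hq.1]
      unfold Progress.watch at hpy
      split_ifs at hpy with hmq
      · rw [(g'.derive_spec q.2).2.1] at hpy
        exact h' py hpy
      · rcases List.mem_cons.1 hpy with rfl | hpy
        · exact fun hd => hmq (List.mem_append_left _ hd)
        · exact h' py hpy
  have hn3 : ∀ py ∈ (g.step inp rp rules x rest).wait,
      py.1 ∉ (g.step inp rp rules x rest).done := by
    rw [hd]
    have := hnot (acts inp rp rules x) g2 ?_
    · rw [d2] at this; exact this
    · intro py hpy
      rw [w2] at hpy
      obtain ⟨hpy, he⟩ := List.mem_filter.1 hpy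
      rw [d2]
      simp only [hg1, Progress.pop, List.mem_append, List.mem_singleton, not_or]
      exact ⟨h.wait_notMem py hpy, by simpa using he⟩
  refine ⟨⟨foldl_watch_sound _ hs2 hS, fun z hz py hpy => ?_, hn3⟩, hd, ?_⟩
  · rw [hd, List.mem_append, List.mem_singleton] at hz
    rcases hz with hz | rfl
    · rcases h.closed z hz py hpy with hm | ⟨hnd, hw⟩
      · exact .inl (m3 _ ((m2 _).2 (.inl ((hm1 _).2 hm))))
      · by_cases hpx : py.1 = x
        · refine .inl (m3 _ ((m2 _).2 (.inr ?_)))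
          exact List.mem_map.2 ⟨py, List.mem_filter.2 ⟨hw, by simpa using hpx⟩, rfl⟩
        · have : py ∈ (g.step inp rp rules x rest).wait := by
            refine w3 py ?_
            rw [w2]
            exact List.mem_filter.2 ⟨hw, by simpa using hpx⟩
          exact .inr ⟨hn3 py this, this⟩
    · exact (c3 py hpy).imp id fun hw => ⟨hn3 py hw, hw⟩
  · have hlen : g1.wait.length + (g.waiting x).length = g.wait.length := by
      simp only [hg1, Progress.pop, Progress.waiting, List.length_map]
      have := List.length_eq_length_filter_add (l := g.wait) fun py => decide (py.1 = x)
      have e : (fun py : Item × Item => decide (py.1 ≠ x)) = fun py => !decide (py.1 = x) := by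
        funext py; simp
      rw [e]
      omega
    rw [w2] at l3
    change ((acts inp rp rules x).foldl Progress.watch g2).wait.length + _ ≤ _
    omega

end RAM

namespace RAM

/-! ### The whole program -/

/-- Compute the offsets of the items of all positions, and find out which positions are right
children. -/
def setupCmd : Cmd :=
  .seq (.ops [.const .one 1, .read .nodeCount .stride .zero .zero .zero,
    .add .stride .stride .one, .const .cells 1, .read .tag .tag .idx .zero .zero])
  (.seq (.loop .tag (.ops [.put .base .idx .t3, .add .t3 .t3 .stride,
    .read .right .right .idx .zero .zero, .add .idx .idx .one, .put .rpar .right .idx,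
    .read .tag .tag .idx .zero .zero]))
  (.ops [.add .idx .idx .one, .put .rpar .zero .idx]))

/-- The state after `i` rounds of the loop of `setupCmd`. -/
structure SetupInv (inp : Input) (n : ℕ) (i : ℕ) (s : St) : Prop where
  zero : s.v .zero = 0
  one : s.v .one = 1
  stride : s.v .stride = n + 1
  cells : s.v .cells = 1
  hd : s.v .hd = 0
  tl : s.v .tl = 0
  idx : s.v .idx = i
  offset : s.v .t3 = i * (n + 1)
  tag : s.v .tag = inp .tag i 0 0
  base : ∀ j, j < i → s.a .base j = j * (n + 1)
  rpar : ∀ x, x ≠ 0 → (∀ j, j < i → inp .right j 0 0 ≠ x) → s.a .rpar x = 0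
  rpar' : ∀ j, j < i → inp .right j 0 0 ≠ 0 → s.a .rpar (inp .right j 0 0) = j + 1
  arr : ∀ A : Arr, A ≠ .base → A ≠ .rpar → s.a A = fun _ => 0
  out : s.out = []

/-- The loop visits the positions in order; it ends at the first position without a tag. -/
theorem tri_setupLoop {inp : Input} {N n : ℕ} {rp : ℕ → ℕ} (hrp : IsRightParent inp N rp)
    (htag : ∀ i, inp .tag i 0 0 ≠ 0 ↔ i < N) (m i : ℕ) (hm : i + m = N) {s : St}
    (h : SetupInv inp n i s) :
    Tri inp (.loop .tag (.ops [.put .base .idx .t3, .add .t3 .t3 .stride,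
      .read .right .right .idx .zero .zero, .add .idx .idx .one, .put .rpar .right .idx,
      .read .tag .tag .idx .zero .zero])) s (30 * m + 1) (SetupInv inp n N) := by
  induction m generalizing i s with
  | zero =>
    have hi : i = N := by omega
    subst hi
    refine Tri.loopFalse ?_ h
    rw [h.tag]
    by_contra hne
    exact absurd ((htag _).1 hne) (by omega)
  | succ m ih =>
    have hne : s.v .tag ≠ 0 := by rw [h.tag]; exact (htag i).2 (by omega)
    refine Tri.mono (B := 22 + 2 + (30 * m + 1)) (Tri.loopTrue hne (Tri.ops _
      (by simp [opsCost, Op.code, addrCode]) (ih (i + 1) (by omega) ?_))) (by omega) fun _ h => h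
    have h0 := h.zero
    have h1 := h.one
    have h2 := h.idx
    have h3 := h.offset
    have h4 := h.stride
    refine ⟨?_, ?_, ?_, ?_, ?_, ?_, ?_, ?_, ?_, ?_, ?_, ?_, ?_, ?_⟩
    · simp [runOps, Op.run, St.set, St.setArr, h0]
    · simp [runOps, Op.run, St.set, St.setArr, h1]
    · simp [runOps, Op.run, St.set, St.setArr, h4]
    · simp [runOps, Op.run, St.set, St.setArr, h.cells]
    · simp [runOps, Op.run, St.set, St.setArr, h.hd]
    · simp [runOps, Op.run, St.set, St.setArr, h.tl]
    · simp [runOps, Op.run, St.set, St.setArr, h1, h2]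
    · simp [runOps, Op.run, St.set, St.setArr, h3, h4]; ring
    · simp [runOps, Op.run, St.set, St.setArr, h0, h1, h2]
    · intro j hj
      simp only [runOps, List.foldl, Op.run, St.set, St.setArr]
      simp [h2, h3, Function.update_apply]
      split_ifs with hji
      · rw [hji]
      · exact h.base j (by omega)
    · intro x hx hj
      simp only [runOps, List.foldl, Op.run, St.set, St.setArr]
      simp [h0, h1, h2]
      rw [Function.update_of_ne (Ne.symm (hj i (by omega)))]
      exact h.rpar x hx fun j hj' => hj j (by omega)
    · intro j hj hr
      simp only [runOps, List.foldl, Op.run, St.set, St.setArr]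
      simp [h0, h1, h2]
      by_cases hri : inp .right j 0 0 = inp .right i 0 0
      · have e1 := hrp.right j (by omega) hr
        have e2 := hrp.right i (by omega) (by rwa [hri] at hr)
        rw [hri] at e1 ⊢
        rw [Function.update_self]
        omega
      · rw [Function.update_of_ne hri]
        refine h.rpar' j ?_ hr
        rcases Nat.lt_succ_iff_lt_or_eq.1 hj with hj | rfl
        · exact hj
        · exact absurd rfl hri
    · intro A h1 h2
      simp [runOps, Op.run, St.set, St.setArr, h1, h2, h.arr A h1 h2]
    · simp [runOps, Op.run, St.set, St.setArr, h.out]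

theorem tri_setupCmd {inp : Input} {N n : ℕ} {rp : ℕ → ℕ} (hrp : IsRightParent inp N rp)
    (htag : ∀ i, inp .tag i 0 0 ≠ 0 ↔ i < N) (hn : inp .nodeCount 0 0 0 = n) :
    Tri inp setupCmd St.init (30 * N + 20) fun s => Rep N n rp s ⟨[], [], []⟩ ∧
      ∀ A : Arr, A ≠ .base → A ≠ .rpar → s.a A = fun _ => 0 := by
  refine Tri.mono (B := 5 + ((30 * N + 1) + 10)) (Tri.seq (Tri.ops _
    (by simp [opsCost, Op.code]) (Tri.seq ((tri_setupLoop (n := n) hrp htag N 0 (by simp) ?_).mono le_rfl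
    ?_)))) (by omega) fun _ h => h
  · refine ⟨?_, ?_, ?_, ?_, ?_, ?_, ?_, ?_, ?_, ?_, ?_, ?_, ?_, ?_⟩ <;>
      simp [runOps, Op.run, St.set, St.init, hn]
  · intro s h
    have h0 := h.zero
    have h1 := h.one
    have h2 := h.idx
    refine Tri.ops _ (by simp [opsCost, Op.code, addrCode]) ⟨⟨?_, ?_, ?_, ?_, ?_, ?_, ?_, ?_, ?_,
      ?_, ?_, ?_, ?_, ?_, ?_, ?_⟩, ?_⟩
    · simp [runOps, Op.run, St.set, St.setArr, h0]
    · simp [runOps, Op.run, St.set, St.setArr, h1]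
    · simp [runOps, Op.run, St.set, St.setArr, h.stride]
    · simp [runOps, Op.run, St.set, St.setArr, h.hd]
    · simp [runOps, Op.run, St.set, St.setArr, h.tl]
    · intro j hj
      simp [runOps, Op.run, St.set, St.setArr, h.base j hj]
    · intro j hj
      simp only [runOps, List.foldl, Op.run, St.set, St.setArr]
      simp [h0, h1, h2]
      by_cases hj0 : j = 0
      · subst hj0; simp [hrp.root]
      · rw [Function.update_of_ne hj0]
        by_cases hex : ∃ i, i < N ∧ inp .right i 0 0 = j
        · obtain ⟨i, hi, rfl⟩ := hex
          rw [h.rpar' i hi hj0, hrp.right i hi hj0]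
        · push Not at hex
          rw [h.rpar j hj0 hex, hrp.left j hj0 hex]
    · simp
    · intro x _
      simp [runOps, Op.run, St.set, St.setArr, h.arr .mark, Progress.Marked]
    · simp [Progress.Marked]
    · simp
    · simp [Progress.Marked]
    · simp
    · simp [runOps, Op.run, St.set, St.setArr, h.cells]
    · intro x _ _
      simp [runOps, Op.run, St.set, St.setArr, h.arr .head, Progress.waiting, Chain]
    · simp [runOps, Op.run, St.set, St.setArr, h.out]
    · intro A h1 h2
      simp [runOps, Op.run, St.set, St.setArr, h2, h.arr A h1 h2]

/-- The first item: the whole query is to be evaluated from the start set. -/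
def firstItem : Item := ⟨.spine, 0, 0⟩

/-- The program that derives all items from the first one. The number of the first item is `7`, and so
is that of its kind; its position and its node are `0`. -/
def engineCmd (rules : List Rule) : Cmd :=
  .seq setupCmd (.seq (.ops [.const .concl 7, .put .itemKind .concl .concl])
    (.seq deriveCmd (.seq (.ops [.sub .go .tl .hd]) (.loop .go (stepCmd rules)))))

/-- An upper bound for the time that the engine needs for the item `x`. For every implication, `200`
steps pay for adding it, and `60` steps for deriving its conclusion in case that it has to wait. -/
noncomputable def itemCost (inp : Input) (rp : ℕ → ℕ) (rules : List Rule) (x : Item) : ℕ :=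
  stepCost rules + 2 + 260 * (acts inp rp rules x).length

/-- The remaining time is bounded by the cost of the items of `U` that have not been processed, plus
the cost of the waiting conclusions, which have been paid for by the items that added them. -/
theorem tri_engineLoop {inp : Input} {N n : ℕ} {rp : ℕ → ℕ} {rules : List Rule} {S : Item → Prop}
    (hr : ∀ r ∈ rules, r.WF)
    (hends : ∀ x, S x → ∀ r ∈ rules, r.Fires (env inp rp x) → r.loop.Ends inp (env inp rp x))
    (hS : ∀ x, S x → ∀ py ∈ acts inp rp rules x,
      py.1.Valid N n ∧ py.2.Valid N n ∧ (S py.1 → S py.2))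
    (U : Finset Item) (hU : ∀ x, S x → x ∈ U) (y0 : Item) (m : ℕ) {s : St} {g : Progress}
    (hm : (U \ g.done.toFinset).card = m)
    (h : Rep N n rp s g) (hi : g.Inv S (acts inp rp rules)) (hgo : s.v .go = s.v .tl - s.v .hd)
    (hy : g.Marked y0) :
    Tri inp (.loop .go (stepCmd rules)) s
      ((∑ x ∈ U \ g.done.toFinset, itemCost inp rp rules x) + 60 * g.wait.length + 1)
      fun s' => ∃ done : List Item, done.Nodup ∧ y0 ∈ done ∧ (∀ x ∈ done, S x) ∧
        (∀ x ∈ done, ∀ py ∈ acts inp rp rules x, py.1 ∈ done → py.2 ∈ done) ∧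
        s'.out = (done.filter fun x => x.k = .ans ∧ x.q = 0).map Item.v := by
  induction m generalizing s g with
  | zero =>
    have hp : g.pend = [] := by
      rcases hp : g.pend with - | ⟨x, rest⟩
      · rfl
      · exfalso
        have hx : S x := hi.marked x (by simp [Progress.Marked, hp])
        have hxd : x ∉ g.done := by
          have := hi.nodup
          rw [hp, List.nodup_append] at this
          exact fun hd => this.2.2 x hd x (by simp) rfl
        rw [Finset.card_eq_zero] at hm
        have : x ∈ U \ g.done.toFinset := by simp [hU x hx, hxd]
        rw [hm] at this
        simp at this
    refine (Tri.loopFalse ?_ ?_).mono (by omega) fun _ h => h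
    · rw [hgo, h.tl, h.hd, hp]; simp
    · have hmk : ∀ z, g.Marked z ↔ z ∈ g.done := by intro z; simp [Progress.Marked, hp]
      refine ⟨g.done, ?_, (hmk _).1 hy, fun x hx => hi.marked x ((hmk x).2 hx),
        fun x hx py hpy hd => ?_, h.out⟩
      · have := hi.nodup; rwa [hp, List.append_nil] at this
      · rcases hi.closed x hx py hpy with h1 | h1
        · exact (hmk _).1 h1
        · exact absurd hd h1.1
  | succ m ih =>
    rcases hp : g.pend with - | ⟨x, rest⟩
    · refine (Tri.loopFalse ?_ ?_).mono (by omega) fun _ h => h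
      · rw [hgo, h.tl, h.hd, hp]; simp
      · have hmk : ∀ z, g.Marked z ↔ z ∈ g.done := by intro z; simp [Progress.Marked, hp]
        refine ⟨g.done, ?_, (hmk _).1 hy, fun x hx => hi.marked x ((hmk x).2 hx),
          fun x hx py hpy hd => ?_, h.out⟩
        · have := hi.nodup; rwa [hp, List.append_nil] at this
        · rcases hi.closed x hx py hpy with h1 | h1
          · exact (hmk _).1 h1
          · exact absurd hd h1.1
    · have hx : S x := hi.marked x (by simp [Progress.Marked, hp])
      have hxd : x ∉ g.done := by
        have := hi.nodup
        rw [hp, List.nodup_append] at this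
        exact fun hd => this.2.2 x hd x (by simp) rfl
      have hxU : x ∈ U \ g.done.toFinset := by simp [hU x hx, hxd]
      obtain ⟨hi', hd', hw'⟩ := Progress.inv_step hi hp fun py hpy => (hS x hx py hpy).2.2
      have hU' : U \ (g.step inp rp rules x rest).done.toFinset =
          (U \ g.done.toFinset).erase x := by
        rw [hd']
        ext z
        simp only [Finset.mem_sdiff, List.mem_toFinset, List.mem_append, List.mem_singleton,
          Finset.mem_erase]
        tauto
      have hsum := Finset.add_sum_erase _ (itemCost inp rp rules) hxU
      refine Tri.mono (Tri.loopTrue (B' := (∑ z ∈ U \ (g.step inp rp rules x rest).done.toFinset,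
        itemCost inp rp rules z) + 60 * (g.step inp rp rules x rest).wait.length + 1) ?_
        ((tri_stepCmd h hp hxd hr (hends x hx) fun py hpy =>
          ⟨(hS x hx py hpy).1, (hS x hx py hpy).2.1⟩).mono le_rfl ?_)) ?_ fun _ h => h
      · rw [hgo, h.tl, h.hd, hp]; simp
      · rintro s' ⟨h', hgo'⟩
        refine ih ?_ h' hi' hgo' ?_
        · rw [hU', Finset.card_erase_of_mem hxU, hm]; rfl
        · have h1 := (Progress.foldl_derive_spec (g.waiting x) (g.pop x rest)).2.2 y0
          exact (Progress.foldl_watch_spec (acts inp rp rules x) _).2.2.2.1 _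
            (h1.2 (.inl ((Progress.marked_pop hp).2 hy)))
      · rw [hU', ← hsum]
        simp only [itemCost]
        omega

/-- The engine derives a set of sound items that contains the first item and is closed under the
rules, and outputs the nodes of the derived answers of the whole query. -/
theorem tri_engineCmd {inp : Input} {N n : ℕ} {rp : ℕ → ℕ} {rules : List Rule} {S : Item → Prop}
    (hN : 0 < N) (hrp : IsRightParent inp N rp) (htag : ∀ i, inp .tag i 0 0 ≠ 0 ↔ i < N)
    (hn : inp .nodeCount 0 0 0 = n) (hr : ∀ r ∈ rules, r.WF)
    (hends : ∀ x, S x → ∀ r ∈ rules, r.Fires (env inp rp x) → r.loop.Ends inp (env inp rp x))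
    (hS : ∀ x, S x → ∀ py ∈ acts inp rp rules x,
      py.1.Valid N n ∧ py.2.Valid N n ∧ (S py.1 → S py.2))
    (hfirst : S firstItem) (U : Finset Item) (hU : ∀ x, S x → x ∈ U) :
    Tri inp (engineCmd rules) St.init
      (30 * N + (∑ x ∈ U, itemCost inp rp rules x) + 100)
      fun s' => ∃ done : List Item, done.Nodup ∧ firstItem ∈ done ∧ (∀ x ∈ done, S x) ∧
        (∀ x ∈ done, ∀ py ∈ acts inp rp rules x, py.1 ∈ done → py.2 ∈ done) ∧
        s'.out = (done.filter fun x => x.k = .ans ∧ x.q = 0).map Item.v := by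
  have hv : firstItem.Valid N n := ⟨hN, Nat.zero_le _⟩
  have hkey : firstItem.key n = 7 := by simp [firstItem, Item.key, Kind.code]
  refine Tri.mono (B := (30 * N + 20) + (10 + (40 + (1 +
    ((∑ x ∈ U, itemCost inp rp rules x) + 60 * 0 + 1))))) (Tri.seq
    ((tri_setupCmd hrp htag hn).mono le_rfl ?_)) (by omega) fun _ h => h
  rintro s1 ⟨h1, ha1⟩
  refine Tri.seq (Tri.ops _ (by simp [opsCost, Op.code, addrCode]) ?_)
  refine Tri.seq ((tri_deriveCmd (rp := rp) (y := firstItem) (g := ⟨[], [], []⟩) ?_ hv ?_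
    ?_).mono le_rfl ?_)
  · refine ⟨?_, ?_, ?_, ?_, ?_, ?_, ?_, ?_, ?_, ?_, ?_, ?_, ?_, ?_, ?_, ?_⟩
    · simp [runOps, Op.run, St.set, St.setArr, h1.zero]
    · simp [runOps, Op.run, St.set, St.setArr, h1.one]
    · simp [runOps, Op.run, St.set, St.setArr, h1.stride]
    · simp [runOps, Op.run, St.set, St.setArr, h1.hd]
    · simp [runOps, Op.run, St.set, St.setArr, h1.tl]
    · simpa [runOps, Op.run, St.set, St.setArr] using h1.base
    · simpa [runOps, Op.run, St.set, St.setArr] using h1.rpar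
    · simp
    · simpa [runOps, Op.run, St.set, St.setArr] using h1.mark
    · simp [Progress.Marked]
    · simp
    · simp [Progress.Marked]
    · simp
    · simpa [runOps, Op.run, St.set, St.setArr] using h1.cells
    · simpa [runOps, Op.run, St.set, St.setArr] using h1.chain
    · simpa [runOps, Op.run, St.set, St.setArr] using h1.out
  · simp [runOps, Op.run, St.set, St.setArr, hkey]
  · unfold Stored
    rw [hkey]
    simp [runOps, Op.run, St.set, St.setArr, ha1, firstItem, Kind.code]
  rintro s2 ⟨h2, -, -⟩
  have hg : (Progress.derive ⟨[], [], []⟩ firstItem) = ⟨[], [firstItem], []⟩ := by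
    simp [Progress.derive, Progress.Marked]
  rw [hg] at h2
  refine Tri.seq (Tri.ops _ (by simp [opsCost, Op.code]) ?_)
  refine (tri_engineLoop (N := N) (n := n) (rp := rp) (g := ⟨[], [firstItem], []⟩) hr hends hS U hU
    firstItem _ rfl ?_ ?_ ?_ ?_).mono (by simp) fun _ h => h
  · refine h2.congr rfl rfl fun y hy => ?_
    have : y ≠ .go := by rintro rfl; simp [Var.IsGlobal] at hy
    simp [runOps, Op.run, St.set, this]
  · refine ⟨⟨by simp, ?_, by simp⟩, by simp, by simp⟩
    intro x hx
    have : x = firstItem := by simpa [Progress.Marked] using hx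
    rw [this]; exact hfirst
  · simp [runOps, Op.run, St.set]
  · simp [Progress.Marked]

end RAM

/-! ### Filters and path queries as one type of relations -/

/-- Negation-free queries, where a filter is regarded as the path query that stays at the nodes that
it selects. Then the conjunction of filters is a composition (`seq true`, whereas `seq false` stands
for the composition of path queries) and the disjunction of filters is a union (`union true`). -/
inductive Query (L : Type u) where
  | ex : Query L → Query L
  | node : Query L
  | lab : L → Query L
  | test : Query L → Query L
  | edge : L → Query L
  | inv : L → Query L
  | seq : Bool → Query L → Query L → Query L
  | union : Bool → Query L → Query L → Query L
  | plus : Query L → Query L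
  | goto : Query L → Query L

namespace Query

variable {L : Type u} {V : Type*}

/-- The number of nodes of the syntax tree. -/
def size : Query L → ℕ
  | .ex p => p.size + 1
  | .node => 1
  | .lab _ => 1
  | .test p => p.size + 1
  | .edge _ => 1
  | .inv _ => 1
  | .seq _ p p' => p.size + p'.size + 1
  | .union _ p p' => p.size + p'.size + 1
  | .plus p => p.size + 1
  | .goto p => p.size + 1

/-- The relation defined by a query. -/
def sem (G : LabeledGraph L V) : Query L → V → V → Prop
  | .ex p => fun v v' => v = v' ∧ ∃ w, p.sem G v w
  | .node => fun v v' => v = v'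
  | .lab a => fun v v' => v = v' ∧ v ∈ G.nodeLab a
  | .test p => p.sem G
  | .edge a => fun v v' => (v, v') ∈ G.edge a
  | .inv a => fun v v' => (v', v) ∈ G.edge a
  | .seq _ p p' => fun v v' => ∃ w, p.sem G v w ∧ p'.sem G w v'
  | .union _ p p' => fun v v' => p.sem G v v' ∨ p'.sem G v v'
  | .plus p => Relation.TransGen (p.sem G)
  | .goto p => fun _ v' => ∃ w, p.sem G w v'

/-- The answers of a query for a start set. -/
def answers (G : LabeledGraph L V) (p : Query L) (S : Set V) : Set V := {v | ∃ s ∈ S, p.sem G s v}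

/-- The facts of the top-down needed subgraph, with a start set or without one. -/
def need (G : LabeledGraph L V) : Query L → Option (Set V) → Set (GFact L V)
  | .ex p, some S => GFact.node '' S ∪ p.need G (some S)
  | .node, some S => GFact.node '' S
  | .lab a, some S => GFact.node '' S ∪ GFact.lab a '' (G.nodeLab a ∩ S)
  | .test p, some S => p.need G (some S)
  | .edge a, some S => GFact.node '' S ∪
      {f | ∃ v v', v ∈ S ∧ (v, v') ∈ G.edge a ∧ (f = .edge a v v' ∨ f = .node v')}
  | .inv a, some S => GFact.node '' S ∪
      {f | ∃ v v', v' ∈ S ∧ (v, v') ∈ G.edge a ∧ (f = .edge a v v' ∨ f = .node v)}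
  | .seq _ p p', some S => p.need G (some S) ∪ p'.need G (some (p.answers G S))
  | .union _ p p', some S => p.need G (some S) ∪ p'.need G (some S)
  | .plus p, some S =>
      p.need G (some (S ∪ {v | ∃ s ∈ S, Relation.TransGen (p.sem G) s v}))
  | .goto p, some _ => p.need G none
  | .ex p, none => GFact.node '' {v | ∃ v', p.sem G v v'} ∪ p.need G none
  | .node, none => Set.range GFact.node
  | .lab a, none => GFact.lab a '' G.nodeLab a
  | .test p, none => p.need G none
  | .edge a, none => {f | ∃ v v', (v, v') ∈ G.edge a ∧ f = .edge a v v'}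
  | .inv a, none => {f | ∃ v v', (v, v') ∈ G.edge a ∧ f = .edge a v v'}
  | .seq _ p p', none => p.need G none ∪ p'.need G (some (p.answers G Set.univ))
  | .union _ p p', none => p.need G none ∪ p'.need G none
  | .plus p, none =>
      p.need G none ∪ p.need G (some {v | ∃ s, Relation.TransGen (p.sem G) s v})
  | .goto p, none => p.need G none

theorem answers_mono {G : LabeledGraph L V} (p : Query L) {S S' : Set V} (h : S ⊆ S') :
    p.answers G S ⊆ p.answers G S' := fun _ ⟨s, hs, hv⟩ => ⟨s, h hs, hv⟩

/-- More start nodes need more facts. -/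
theorem need_mono {G : LabeledGraph L V} (p : Query L) {S S' : Set V} (h : S ⊆ S') :
    p.need G (some S) ⊆ p.need G (some S') := by
  induction p generalizing S S' with
  | ex p ih => exact Set.union_subset_union (Set.image_mono h) (ih h)
  | node => exact Set.image_mono h
  | lab a =>
    exact Set.union_subset_union (Set.image_mono h)
      (Set.image_mono (Set.inter_subset_inter_right _ h))
  | test p ih => exact ih h
  | edge a =>
    refine Set.union_subset_union (Set.image_mono h) ?_
    rintro f ⟨v, v', hv, hr⟩
    exact ⟨v, v', h hv, hr⟩
  | inv a =>
    refine Set.union_subset_union (Set.image_mono h) ?_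
    rintro f ⟨v, v', hv, hr⟩
    exact ⟨v, v', h hv, hr⟩
  | seq b p p' ih ih' => exact Set.union_subset_union (ih h) (ih' (p.answers_mono h))
  | union b p p' ih ih' => exact Set.union_subset_union (ih h) (ih' h)
  | plus p ih =>
    refine ih (Set.union_subset_union h ?_)
    rintro v ⟨s, hs, hv⟩
    exact ⟨s, h hs, hv⟩
  | goto p ih => exact subset_rfl

end Query

/-! ### Syntax trees -/

/-- Syntax trees, reduced to the data that the machine can see. -/
inductive QTree where
  | leaf (t l : ℕ)
  | un (t : ℕ) (s : QTree)
  | bin (t : ℕ) (s s' : QTree)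

namespace QTree

/-- The number of nodes. -/
def size : QTree → ℕ
  | .leaf _ _ => 1
  | .un _ s => s.size + 1
  | .bin _ s s' => s.size + s'.size + 1

/-- The nodes of a tree in prefix order, numbered from `k` on, with their tags and children. -/
def code : QTree → ℕ → List (ℕ × ℕ × ℕ)
  | .leaf t l, _ => [(t, l, 0)]
  | .un t s, k => (t, k + 1, 0) :: s.code (k + 1)
  | .bin t s s', k => (t, k + 1, k + 1 + s.size) :: (s.code (k + 1) ++ s'.code (k + 1 + s.size))

/-- Tags are not `0`, and those in `[2, 3, 8, 9]` are the tags of leaves. -/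
def WF : QTree → Prop
  | .leaf t _ => t ∈ [2, 3, 8, 9]
  | .un t s => t ∉ [0, 2, 3, 8, 9] ∧ s.WF
  | .bin t s s' => t ∉ [0, 2, 3, 8, 9] ∧ s.WF ∧ s'.WF

/-- The entry of the node number `i` of a tree whose nodes are numbered from `k` on. -/
def at' : QTree → ℕ → ℕ → ℕ × ℕ × ℕ
  | .leaf t l, _, _ => (t, l, 0)
  | .un t s, k, i => if i = k then (t, k + 1, 0) else s.at' (k + 1) i
  | .bin t s s', k, i =>
      if i = k then (t, k + 1, k + 1 + s.size)
      else if i < k + 1 + s.size then s.at' (k + 1) i else s'.at' (k + 1 + s.size) i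

theorem size_pos (s : QTree) : 0 < s.size := by cases s <;> simp [size]

theorem length_code (s : QTree) (k : ℕ) : (s.code k).length = s.size := by
  induction s generalizing k with
  | leaf t l => rfl
  | un t s ih => simp [code, size, ih]
  | bin t s s' ih ih' => simp [code, size, ih, ih']

theorem code_getElem? (s : QTree) (k i : ℕ) (hi : i < s.size) :
    (s.code k)[i]? = some (s.at' k (k + i)) := by
  induction s generalizing k i with
  | leaf t l =>
    have : i = 0 := by simp [size] at hi; omega
    subst this; rfl
  | un t s ih =>
    rcases i with - | i
    · simp [code, at']
    · simp only [code, List.getElem?_cons_succ, at']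
      rw [ih (k + 1) i (by simp [size] at hi; omega), if_neg (by omega)]
      congr 2; omega
  | bin t s s' ih ih' =>
    rcases i with - | i
    · simp [code, at']
    · simp only [code, List.getElem?_cons_succ, at', size] at hi ⊢
      rw [if_neg (by omega)]
      by_cases h : i < s.size
      · rw [List.getElem?_append_left (by rwa [length_code]), ih (k + 1) i h, if_pos (by omega)]
        congr 2; omega
      · rw [List.getElem?_append_right (by rw [length_code]; omega), length_code,
          ih' _ (i - s.size) (by omega), if_neg (by omega)]
        congr 2; omega

theorem tag_at'_ne_zero {s : QTree} (h : s.WF) (k i : ℕ) : (s.at' k i).1 ≠ 0 := by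
  induction s generalizing k with
  | leaf t l => rintro rfl; simp [WF] at h
  | un t s ih =>
    simp only [at']
    split_ifs
    · rintro rfl; simp [WF] at h
    · exact ih h.2 _
  | bin t s s' ih ih' =>
    simp only [at']
    split_ifs
    · rintro rfl; simp [WF] at h
    · exact ih h.2.1 _
    · exact ih' h.2.2 _

/-- The last node in prefix order is a leaf. -/
theorem leaf_last {s : QTree} (h : s.WF) (k : ℕ) :
    (s.at' k (k + s.size - 1)).1 ∈ [2, 3, 8, 9] := by
  induction s generalizing k with
  | leaf t l => exact h
  | un t s ih =>
    have hs := s.size_pos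
    have := ih h.2 (k + 1)
    obtain ⟨m, hm⟩ : ∃ m, m = k + (un t s).size - 1 := ⟨_, rfl⟩
    rw [← hm]
    simp only [size] at hm
    simp only [at']
    rw [if_neg (by omega)]
    convert this using 3; omega
  | bin t s s' ih ih' =>
    have hs := s'.size_pos
    have := ih' h.2.2 (k + 1 + s.size)
    obtain ⟨m, hm⟩ : ∃ m, m = k + (bin t s s').size - 1 := ⟨_, rfl⟩
    rw [← hm]
    simp only [size] at hm
    simp only [at']
    rw [if_neg (by omega), if_neg (by omega)]
    convert this using 3; omega

/-- A right child lies behind the left child of its parent, and in the subtree of its parent. -/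
theorem right_range (s : QTree) (k i : ℕ) (hk : k ≤ i) (hi : i < k + s.size)
    (h : (s.at' k i).2.2 ≠ 0) : i + 1 < (s.at' k i).2.2 ∧ (s.at' k i).2.2 < k + s.size := by
  induction s generalizing k with
  | leaf t l => simp [at'] at h
  | un t s ih =>
    simp only [at', size] at h hi ⊢
    split_ifs at h ⊢ with h1
    · simp at h
    · have := ih (k + 1) (by omega) (by omega) h
      omega
  | bin t s s' ih ih' =>
    have hs := s.size_pos
    have hs' := s'.size_pos
    simp only [at', size] at h hi ⊢
    split_ifs at h ⊢ with h1 h2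
    · simp only; omega
    · have := ih (k + 1) (by omega) (by omega) h
      omega
    · have := ih' (k + 1 + s.size) (by omega) (by omega) h
      omega

/-- The node before a right child is the last node of the left subtree, and hence a leaf. -/
theorem leaf_before_right {s : QTree} (hw : s.WF) (k i : ℕ) (hk : k ≤ i) (hi : i < k + s.size)
    (h : (s.at' k i).2.2 ≠ 0) : (s.at' k ((s.at' k i).2.2 - 1)).1 ∈ [2, 3, 8, 9] := by
  induction s generalizing k with
  | leaf t l => simp [at'] at h
  | un t s ih =>
    have hr := right_range _ k i hk hi h
    have e : (QTree.un t s).at' k i = s.at' (k + 1) i := by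
      by_cases h1 : i = k
      · simp [at', h1] at h
      · simp [at', h1]
    rw [e] at h hr ⊢
    have h1 : i ≠ k := by rintro rfl; simp [at'] at e; simp [← e] at h
    simp only [at', size] at hi ⊢
    rw [if_neg (by omega)]
    exact ih hw.2 (k + 1) (by omega) (by omega) h
  | bin t s s' ih ih' =>
    have hs := s.size_pos
    by_cases h1 : i = k
    · have e : (QTree.bin t s s').at' k i = (t, k + 1, k + 1 + s.size) := by simp [at', h1]
      rw [e]
      simp only [at']
      rw [if_neg (by omega), if_pos (by omega)]
      convert leaf_last hw.2.1 (k + 1) using 3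
    · simp only [size] at hi
      by_cases h2 : i < k + 1 + s.size
      · have e : (QTree.bin t s s').at' k i = s.at' (k + 1) i := by simp [at', h1, h2]
        rw [e] at h ⊢
        have hr := right_range s (k + 1) i (by omega) (by omega) h
        simp only [at']
        rw [if_neg (by omega), if_pos (by omega)]
        exact ih hw.2.1 _ (by omega) (by omega) h
      · have e : (QTree.bin t s s').at' k i = s'.at' (k + 1 + s.size) i := by simp [at', h1, h2]
        rw [e] at h ⊢
        have hr := right_range s' (k + 1 + s.size) i (by omega) (by omega) h
        simp only [at']
        rw [if_neg (by omega), if_neg (by omega)]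
        exact ih' hw.2.2 _ (by omega) (by omega) h

/-- A position is the right child of at most one position. -/
theorem right_injective (s : QTree) (k i j : ℕ) (hi : k ≤ i) (hi' : i < k + s.size) (hj : k ≤ j)
    (hj' : j < k + s.size) (h : (s.at' k i).2.2 ≠ 0) (he : (s.at' k i).2.2 = (s.at' k j).2.2) :
    i = j := by
  induction s generalizing k with
  | leaf t l => simp [at'] at h
  | un t s ih =>
    simp only [at', size] at *
    split_ifs at h he with h1 h2 h2
    · exact absurd rfl h
    · exact absurd rfl h
    · exact absurd he h
    · exact ih (k + 1) (by omega) (by omega) (by omega) (by omega) h he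
  | bin t s s' ih ih' =>
    have hs := s.size_pos
    have r1 : ∀ i, k + 1 ≤ i → i < k + 1 + s.size → (s.at' (k + 1) i).2.2 ≠ 0 →
        (s.at' (k + 1) i).2.2 < k + 1 + s.size := fun i h1 h2 h3 =>
      (right_range s (k + 1) i h1 h2 h3).2
    have r2 : ∀ i, k + 1 + s.size ≤ i → i < k + 1 + s.size + s'.size →
        (s'.at' (k + 1 + s.size) i).2.2 ≠ 0 → k + 1 + s.size <
        (s'.at' (k + 1 + s.size) i).2.2 := fun i h1 h2 h3 => by
      have := (right_range s' (k + 1 + s.size) i h1 h2 h3).1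
      omega
    simp only [size] at hi' hj'
    have a1 := r1 i
    have a2 := r2 i
    have a3 := r1 j
    have a4 := r2 j
    simp only [at'] at h he
    split_ifs at h he
    all_goals try dsimp only at h he
    all_goals first
      | omega
      | exact ih (k + 1) (by omega) (by omega) (by omega) (by omega) h he
      | exact ih' (k + 1 + s.size) (by omega) (by omega) (by omega) (by omega) h he

end QTree

namespace Query

variable {L : Type u} {V : Type*}

/-- The tag of a query: the number by which the input encodes its outermost constructor. -/
def tag : Query L → ℕ
  | .ex _ => 1
  | .node => 2
  | .lab _ => 3
  | .test _ => 7
  | .edge _ => 8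
  | .inv _ => 9
  | .seq b _ _ => if b then 4 else 10
  | .union b _ _ => if b then 5 else 11
  | .plus _ => 12
  | .goto _ => 13

/-- The syntax tree of a query. -/
def tree (lab : L → ℕ) : Query L → QTree
  | .ex p => .un 1 (p.tree lab)
  | .node => .leaf 2 0
  | .lab a => .leaf 3 (lab a)
  | .test p => .un 7 (p.tree lab)
  | .edge a => .leaf 8 (lab a)
  | .inv a => .leaf 9 (lab a)
  | .seq b p p' => .bin (if b then 4 else 10) (p.tree lab) (p'.tree lab)
  | .union b p p' => .bin (if b then 5 else 11) (p.tree lab) (p'.tree lab)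
  | .plus p => .un 12 (p.tree lab)
  | .goto p => .un 13 (p.tree lab)

theorem size_tree (lab : L → ℕ) (p : Query L) : (p.tree lab).size = p.size := by
  induction p <;> simp_all [tree, size, QTree.size]

theorem wf_tree (lab : L → ℕ) (p : Query L) : (p.tree lab).WF := by
  induction p <;> simp_all [tree, QTree.WF]
  all_goals split_ifs <;> simp

end Query

mutual

/-- The query of a filter; the value at negations is irrelevant. -/
def NFilter.toQuery {L : Type*} : NFilter L → Query L
  | .ex P => .ex P.toQuery
  | .node => .node
  | .lab a => .lab a
  | .and F F' => .seq true F.toQuery F'.toQuery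
  | .or F F' => .union true F.toQuery F'.toQuery
  | .not _ => .node

/-- The query of a path query. -/
def NPath.toQuery {L : Type*} : NPath L → Query L
  | .test F => .test F.toQuery
  | .edge a => .edge a
  | .inv a => .inv a
  | .seq P P' => .seq false P.toQuery P'.toQuery
  | .union P P' => .union false P.toQuery P'.toQuery
  | .plus P => .plus P.toQuery
  | .goto F => .goto F.toQuery

end

mutual

theorem NFilter.size_toQuery {L : Type*} : ∀ F : NFilter L, F.NegFree → F.toQuery.size = F.size
  | .ex P, h => by simp [NFilter.toQuery, NFilter.size, Query.size, P.size_toQuery h]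
  | .node, _ => rfl
  | .lab a, _ => rfl
  | .and F F', h => by
    simp [NFilter.toQuery, NFilter.size, Query.size, F.size_toQuery h.1, F'.size_toQuery h.2]
  | .or F F', h => by
    simp [NFilter.toQuery, NFilter.size, Query.size, F.size_toQuery h.1, F'.size_toQuery h.2]
  | .not _, h => h.elim

theorem NPath.size_toQuery {L : Type*} : ∀ P : NPath L, P.NegFree → P.toQuery.size = P.size
  | .test F, h => by simp [NPath.toQuery, NPath.size, Query.size, F.size_toQuery h]
  | .edge a, _ => rfl
  | .inv a, _ => rfl
  | .seq P P', h => by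
    simp [NPath.toQuery, NPath.size, Query.size, P.size_toQuery h.1, P'.size_toQuery h.2]
  | .union P P', h => by
    simp [NPath.toQuery, NPath.size, Query.size, P.size_toQuery h.1, P'.size_toQuery h.2]
  | .plus P, h => by simp [NPath.toQuery, NPath.size, Query.size, P.size_toQuery h]
  | .goto F, h => by simp [NPath.toQuery, NPath.size, Query.size, F.size_toQuery h]

end

mutual

theorem NFilter.code_toQuery {L : Type*} (lab : L → ℕ) :
    ∀ (F : NFilter L) (k : ℕ), F.NegFree → (F.toQuery.tree lab).code k = F.code lab k
  | .ex P, k, h => by simp [NFilter.toQuery, NFilter.code, Query.tree, QTree.code, P.code_toQuery lab _ h]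
  | .node, _, _ => rfl
  | .lab a, _, _ => rfl
  | .and F F', k, h => by
    simp [NFilter.toQuery, NFilter.code, Query.tree, QTree.code, Query.size_tree, F.size_toQuery h.1,
      F.code_toQuery lab _ h.1, F'.code_toQuery lab _ h.2]
  | .or F F', k, h => by
    simp [NFilter.toQuery, NFilter.code, Query.tree, QTree.code, Query.size_tree, F.size_toQuery h.1,
      F.code_toQuery lab _ h.1, F'.code_toQuery lab _ h.2]
  | .not _, _, h => h.elim

theorem NPath.code_toQuery {L : Type*} (lab : L → ℕ) :
    ∀ (P : NPath L) (k : ℕ), P.NegFree → (P.toQuery.tree lab).code k = P.code lab k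
  | .test F, k, h => by simp [NPath.toQuery, NPath.code, Query.tree, QTree.code, F.code_toQuery lab _ h]
  | .edge a, _, _ => rfl
  | .inv a, _, _ => rfl
  | .seq P P', k, h => by
    simp [NPath.toQuery, NPath.code, Query.tree, QTree.code, Query.size_tree, P.size_toQuery h.1,
      P.code_toQuery lab _ h.1, P'.code_toQuery lab _ h.2]
  | .union P P', k, h => by
    simp [NPath.toQuery, NPath.code, Query.tree, QTree.code, Query.size_tree, P.size_toQuery h.1,
      P.code_toQuery lab _ h.1, P'.code_toQuery lab _ h.2]
  | .plus P, k, h => by simp [NPath.toQuery, NPath.code, Query.tree, QTree.code, P.code_toQuery lab _ h]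
  | .goto F, k, h => by simp [NPath.toQuery, NPath.code, Query.tree, QTree.code, F.code_toQuery lab _ h]

end

mutual

theorem NFilter.sem_toQuery {L V : Type*} (G : LabeledGraph L V) :
    ∀ F : NFilter L, F.NegFree → F.toQuery.sem G = fun v v' => v = v' ∧ v ∈ F.sem G
  | .ex P, h => by simp [NFilter.toQuery, NFilter.sem, Query.sem, P.sem_toQuery G h]
  | .node, _ => by simp [NFilter.toQuery, NFilter.sem, Query.sem]
  | .lab a, _ => by simp [NFilter.toQuery, NFilter.sem, Query.sem]
  | .and F F', h => by
    funext v v'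
    simp only [NFilter.toQuery, NFilter.sem, Query.sem, F.sem_toQuery G h.1, F'.sem_toQuery G h.2]
    refine propext ⟨?_, ?_⟩
    · rintro ⟨w, ⟨rfl, h1⟩, rfl, h2⟩; exact ⟨rfl, h1, h2⟩
    · rintro ⟨rfl, h1, h2⟩; exact ⟨v, ⟨rfl, h1⟩, rfl, h2⟩
  | .or F F', h => by
    funext v v'
    simp only [NFilter.toQuery, NFilter.sem, Query.sem, F.sem_toQuery G h.1, F'.sem_toQuery G h.2]
    refine propext ⟨?_, ?_⟩
    · rintro (⟨rfl, h1⟩ | ⟨rfl, h1⟩)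
      · exact ⟨rfl, .inl h1⟩
      · exact ⟨rfl, .inr h1⟩
    · rintro ⟨rfl, h1 | h1⟩
      · exact .inl ⟨rfl, h1⟩
      · exact .inr ⟨rfl, h1⟩
  | .not _, h => h.elim

theorem NPath.sem_toQuery {L V : Type*} (G : LabeledGraph L V) :
    ∀ P : NPath L, P.NegFree → P.toQuery.sem G = P.sem G
  | .test F, h => by simp [NPath.toQuery, NPath.sem, Query.sem, F.sem_toQuery G h]
  | .edge a, _ => rfl
  | .inv a, _ => rfl
  | .seq P P', h => by
    simp [NPath.toQuery, NPath.sem, Query.sem, P.sem_toQuery G h.1, P'.sem_toQuery G h.2]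
  | .union P P', h => by
    simp [NPath.toQuery, NPath.sem, Query.sem, P.sem_toQuery G h.1, P'.sem_toQuery G h.2]
  | .plus P, h => by simp [NPath.toQuery, NPath.sem, Query.sem, P.sem_toQuery G h]
  | .goto F, h => by simp [NPath.toQuery, NPath.sem, Query.sem, F.sem_toQuery G h]

end

theorem NPath.answers_toQuery {L V : Type*} (G : LabeledGraph L V) (P : NPath L) (h : P.NegFree)
    (S : Set V) : P.toQuery.answers G S = P.answers G S := by
  simp [Query.answers, NPath.answers, P.sem_toQuery G h]

theorem NFilter.answers_toQuery {L V : Type*} (G : LabeledGraph L V) (F : NFilter L)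
    (h : F.NegFree) (S : Set V) : F.toQuery.answers G S = F.sem G ∩ S := by
  ext v
  simp only [Query.answers, F.sem_toQuery G h, Set.mem_ofPred_eq, Set.mem_inter_iff]
  exact ⟨fun ⟨s, hs, e, hv⟩ => e ▸ ⟨hv, hs⟩, fun ⟨hv, hs⟩ => ⟨v, hs, rfl, hv⟩⟩

mutual

theorem NFilter.need_toQuery {L V : Type*} (G : LabeledGraph L V) :
    ∀ F : NFilter L, F.NegFree → (∀ S, F.toQuery.need G (some S) = F.tdn G S) ∧
      F.toQuery.need G none = F.tdnAll G
  | .ex P, h => by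
    obtain ⟨h1, h2⟩ := P.need_toQuery G h
    simp [NFilter.toQuery, NFilter.tdn, NFilter.tdnAll, Query.need, h1, h2, P.sem_toQuery G h]
  | .node, _ => ⟨fun _ => rfl, rfl⟩
  | .lab a, _ => ⟨fun _ => rfl, rfl⟩
  | .and F F', h => by
    obtain ⟨h1, h2⟩ := F.need_toQuery G h.1
    obtain ⟨h3, h4⟩ := F'.need_toQuery G h.2
    simp [NFilter.toQuery, NFilter.tdn, NFilter.tdnAll, Query.need, h1, h2, h3, F.answers_toQuery G h.1]
  | .or F F', h => by
    obtain ⟨h1, h2⟩ := F.need_toQuery G h.1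
    obtain ⟨h3, h4⟩ := F'.need_toQuery G h.2
    simp [NFilter.toQuery, NFilter.tdn, NFilter.tdnAll, Query.need, h1, h2, h3, h4]
  | .not _, h => h.elim

theorem NPath.need_toQuery {L V : Type*} (G : LabeledGraph L V) :
    ∀ P : NPath L, P.NegFree → (∀ S, P.toQuery.need G (some S) = P.tdn G S) ∧
      P.toQuery.need G none = P.tdnAll G
  | .test F, h => by
    obtain ⟨h1, h2⟩ := F.need_toQuery G h
    simp [NPath.toQuery, NPath.tdn, NPath.tdnAll, Query.need, h1, h2]
  | .edge a, _ => ⟨fun _ => rfl, rfl⟩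
  | .inv a, _ => ⟨fun _ => rfl, rfl⟩
  | .seq P P', h => by
    obtain ⟨h1, h2⟩ := P.need_toQuery G h.1
    obtain ⟨h3, h4⟩ := P'.need_toQuery G h.2
    simp [NPath.toQuery, NPath.tdn, NPath.tdnAll, Query.need, h1, h2, h3, P.answers_toQuery G h.1]
  | .union P P', h => by
    obtain ⟨h1, h2⟩ := P.need_toQuery G h.1
    obtain ⟨h3, h4⟩ := P'.need_toQuery G h.2
    simp [NPath.toQuery, NPath.tdn, NPath.tdnAll, Query.need, h1, h2, h3, h4]
  | .plus P, h => by
    obtain ⟨h1, h2⟩ := P.need_toQuery G h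
    simp [NPath.toQuery, NPath.tdn, NPath.tdnAll, Query.need, h1, h2, P.sem_toQuery G h]
  | .goto F, h => by
    obtain ⟨h1, h2⟩ := F.need_toQuery G h
    simp [NPath.toQuery, NPath.tdn, NPath.tdnAll, Query.need, h2]

end

/-! ### The inference rules for queries -/

namespace RAM

/-- A single element; the tag of a position of the syntax tree is not `0`. -/
def oneLoop : Loop := ⟨.tag, .pos, .zero, .zero, .zero, true⟩

/-- The start nodes. -/
def startLoop : Loop := ⟨.start, .idx, .zero, .zero, .zero, false⟩

/-- The first start node. -/
def firstLoop : Loop := ⟨.start, .zero, .zero, .zero, .zero, true⟩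

/-- A single element if the current node has the current label. -/
def hasLabLoop : Loop := ⟨.hasLab, .left, .node, .zero, .zero, true⟩

/-- All nodes, in decreasing order. -/
def nodesLoop : Loop := ⟨.nodeCount, .zero, .zero, .zero, .idx, false⟩

/-- The nodes with the current label. -/
def labeledLoop : Loop := ⟨.labeled, .left, .idx, .zero, .zero, false⟩

/-- The edges with the current label. -/
def edgesLoop : Loop := ⟨.edgeSrc, .left, .idx, .zero, .zero, false⟩

/-- The successors of the current node. -/
def succLoop : Loop := ⟨.succ, .left, .node, .idx, .zero, false⟩

/-- The predecessors of the current node. -/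
def predLoop : Loop := ⟨.pred, .left, .node, .idx, .zero, false⟩

/-- A rule that depends on the tag of the position of the item. The tags are `1` for `[P]`, `2` for
`node`, `3` for `node_a`, `4` for `∧`, `5` for `∨`, `7` for `F?`, `8` for `edge_a`, `9` for its inverse,
`10` for `P/P'`, `11` for `P ∪ P'`, `12` for `P⁺` and `13` for `goto`. -/
def Rule.own (k : Kind) (tags : List ℕ) (l : Loop) (pk : Kind) (pp pn : Var) (ck : Kind)
    (cp cn : Var) : Rule := ⟨k, .tag, tags, [0, 1], l, pk, pp, pn, ck, cp, cn⟩

/-- A rule that depends on the tag of the parent, and on the side of the item. -/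
def Rule.up (k : Kind) (tags sides : List ℕ) (pk : Kind) (pp pn : Var) (ck : Kind)
    (cp cn : Var) : Rule := ⟨k, .ptag, tags, sides, oneLoop, pk, pp, pn, ck, cp, cn⟩

/-- Rules that pass the evaluation on the start set down to the leftmost subqueries. If one of these
needs the start set, then the whole start set is loaded; otherwise one start node is enough. -/
def spineRules : List Rule :=
  [.own .spine [4, 5, 7, 10, 11, 12] oneLoop .spine .pos .node .spine .left .zero,
   .own .spine [5, 11] oneLoop .spine .pos .node .spine .right .zero,
   .own .spine [1, 2, 3, 8, 9] startLoop .spine .pos .node .req .zero .fst,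
   .own .spine [13] firstLoop .spine .pos .node .req .zero .fst]

/-- Rules for the evaluation of a query from a node. -/
def reqRules : List Rule :=
  [.own .req [1, 4, 5, 7, 10, 11, 12] oneLoop .req .pos .node .req .left .node,
   .own .req [5, 11] oneLoop .req .pos .node .req .right .node,
   .own .req [2] oneLoop .req .pos .node .ans .pos .node,
   .own .req [3] hasLabLoop .req .pos .node .ans .pos .node,
   .own .req [8] succLoop .req .pos .node .ans .pos .fst,
   .own .req [8] succLoop .endGood .pos .fst .startGood .pos .node,
   .own .req [9] predLoop .req .pos .node .ans .pos .fst,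
   .own .req [9] predLoop .endGood .pos .fst .startGood .pos .node,
   .own .req [13] oneLoop .req .pos .node .all .left .zero,
   .own .req [13] oneLoop .every .pos .zero .startGood .pos .node]

/-- Rules for the evaluation of a query without start set. -/
def allRules : List Rule :=
  [.own .all [1, 4, 5, 7, 10, 11, 12, 13] oneLoop .all .pos .node .all .left .zero,
   .own .all [5, 11] oneLoop .all .pos .node .all .right .zero,
   .own .all [2] nodesLoop .all .pos .node .ans .pos .fst,
   .own .all [3] labeledLoop .all .pos .node .ans .pos .fst,
   .own .all [8] edgesLoop .all .pos .node .ans .pos .snd,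
   .own .all [8] edgesLoop .endGood .pos .snd .startGood .pos .fst,
   .own .all [9] edgesLoop .all .pos .node .ans .pos .fst,
   .own .all [9] edgesLoop .endGood .pos .fst .startGood .pos .snd]

/-- Rules that propagate answers. -/
def ansRules : List Rule :=
  [.own .ans [1, 2, 3] oneLoop .endGood .pos .node .startGood .pos .node,
   .up .ans [1] [0, 1] .ans .pos .node .endGood .pos .node,
   .up .ans [4, 10] [0] .ans .pos .node .req .pright .node,
   .up .ans [4, 10] [1] .ans .pos .node .ans .par .node,
   .up .ans [5, 7, 11, 12, 13] [0, 1] .ans .pos .node .ans .par .node,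
   .up .ans [12] [0, 1] .ans .pos .node .req .pos .node,
   .up .ans [13] [0, 1] .endGood .par .node .every .par .zero]

/-- Rules that propagate nodes that are good as ends downwards. -/
def endGoodRules : List Rule :=
  [.own .endGood [4, 10] oneLoop .endGood .pos .node .endGood .right .node,
   .own .endGood [5, 7, 11, 12] oneLoop .endGood .pos .node .endGood .left .node,
   .own .endGood [5, 11] oneLoop .endGood .pos .node .endGood .right .node]

/-- Rules that propagate nodes that are good as starts upwards. -/
def startGoodRules : List Rule :=
  [.up .startGood [1] [0, 1] .startGood .pos .node .ans .par .node,
   .up .startGood [4, 10] [0] .startGood .pos .node .startGood .par .node,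
   .up .startGood [4, 10] [1] .startGood .pos .node .endGood .pleft .node,
   .up .startGood [5, 7, 11] [0, 1] .startGood .pos .node .startGood .par .node,
   .up .startGood [12] [0, 1] .startGood .pos .node .endGood .pos .node,
   .up .startGood [12] [0, 1] .req .par .node .startGood .par .node,
   .up .startGood [12] [0, 1] .all .par .zero .startGood .par .node]

/-- Rules for queries that lead from every node to a good end. -/
def everyRules : List Rule :=
  [.up .every [1] [0, 1] .all .par .zero .everyEx .par .zero,
   .up .every [4, 10] [0] .every .pos .node .every .par .zero,
   .up .every [5, 7, 11, 12] [0, 1] .every .pos .node .every .par .zero,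
   .own .everyEx [1] nodesLoop .everyEx .pos .node .ans .pos .fst]

/-- All inference rules. -/
def queryRules : List Rule :=
  spineRules ++ (reqRules ++ (allRules ++ (ansRules ++ (endGoodRules ++ (startGoodRules ++
    everyRules)))))

theorem wf_queryRules : ∀ r ∈ queryRules, r.WF := by decide

/-! ### Tables of the input -/

variable {L : Type*} {V : Type*} {G : LabeledGraph L V} {S : Set V}

/-- The input `inp` describes the query `Q` on the graph presented by `D`. -/
structure Describes (inp : Input) (D : Presentation G S) (Q : Query L) : Prop where
  code : ∀ i, i < Q.size → (inp .tag i 0 0, inp .left i 0 0, inp .right i 0 0) =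
    (Q.tree fun a => (D.labelId a : ℕ)).at' 0 i
  tag_end : ∀ i, Q.size ≤ i → inp .tag i 0 0 = 0
  nodeCount : ∀ x y z, inp .nodeCount x y z = D.nodeCount
  start : ∀ i, inp .start i 0 0 = entry (D.start.map fun v => (D.nodeId v : ℕ)) i
  hasLab : ∀ a v, inp .hasLab (D.labelId a) (D.nodeId v) 0 ≠ 0 ↔ v ∈ G.nodeLab a
  labeled : ∀ a i, inp .labeled (D.labelId a) i 0 =
    entry ((D.labeled a).map fun v => (D.nodeId v : ℕ)) i
  edgeSrc : ∀ a i, inp .edgeSrc (D.labelId a) i 0 =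
    entry ((D.edges a).map fun e => (D.nodeId e.1 : ℕ)) i
  edgeTgt : ∀ a i, inp .edgeTgt (D.labelId a) i 0 =
    entry ((D.edges a).map fun e => (D.nodeId e.2 : ℕ)) i
  succ : ∀ a v i, inp .succ (D.labelId a) (D.nodeId v) i =
    entry ((D.succ a v).map fun w => (D.nodeId w : ℕ)) i
  pred : ∀ a v i, inp .pred (D.labelId a) (D.nodeId v) i =
    entry ((D.pred a v).map fun w => (D.nodeId w : ℕ)) i

theorem nodeOf_nodeId (D : Presentation G S) (v : V) : nodeOf D (D.nodeId v) = some v := by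
  simp [nodeOf]

theorem labelOf_labelId (D : Presentation G S) (a : L) : labelOf D (D.labelId a) = some a := by
  simp [labelOf]

theorem describes_ofQuery (D : Presentation G S) (P : NPath L) (hP : P.NegFree) :
    Describes (Input.ofQuery D P) D P.toQuery := by
  have hcode := P.code_toQuery (fun a => (D.labelId a : ℕ)) 0 hP
  refine ⟨fun i hi => ?_, fun i hi => ?_, fun _ _ _ => rfl, fun _ => rfl, fun a v => ?_,
    fun a i => ?_, fun a i => ?_, fun a i => ?_, fun a v i => ?_, fun a v i => ?_⟩
  · have := QTree.code_getElem? (P.toQuery.tree fun a => (D.labelId a : ℕ)) 0 i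
      (by rwa [Query.size_tree])
    rw [hcode, zero_add] at this
    simp [Input.ofQuery, this]
  · have : (P.code (fun a => (D.labelId a : ℕ)) 0)[i]? = none := by
      rw [← hcode, List.getElem?_eq_none_iff, QTree.length_code, Query.size_tree]; exact hi
    simp [Input.ofQuery, this]
  · simp only [Input.ofQuery, nodeOf_nodeId, labelOf_labelId]
    split_ifs with h <;> simp [h]
  all_goals simp only [Input.ofQuery, nodeOf_nodeId, labelOf_labelId]

theorem describes_tag {inp : Input} {D : Presentation G S} {Q : Query L}
    (h : Describes inp D Q) (i : ℕ) : inp .tag i 0 0 ≠ 0 ↔ i < Q.size := by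
  constructor
  · intro hne
    by_contra hi
    exact hne (h.tag_end i (by omega))
  · intro hi
    have := h.code i hi
    rw [show inp .tag i 0 0 = _ from congrArg Prod.fst this]
    exact QTree.tag_at'_ne_zero (Q.wf_tree _) _ _

/-- The map that is required by the engine exists, since right children have only one parent. -/
theorem exists_isRightParent {inp : Input} {D : Presentation G S} {Q : Query L}
    (h : Describes inp D Q) : ∃ rp, IsRightParent inp Q.size rp := by
  classical
  refine ⟨fun x => if x = 0 then Q.size + 1 else
    if hx : ∃ i, i < Q.size ∧ inp .right i 0 0 = x then hx.choose + 1 else 0, by simp, ?_, ?_⟩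
  · intro i hi hne
    have hex : ∃ j, j < Q.size ∧ inp .right j 0 0 = inp .right i 0 0 := ⟨i, hi, rfl⟩
    simp only [if_neg hne, dif_pos hex]
    obtain ⟨h1, h2⟩ := hex.choose_spec
    generalize hex.choose = j at h1 h2 ⊢
    have e : ∀ j, j < Q.size → inp .right j 0 0 =
        ((Q.tree fun a => (D.labelId a : ℕ)).at' 0 j).2.2 := fun j hj =>
      congrArg (fun c => c.2.2) (h.code j hj)
    rw [e i hi] at hne
    rw [e i hi, e _ h1] at h2
    have := QTree.right_injective _ 0 i j (by omega)
      (by rw [Query.size_tree]; omega) (by omega) (by rw [Query.size_tree]; omega) hne h2.symm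
    omega
  · intro x hx hne
    have : ¬ ∃ i, i < Q.size ∧ inp .right i 0 0 = x := fun ⟨i, hi, he⟩ => hne i hi he
    simp [hx, this]

end RAM

/-! ### Subqueries with their contexts -/

namespace Query

variable {L : Type*} {V : Type*}

/-- The context of a subquery in the whole evaluation: `As` are the nodes that may occur as answers,
`K` those that may be good as ends, and `Gs` those that may be good as starts. -/
structure Ctx (V : Type*) where
  As : Set V
  K : Set V
  Gs : Set V

/-- The nodes from which `p` leads to a node of `K`. -/
def dom (G : LabeledGraph L V) (p : Query L) (K : Set V) : Set V := {v | ∃ v', p.sem G v v' ∧ v' ∈ K}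

/-- The nodes from which `p` may be evaluated, if only the facts in `T` may be used and only the
nodes in `A` may be answers. -/
def allowed (G : LabeledGraph L V) (T : Set (GFact L V)) (p : Query L) (A : Set V) : Set V :=
  {v | p.need G (some {v}) ⊆ T ∧ ∀ v', p.sem G v v' → v' ∈ A}

/-- `IsKid G T p c d p' c'` says that `p'` is the left (`d = false`) or the right (`d = true`) child
of `p`, and that its context is `c'` if that of `p` is `c`. An answer of the left part of a
composition must be a node where the right part may be evaluated, and its ends are good if the right
part leads from them to good ends. An end of one round of `p⁺` is good also if further rounds lead
from it to a good end. Below `goto` no end is good, since the start is forgotten there. -/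
inductive IsKid (G : LabeledGraph L V) (T : Set (GFact L V)) :
    Query L → Ctx V → Bool → Query L → Ctx V → Prop where
  | ex (p c) : IsKid G T (.ex p) c false p
      ⟨Set.univ, Set.univ, {v | v ∈ c.As ∧ (v ∈ c.K → v ∈ c.Gs)}⟩
  | test (p c) : IsKid G T (.test p) c false p c
  | plus (p c) : IsKid G T (.plus p) c false p
      ⟨c.As ∩ allowed G T (.plus p) c.As, c.K ∪ dom G (.plus p) c.K, dom G (.plus p) c.K⟩
  | goto (p c) : IsKid G T (.goto p) c false p ⟨{v | v ∈ c.As ∧ ∃ w, p.sem G w v}, ∅, ∅⟩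
  | seqL (b p p' c) : IsKid G T (.seq b p p') c false p ⟨allowed G T p' c.As, dom G p' c.K, c.Gs⟩
  | seqR (b p p' c) : IsKid G T (.seq b p p') c true p' ⟨c.As, c.K, dom G p' c.K⟩
  | unionL (b p p' c) : IsKid G T (.union b p p') c false p c
  | unionR (b p p' c) : IsKid G T (.union b p p') c true p' c

/-- The number of a child of the node number `q` of a syntax tree. -/
def kidPos : Query L → ℕ → Bool → ℕ
  | .seq _ p _, q, true => q + 1 + p.size
  | .union _ p _, q, true => q + 1 + p.size
  | _, q, _ => q + 1

/-- `Occ G T Q c₀ q p c` says that the subquery of `Q` at position `q` is `p`, and that its context is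
`c` if that of `Q` is `c₀`. -/
inductive Occ (G : LabeledGraph L V) (T : Set (GFact L V)) (Q : Query L) (c₀ : Ctx V) :
    ℕ → Query L → Ctx V → Prop where
  | root : Occ G T Q c₀ 0 Q c₀
  | kid {q p c d p' c'} : Occ G T Q c₀ q p c → IsKid G T p c d p' c' →
      Occ G T Q c₀ (p.kidPos q d) p' c'

variable {G : LabeledGraph L V} {T : Set (GFact L V)} {Q : Query L} {c₀ : Ctx V}

theorem size_pos (p : Query L) : 0 < p.size := by cases p <;> simp [size]

theorem Occ.hasCode (lab : L → ℕ) {q : ℕ} {p : Query L} {c : Ctx V} (h : Occ G T Q c₀ q p c) :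
    RAM.HasCode ((Q.tree lab).code 0) q ((p.tree lab).code q) := by
  induction h with
  | root => intro i _; simp
  | kid _ hk ih =>
    cases hk <;>
      simp only [tree, QTree.code, RAM.hasCode_cons, RAM.hasCode_append, kidPos, size_tree,
        QTree.length_code] at ih ⊢
    all_goals first
      | exact ih.2.2
      | exact ih.2.1
      | exact ih.2

theorem Occ.lt {q : ℕ} {p : Query L} {c : Ctx V} (h : Occ G T Q c₀ q p c) : q < Q.size := by
  have := h.hasCode (fun _ => 0) 0 (by rw [QTree.length_code, size_tree]; exact p.size_pos)
  rw [QTree.code_getElem? (p.tree _) q 0 (by rw [size_tree]; exact p.size_pos)] at this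
  have := (List.getElem?_eq_some_iff.1 this).1
  rwa [QTree.length_code, size_tree] at this

variable {S : Set V} {D : Presentation G S} {inp : RAM.Input}

theorem Occ.read (hD : RAM.Describes inp D Q) {q : ℕ} {p : Query L} {c : Ctx V}
    (h : Occ G T Q c₀ q p c) : (inp .tag q 0 0, inp .left q 0 0, inp .right q 0 0) =
      (p.tree fun a => (D.labelId a : ℕ)).at' q q := by
  have := h.hasCode (fun a => (D.labelId a : ℕ)) 0
    (by rw [QTree.length_code, size_tree]; exact p.size_pos)
  rw [QTree.code_getElem? (p.tree _) q 0 (by rw [size_tree]; exact p.size_pos),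
    QTree.code_getElem? (Q.tree _) 0 (q + 0) (by rw [size_tree]; exact h.lt)] at this
  rw [hD.code q h.lt]
  simpa using this

theorem Occ.tag_eq (hD : RAM.Describes inp D Q) {q : ℕ} {p : Query L} {c : Ctx V}
    (h : Occ G T Q c₀ q p c) : inp .tag q 0 0 = p.tag := by
  rw [show inp .tag q 0 0 = _ from congrArg Prod.fst (h.read hD)]
  cases p <;> simp [tree, QTree.at', tag]

theorem Occ.left_eq (hD : RAM.Describes inp D Q) {q : ℕ} {p : Query L} {c : Ctx V}
    (h : Occ G T Q c₀ q p c) {d : Bool} {p' : Query L} {c' : Ctx V} (hk : IsKid G T p c d p' c') :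
    inp .left q 0 0 = q + 1 := by
  rw [show inp .left q 0 0 = _ from congrArg (fun x => x.2.1) (h.read hD)]
  cases hk <;> simp [tree, QTree.at']

theorem Occ.right_eq (hD : RAM.Describes inp D Q) {q : ℕ} {p : Query L} {c : Ctx V}
    (h : Occ G T Q c₀ q p c) {p' : Query L} {c' : Ctx V} (hk : IsKid G T p c true p' c') :
    inp .right q 0 0 = p.kidPos q true := by
  rw [show inp .right q 0 0 = _ from congrArg (fun x => x.2.2) (h.read hD)]
  cases hk <;> simp [tree, QTree.at', kidPos, size_tree]

theorem IsKid.kidPos_eq {p p' : Query L} {c c' : Ctx V} (hk : IsKid G T p c false p' c') (q : ℕ) :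
    p.kidPos q false = q + 1 := by
  cases hk <;> rfl

theorem lt_kidPos (p : Query L) (q : ℕ) (d : Bool) : q < p.kidPos q d := by
  unfold kidPos
  split <;> omega

/-- The machine finds the parent of a position. -/
theorem Occ.parent (hD : RAM.Describes inp D Q) {rp : ℕ → ℕ}
    (hrp : RAM.IsRightParent inp Q.size rp) {q : ℕ} {p : Query L} {c : Ctx V}
    (h : Occ G T Q c₀ q p c) {d : Bool} {p' : Query L} {c' : Ctx V} (hk : IsKid G T p c d p' c') :
    rp (p.kidPos q d) = if d then q + 1 else 0 := by
  have hpos := lt_kidPos p q d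
  cases d with
  | true =>
    rw [← h.right_eq hD hk, hrp.right q h.lt (by rw [h.right_eq hD hk]; omega)]
    rfl
  | false =>
    refine hrp.left _ (by omega) fun i hi he => ?_
    have h1 : inp .right i 0 0 = ((Q.tree fun a => (D.labelId a : ℕ)).at' 0 i).2.2 :=
      congrArg (fun c => c.2.2) (hD.code i hi)
    have h2 := QTree.leaf_before_right (Q.wf_tree fun a => (D.labelId a : ℕ)) 0 i (by omega)
      (by rw [size_tree]; omega) (by rw [← h1]; omega)
    rw [← h1, he, hk.kidPos_eq, Nat.add_sub_cancel, ← hD.code q h.lt] at h2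
    simp only [h.tag_eq hD] at h2
    cases hk
    all_goals simp [tag] at h2
    all_goals split_ifs at h2 <;> simp at h2

theorem Occ.inv (hD : RAM.Describes inp D Q) {rp : ℕ → ℕ}
    (hrp : RAM.IsRightParent inp Q.size rp) {x : ℕ} {p : Query L} {c : Ctx V}
    (h : Occ G T Q c₀ x p c) : (x = 0 ∧ p = Q ∧ c = c₀) ∨ ∃ q p₁ c₁ d, Occ G T Q c₀ q p₁ c₁ ∧
      IsKid G T p₁ c₁ d p c ∧ x = p₁.kidPos q d ∧ q < x ∧ rp x = if d then q + 1 else 0 := by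
  cases h with
  | root => exact .inl ⟨rfl, rfl, rfl⟩
  | kid h hk => exact .inr ⟨_, _, _, _, h, hk, rfl, lt_kidPos _ _ _, h.parent hD hrp hk⟩

theorem IsKid.unique {p p₁ p₂ : Query L} {c c₁ c₂ : Ctx V} {d : Bool}
    (h₁ : IsKid G T p c d p₁ c₁) (h₂ : IsKid G T p c d p₂ c₂) : p₁ = p₂ ∧ c₁ = c₂ := by
  cases h₁ <;> cases h₂ <;> exact ⟨rfl, rfl⟩

/-- A position determines its subquery and its context. -/
theorem Occ.unique (hD : RAM.Describes inp D Q) {x : ℕ} {p₁ p₂ : Query L} {c₁ c₂ : Ctx V}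
    (h₁ : Occ G T Q c₀ x p₁ c₁) (h₂ : Occ G T Q c₀ x p₂ c₂) : p₁ = p₂ ∧ c₁ = c₂ := by
  obtain ⟨rp, hrp⟩ := RAM.exists_isRightParent hD
  induction x using Nat.strong_induction_on generalizing p₁ p₂ c₁ c₂ with
  | _ x ih =>
    rcases h₁.inv hD hrp with ⟨rfl, rfl, rfl⟩ | ⟨q, e, c, d, ho, hk, hx, hlt, hr⟩
    · rcases h₂.inv hD hrp with ⟨_, rfl, rfl⟩ | ⟨q, e, c, d, ho, hk, hx, hlt, hr⟩
      · exact ⟨rfl, rfl⟩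
      · omega
    · rcases h₂.inv hD hrp with ⟨rfl, _, _⟩ | ⟨q', e', c', d', ho', hk', hx', hlt', hr'⟩
      · omega
      · have hdq : d = d' ∧ q = q' := by
          cases d <;> cases d' <;> simp at hr hr'
          · rw [hk.kidPos_eq] at hx
            rw [hk'.kidPos_eq] at hx'
            exact ⟨rfl, by omega⟩
          · omega
          · omega
          · exact ⟨rfl, by omega⟩
        obtain ⟨rfl, rfl⟩ := hdq
        obtain ⟨rfl, rfl⟩ := ih q hlt ho ho'
        exact hk.unique hk'

end Query

namespace RAM

open Query

variable {L : Type*} {V : Type*} {G : LabeledGraph L V} {S : Set V}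

/-! ### Soundness of the rules -/

/-- The nodes of the numbers that are enumerated. -/
def Loop.Enumerates (inp : Input) (e : Var → ℕ) (l : Loop) (xs : List ℕ) : Prop :=
  l.once = false ∧ ∀ j, l.val inp e j = entry xs j

theorem entry_eq_zero {xs : List ℕ} {j : ℕ} : entry xs j = 0 ↔ xs.length ≤ j := by
  unfold entry
  rcases h : xs[j]? with - | a
  · simpa using h
  · have := (List.getElem?_eq_some_iff.1 h).1
    simp; omega

theorem entry_of_lt {xs : List ℕ} {j : ℕ} (h : j < xs.length) : entry xs j - 1 = xs[j] := by
  simp [entry, h]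

theorem Loop.Enumerates.ends {inp : Input} {e : Var → ℕ} {l : Loop} {xs : List ℕ}
    (h : l.Enumerates inp e xs) : l.Ends inp e :=
  .inr ⟨xs.length, by rw [h.2, entry_eq_zero]⟩

theorem Loop.Enumerates.length {inp : Input} {e : Var → ℕ} {l : Loop} {xs : List ℕ}
    (h : l.Enumerates inp e xs) : l.length inp e = xs.length := by
  unfold Loop.length
  rw [h.1]
  simp only [Bool.false_eq_true, if_false]
  have : {j | l.val inp e j = 0} = Set.Ici xs.length := by
    ext j
    rw [Set.mem_ofPred_eq, h.2, entry_eq_zero, Set.mem_Ici]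
  rw [this, csInf_Ici]

theorem Loop.Enumerates.val {inp : Input} {e : Var → ℕ} {l : Loop} {xs : List ℕ}
    (h : l.Enumerates inp e xs) {j : ℕ} (hj : j < l.length inp e) :
    l.val inp e j - 1 = xs[j]'(by rwa [h.length] at hj) := by
  rw [h.2, entry_of_lt]

/-- The facts that are shared by the arguments about the rules: the input describes the query, the
facts in `T` include the needed ones, and the nodes in `W` include those of `T` and the first start
node. -/
structure Setting (inp : Input) (D : Presentation G S) (Q : Query L) (rp : ℕ → ℕ)
    (T : Set (GFact L V)) (W : Set V) : Prop where
  desc : Describes inp D Q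
  parent : IsRightParent inp Q.size rp
  need : Q.need G (some S) ⊆ T
  node : ∀ v, .node v ∈ T → v ∈ W
  lab : ∀ a v, .lab a v ∈ T → v ∈ W
  edge : ∀ a v w, .edge a v w ∈ T → v ∈ W ∧ w ∈ W
  first : ∀ v, D.start.head? = some v → v ∈ W

/-- The meaning of an item of kind `k` for the query `p` in the context `c`; `x` is the number of a
node, or `0` if there is no node. -/
def Good (D : Presentation G S) (T : Set (GFact L V)) (W : Set V) (p : Query L) (c : Ctx V)
    (x : ℕ) : Kind → Prop
  | .req => ∃ v, x = D.nodeId v ∧ v ∈ W ∧ p.need G (some {v}) ⊆ T ∧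
      ∀ v', p.sem G v v' → v' ∈ c.As ∧ (v' ∈ c.K → v ∈ c.Gs)
  | .ans => ∃ v, x = D.nodeId v ∧ v ∈ W ∧ v ∈ c.As ∧ (p.tag ∈ [1, 2, 3] → v ∈ c.K → v ∈ c.Gs)
  | .endGood => ∃ v, x = D.nodeId v ∧ v ∈ W ∧ v ∈ c.K
  | .startGood => ∃ v, x = D.nodeId v ∧ v ∈ W ∧ v ∈ c.Gs
  | .all => x = 0 ∧ p.need G none ⊆ T ∧
      ∀ v v', p.sem G v v' → v' ∈ c.As ∧ (v' ∈ c.K → v ∈ c.Gs)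
  | .every => x = 0 ∧ ∀ v, v ∈ p.dom G c.K
  | .everyEx => x = 0 ∧ p.tag = 1 ∧ Set.range GFact.node ⊆ T ∧
      ∀ v, v ∈ c.As ∧ (v ∈ c.K → v ∈ c.Gs)
  | .spine => x = 0 ∧ p.need G (some S) ⊆ T

/-- The context of the whole query. -/
def rootCtx (G : LabeledGraph L V) (S : Set V) (Q : Query L) : Ctx V := ⟨Q.answers G S, ∅, ∅⟩

/-- The item `x` is correct, and licensed by the facts in `T`. -/
def Sound (D : Presentation G S) (Q : Query L) (T : Set (GFact L V)) (W : Set V) (x : Item) :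
    Prop :=
  ∃ p c, Occ G T Q (rootCtx G S Q) x.q p c ∧ Good D T W p c x.v x.k

variable {D : Presentation G S} {Q : Query L} {T : Set (GFact L V)} {W : Set V} {inp : Input}
  {rp : ℕ → ℕ}

theorem Good.le {p : Query L} {c : Ctx V} {x : ℕ} {k : Kind} (h : Good D T W p c x k) :
    x ≤ D.nodeCount := by
  cases k
  case req | ans | endGood | startGood => obtain ⟨v, rfl, -⟩ := h; exact (D.nodeId v).2.le
  case all | every | everyEx | spine => rw [h.1]; exact Nat.zero_le _

theorem Sound.valid {x : Item} (h : Sound D Q T W x) : x.Valid Q.size D.nodeCount := by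
  obtain ⟨p, c, ho, hg⟩ := h
  exact ⟨ho.lt, hg.le⟩

/-- The property of an implication that is needed for soundness. -/
def ActOK (D : Presentation G S) (Q : Query L) (T : Set (GFact L V)) (W : Set V)
    (py : Item × Item) : Prop :=
  py.1.Valid Q.size D.nodeCount ∧ py.2.Valid Q.size D.nodeCount ∧
    (Sound D Q T W py.1 → Sound D Q T W py.2)

/-- An implication is sound if its conclusion is good whenever its premise is; that the positions
determine subqueries and contexts makes it enough to consider one subquery and context each. -/
theorem actOK_of (hs : Setting inp D Q rp T W) {py : Item × Item} {k k' : Kind} {q q' v v' : ℕ}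
    {p p' : Query L} {c c' : Ctx V} (h₁ : py.1 = ⟨k, q, v⟩) (h₂ : py.2 = ⟨k', q', v'⟩)
    (ho : Occ G T Q (rootCtx G S Q) q p c) (ho' : Occ G T Q (rootCtx G S Q) q' p' c')
    (hv : v ≤ D.nodeCount) (hv' : v' ≤ D.nodeCount)
    (h : Good D T W p c v k → Good D T W p' c' v' k') : ActOK D Q T W py := by
  refine ⟨by rw [h₁]; exact ⟨ho.lt, hv⟩, by rw [h₂]; exact ⟨ho'.lt, hv'⟩, ?_⟩
  rw [h₁, h₂]
  rintro ⟨p₁, c₁, ho₁, hg⟩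
  obtain ⟨rfl, rfl⟩ := ho₁.unique hs.desc ho
  exact ⟨p', c', ho', h hg⟩

theorem exists_left {p : Query L} (c : Ctx V) (h : p.tag ∈ [1, 4, 5, 7, 10, 11, 12, 13]) :
    ∃ p' c', IsKid G T p c false p' c' := by
  cases p
  case ex p => exact ⟨_, _, .ex p c⟩
  case test p => exact ⟨_, _, .test p c⟩
  case plus p => exact ⟨_, _, .plus p c⟩
  case goto p => exact ⟨_, _, .goto p c⟩
  case seq b p p' => exact ⟨_, _, .seqL b p p' c⟩
  case union b p p' => exact ⟨_, _, .unionL b p p' c⟩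
  all_goals simp [tag] at h

theorem exists_right {p : Query L} (c : Ctx V) (h : p.tag ∈ [4, 5, 10, 11]) :
    ∃ p' c', IsKid G T p c true p' c' := by
  cases p
  case seq b p p' => exact ⟨_, _, .seqR b p p' c⟩
  case union b p p' => exact ⟨_, _, .unionR b p p' c⟩
  all_goals simp [tag] at h

/-- The facts about the parent of a position that are used by the rules. -/
theorem exists_parent (hs : Setting inp D Q rp T W) {x : Item} {p : Query L} {c : Ctx V}
    (h : Occ G T Q (rootCtx G S Q) x.q p c) (ht : env inp rp x .ptag ≠ 0) :
    ∃ q p₁ c₁ d, Occ G T Q (rootCtx G S Q) q p₁ c₁ ∧ IsKid G T p₁ c₁ d p c ∧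
      x.q = p₁.kidPos q d ∧ env inp rp x .par = q ∧ env inp rp x .ptag = p₁.tag ∧
      env inp rp x .side = (if d then 1 else 0) ∧ env inp rp x .pleft = inp .left q 0 0 ∧
      env inp rp x .pright = inp .right q 0 0 := by
  rcases h.inv hs.desc hs.parent with ⟨h0, -, -⟩ | ⟨q, p₁, c₁, d, ho, hk, hx, hlt, hr⟩
  · exfalso
    refine ht ?_
    simp [env, h0, hs.parent.root, hs.desc.tag_end]
  · have hpar : (if rp x.q = 0 then x.q - 1 else rp x.q - 1) = q := by
      cases d
      · rw [hk.kidPos_eq] at hx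
        simp at hr
        rw [if_pos hr]; omega
      · simp at hr
        rw [if_neg (by omega)]; omega
    refine ⟨q, p₁, c₁, d, ho, hk, hx, ?_, ?_, ?_, ?_, ?_⟩
    · exact hpar
    · simp only [env, hpar, ho.tag_eq hs.desc]
    · cases d <;> simp at hr <;> simp [env, hr]
    · simp only [env, hpar]
    · simp only [env, hpar]

/-- The number of an element of an enumeration of nodes. -/
theorem Loop.Enumerates.exists_node {e : Var → ℕ} {l : Loop} {vs : List V}
    (h : l.Enumerates inp e (vs.map fun v => (D.nodeId v : ℕ))) {j : ℕ}
    (hj : j < l.length inp e) : ∃ v ∈ vs, l.val inp e j - 1 = D.nodeId v := by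
  have hj' : j < vs.length := by rw [h.length, List.length_map] at hj; exact hj
  refine ⟨vs[j], List.getElem_mem _, ?_⟩
  rw [h.val hj]; simp

theorem enum_start (hs : Setting inp D Q rp T W) (x : Item) :
    startLoop.Enumerates inp (env inp rp x) (D.start.map fun v => (D.nodeId v : ℕ)) := by
  refine ⟨rfl, fun j => ?_⟩
  rw [← hs.desc.start]
  simp [Loop.val, startLoop, env]

theorem enum_nodes (hs : Setting inp D Q rp T W) (x : Item) :
    nodesLoop.Enumerates inp (env inp rp x) (List.range D.nodeCount).reverse := by
  refine ⟨rfl, fun j => ?_⟩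
  simp only [Loop.val, nodesLoop, hs.desc.nodeCount, Function.update_self]
  by_cases hj : j < D.nodeCount
  · rw [entry, List.getElem?_reverse (by simpa using hj)]
    rw [List.getElem?_range (by simp; omega)]
    simp; omega
  · rw [entry_eq_zero.2 (by simpa using hj)]; omega

theorem enum_labeled (hs : Setting inp D Q rp T W) {x : Item} {a : L}
    (hx : inp .left x.q 0 0 = D.labelId a) : labeledLoop.Enumerates inp (env inp rp x)
      ((D.labeled a).map fun v => (D.nodeId v : ℕ)) := by
  refine ⟨rfl, fun j => ?_⟩
  rw [← hs.desc.labeled, ← hx]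
  simp [Loop.val, labeledLoop, env]

theorem enum_edges (hs : Setting inp D Q rp T W) {x : Item} {a : L}
    (hx : inp .left x.q 0 0 = D.labelId a) : edgesLoop.Enumerates inp (env inp rp x)
      ((D.edges a).map fun e => (D.nodeId e.1 : ℕ)) := by
  refine ⟨rfl, fun j => ?_⟩
  rw [← hs.desc.edgeSrc, ← hx]
  simp [Loop.val, edgesLoop, env]

theorem enum_succ (hs : Setting inp D Q rp T W) {x : Item} {a : L} {v : V}
    (hx : inp .left x.q 0 0 = D.labelId a) (hv : x.v = D.nodeId v) :
    succLoop.Enumerates inp (env inp rp x) ((D.succ a v).map fun v => (D.nodeId v : ℕ)) := by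
  refine ⟨rfl, fun j => ?_⟩
  rw [← hs.desc.succ, ← hx, ← hv]
  simp [Loop.val, succLoop, env]

theorem enum_pred (hs : Setting inp D Q rp T W) {x : Item} {a : L} {v : V}
    (hx : inp .left x.q 0 0 = D.labelId a) (hv : x.v = D.nodeId v) :
    predLoop.Enumerates inp (env inp rp x) ((D.pred a v).map fun v => (D.nodeId v : ℕ)) := by
  refine ⟨rfl, fun j => ?_⟩
  rw [← hs.desc.pred, ← hx, ← hv]
  simp [Loop.val, predLoop, env]

theorem exists_edge (hs : Setting inp D Q rp T W) {x : Item} {a : L}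
    (hx : inp .left x.q 0 0 = D.labelId a) {j : ℕ}
    (hj : j < edgesLoop.length inp (env inp rp x)) : ∃ v w, (v, w) ∈ G.edge a ∧
      edgesLoop.val inp (env inp rp x) j - 1 = D.nodeId v ∧
      edgesLoop.val' inp (env inp rp x) j - 1 = D.nodeId w := by
  have h := enum_edges hs hx
  have hj' : j < (D.edges a).length := by rw [h.length, List.length_map] at hj; exact hj
  refine ⟨(D.edges a)[j].1, (D.edges a)[j].2, (D.mem_edges a _).1 (List.getElem_mem _), ?_, ?_⟩
  · rw [h.val hj]; simp
  · have : edgesLoop.val' inp (env inp rp x) j =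
        entry ((D.edges a).map fun e => (D.nodeId e.2 : ℕ)) j := by
      rw [← hs.desc.edgeTgt, ← hx]; simp [Loop.val', edgesLoop, env]
    rw [this, entry_of_lt (by simpa using hj')]; simp

theorem left_of_label (hs : Setting inp D Q rp T W) {q : ℕ} {p : Query L} {c : Ctx V}
    (h : Occ G T Q (rootCtx G S Q) q p c) {a : L} (hp : p = .lab a ∨ p = .edge a ∨ p = .inv a) :
    inp .left q 0 0 = D.labelId a := by
  rw [show inp .left q 0 0 = _ from congrArg (fun x => x.2.1) (h.read hs.desc)]
  rcases hp with rfl | rfl | rfl <;> rfl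

end RAM

namespace RAM

open Query

variable {L : Type*} {V : Type*} {G : LabeledGraph L V} {S : Set V} {D : Presentation G S}
  {Q : Query L} {T : Set (GFact L V)} {W : Set V} {inp : Input} {rp : ℕ → ℕ}

/-- A bound for the number of elements of the enumerations at an item with node number `x`: the
number of the edge facts at this node, and for items without a node (where `x = 0`) the number of all
facts. -/
noncomputable def localSize (D : Presentation G S) (T : Set (GFact L V)) (x : ℕ) : ℕ :=
  {f | f ∈ T ∧ ∃ a v w, f = .edge a v w ∧ x = D.nodeId v}.ncard +
    {f | f ∈ T ∧ ∃ a v w, f = .edge a v w ∧ x = D.nodeId w}.ncard + if x = 0 then T.ncard else 0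

/-- All that has to be known about a rule: at a sound item its enumeration ends, is short, and leads
only to valid implications. -/
def RuleOK (D : Presentation G S) (Q : Query L) (T : Set (GFact L V)) (W : Set V) (inp : Input)
    (rp : ℕ → ℕ) (r : Rule) : Prop :=
  ∀ x, Sound D Q T W x → r.Fires (env inp rp x) → r.loop.Ends inp (env inp rp x) ∧
    r.loop.length inp (env inp rp x) ≤ 1 + localSize D T x.v ∧
    ∀ j < r.loop.length inp (env inp rp x), ActOK D Q T W (r.inst inp (env inp rp x) j)

theorem Loop.length_le_one {e : Var → ℕ} {l : Loop} (hl : l.once = true) :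
    l.length inp e ≤ 1 := by
  unfold Loop.length
  rw [if_pos hl]
  split_ifs <;> omega

theorem Loop.val_ne_zero {e : Var → ℕ} {l : Loop} (hl : l.once = true)
    (h : l.length inp e ≠ 0) : l.val inp e 0 ≠ 0 := by
  intro h0
  apply h
  unfold Loop.length
  rw [if_pos hl, if_pos h0]

theorem occ_left (hs : Setting inp D Q rp T W) {q : ℕ} {p p' : Query L} {c c' : Ctx V}
    (h : Occ G T Q (rootCtx G S Q) q p c) (hk : IsKid G T p c false p' c') :
    Occ G T Q (rootCtx G S Q) (inp .left q 0 0) p' c' := by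
  rw [h.left_eq hs.desc hk, ← hk.kidPos_eq]; exact h.kid hk

theorem occ_right (hs : Setting inp D Q rp T W) {q : ℕ} {p p' : Query L} {c c' : Ctx V}
    (h : Occ G T Q (rootCtx G S Q) q p c) (hk : IsKid G T p c true p' c') :
    Occ G T Q (rootCtx G S Q) (inp .right q 0 0) p' c' := by
  rw [h.right_eq hs.desc hk]; exact h.kid hk

/-- Rules whose enumeration has at most one element. -/
theorem ruleOK_once (hs : Setting inp D Q rp T W) {k : Kind} {tags : List ℕ} {l : Loop}
    {pk : Kind} {pp pn : Var} {ck : Kind} {cp cn : Var} (hl : l.once = true)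
    (H : ∀ q v p c, Occ G T Q (rootCtx G S Q) q p c → p.tag ∈ tags → Good D T W p c v k →
      l.val inp (env inp rp ⟨k, q, v⟩) 0 ≠ 0 → ActOK D Q T W
        ((Rule.own k tags l pk pp pn ck cp cn).inst inp (env inp rp ⟨k, q, v⟩) 0)) :
    RuleOK D Q T W inp rp (.own k tags l pk pp pn ck cp cn) := by
  rintro ⟨k', q, v⟩ ⟨p, c, ho, hg⟩ ⟨h1, h2, -⟩
  obtain rfl : k' = k := Kind.code_injective h1
  have hlen := Loop.length_le_one (inp := inp) (e := env inp rp ⟨k', q, v⟩) hl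
  refine ⟨.inl hl, le_trans hlen (Nat.le_add_right _ _), fun j hj => ?_⟩
  have h0 : j = 0 := by
    have : j < l.length inp (env inp rp ⟨k', q, v⟩) := hj
    omega
  subst h0
  refine H q v p c ho ?_ hg (Loop.val_ne_zero hl (Nat.pos_iff_ne_zero.1 hj))
  rw [← ho.tag_eq hs.desc]; exact h2

/-- Rules that depend on the parent. -/
theorem ruleOK_up (hs : Setting inp D Q rp T W) {k : Kind} {tags sides : List ℕ}
    {pk : Kind} {pp pn : Var} {ck : Kind} {cp cn : Var} (ht : 0 ∉ tags)
    (H : ∀ x q v p c p₁ c₁ d, x = ⟨k, q, v⟩ → Occ G T Q (rootCtx G S Q) q p c →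
      Good D T W p c v k → IsKid G T p₁ c₁ d p c → p₁.tag ∈ tags → (if d then 1 else 0) ∈ sides →
      Occ G T Q (rootCtx G S Q) (env inp rp x .par) p₁ c₁ →
      (∀ p' c', IsKid G T p₁ c₁ false p' c' →
        Occ G T Q (rootCtx G S Q) (env inp rp x .pleft) p' c') →
      (∀ p' c', IsKid G T p₁ c₁ true p' c' →
        Occ G T Q (rootCtx G S Q) (env inp rp x .pright) p' c') →
      ActOK D Q T W (⟨pk, env inp rp x pp, env inp rp x pn⟩, ⟨ck, env inp rp x cp, env inp rp x cn⟩))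
    (hreg : pp.IsReg && pn.IsReg && cp.IsReg && cn.IsReg) :
    RuleOK D Q T W inp rp (.up k tags sides pk pp pn ck cp cn) := by
  rintro ⟨k', q, v⟩ ⟨p, c, ho, hg⟩ ⟨h1, h2, h3⟩
  obtain rfl : k' = k := Kind.code_injective h1
  have hlen := Loop.length_le_one (inp := inp) (e := env inp rp ⟨k', q, v⟩) (l := oneLoop) rfl
  refine ⟨.inl rfl, le_trans hlen (Nat.le_add_right _ _), fun j hj => ?_⟩
  have hne : env inp rp ⟨k', q, v⟩ .ptag ≠ 0 := fun h => ht (h ▸ h2)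
  obtain ⟨q₁, p₁, c₁, d, ho₁, hk, -, hpar, hptag, hside, hpl, hpr⟩ := exists_parent hs ho hne
  have hreg' : ∀ y : Var, y.IsReg → (Rule.up k' tags sides pk pp pn ck cp cn).loop.env inp
      (env inp rp ⟨k', q, v⟩) j y = env inp rp ⟨k', q, v⟩ y := by
    intro y hy
    cases y <;> simp [Var.IsReg] at hy <;> rfl
  simp only [Bool.and_eq_true] at hreg
  obtain ⟨⟨⟨hr1, hr2⟩, hr3⟩, hr4⟩ := hreg
  have hinst : (Rule.up k' tags sides pk pp pn ck cp cn).inst inp (env inp rp ⟨k', q, v⟩) j =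
      (⟨pk, env inp rp ⟨k', q, v⟩ pp, env inp rp ⟨k', q, v⟩ pn⟩,
        ⟨ck, env inp rp ⟨k', q, v⟩ cp, env inp rp ⟨k', q, v⟩ cn⟩) := by
    rw [← hreg' _ hr1, ← hreg' _ hr2, ← hreg' _ hr3, ← hreg' _ hr4]; rfl
  rw [hinst]
  refine H _ q v p c p₁ c₁ d rfl ho hg hk (hptag ▸ h2) (hside ▸ h3) (by rwa [hpar]) ?_ ?_
  · intro p' c' hk'
    rw [hpl]; exact occ_left hs ho₁ hk'
  · intro p' c' hk'
    rw [hpr]; exact occ_right hs ho₁ hk'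

theorem good_req_root (hs : Setting inp D Q rp T W) {v : V} (hv : v ∈ S) (hw : v ∈ W) :
    Good D T W Q (rootCtx G S Q) (D.nodeId v) .req :=
  ⟨v, rfl, hw, (Q.need_mono (Set.singleton_subset_iff.2 hv)).trans hs.need,
    fun _ hv' => ⟨⟨v, hv, hv'⟩, fun h => h.elim⟩⟩

theorem nodeId_le (v : V) : (D.nodeId v : ℕ) ≤ D.nodeCount := (D.nodeId v).2.le

/-- Requests are passed to the body of an iteration. -/
theorem good_req_plus {p : Query L} {c : Ctx V} {v : V} (hw : v ∈ W)
    (h : v ∈ allowed G T (.plus p) c.As) : Good D T W p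
      ⟨c.As ∩ allowed G T (.plus p) c.As, c.K ∪ dom G (.plus p) c.K, dom G (.plus p) c.K⟩
      (D.nodeId v) .req := by
  refine ⟨v, rfl, hw, (p.need_mono Set.subset_union_left).trans h.1, fun v' hv' => ⟨⟨?_, ?_, ?_⟩, ?_⟩⟩
  · exact h.2 _ (.single hv')
  · refine (p.need_mono ?_).trans h.1
    rintro w (rfl | ⟨s, rfl, hw⟩)
    · exact .inr ⟨v, rfl, .single hv'⟩
    · exact .inr ⟨v, rfl, .head hv' hw⟩
  · intro w hw
    exact h.2 _ (.head hv' hw)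
  · rintro (hk | ⟨w, hw, hk⟩)
    · exact ⟨v', .single hv', hk⟩
    · exact ⟨w, .head hv' hw, hk⟩

/-- Requests are passed to the left child. For a composition, an answer of the left part is licensed
for a request to the right part; for `[P]`, a good start of `P` is an answer. -/
theorem good_req_left {p p' : Query L} {c c' : Ctx V} {v : ℕ} (ht : p.tag ≠ 13)
    (hk : IsKid G T p c false p' c') (h : Good D T W p c v .req) : Good D T W p' c' v .req := by
  obtain ⟨v, rfl, hw, hn, hv⟩ := h
  cases hk with
  | ex p₀ => exact ⟨v, rfl, hw, Set.subset_union_right.trans hn, fun v' hv' =>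
      ⟨trivial, fun _ => hv v ⟨rfl, v', hv'⟩⟩⟩
  | test p => exact ⟨v, rfl, hw, hn, hv⟩
  | plus p => exact good_req_plus hw ⟨hn, fun v' hv' => (hv v' hv').1⟩
  | goto p => simp [tag] at ht
  | seqL b p p₂ =>
    refine ⟨v, rfl, hw, Set.subset_union_left.trans hn, fun v' hv' => ⟨⟨?_, ?_⟩, ?_⟩⟩
    · refine (p₂.need_mono ?_).trans (Set.subset_union_right.trans hn)
      rintro _ rfl
      exact ⟨v, rfl, hv'⟩
    · exact fun w hw => (hv w ⟨v', hv', hw⟩).1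
    · rintro ⟨w, hw, hK⟩
      exact (hv w ⟨v', hv', hw⟩).2 hK
  | unionL b p p₂ =>
    exact ⟨v, rfl, hw, Set.subset_union_left.trans hn, fun v' hv' => hv v' (.inl hv')⟩

/-- Evaluation without start set is passed to the left child. -/
theorem good_all_left {p p' : Query L} {c c' : Ctx V} {v : ℕ}
    (hk : IsKid G T p c false p' c') (h : Good D T W p c v .all) : Good D T W p' c' 0 .all := by
  obtain ⟨rfl, hn, hv⟩ := h
  cases hk with
  | ex p => exact ⟨rfl, Set.subset_union_right.trans hn, fun v v' hv' =>
      ⟨trivial, fun _ => hv v v ⟨rfl, v', hv'⟩⟩⟩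
  | test p => exact ⟨rfl, hn, hv⟩
  | plus p =>
    refine ⟨rfl, Set.subset_union_left.trans hn, fun v v' hv' => ⟨⟨?_, ?_, ?_⟩, ?_⟩⟩
    · exact (hv v v' (.single hv')).1
    · refine (p'.need_mono ?_).trans (Set.subset_union_right.trans hn)
      rintro w (rfl | ⟨s, rfl, hw⟩)
      · exact ⟨v, .single hv'⟩
      · exact ⟨v, .head hv' hw⟩
    · intro w hw
      exact (hv v w (.head hv' hw)).1
    · rintro (hk | ⟨w, hw, hk⟩)
      · exact ⟨v', .single hv', hk⟩
      · exact ⟨w, .head hv' hw, hk⟩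
  | goto p => exact ⟨rfl, hn, fun v v' hv' => ⟨⟨(hv v v' ⟨v, hv'⟩).1, v, hv'⟩, fun h => h.elim⟩⟩
  | seqL b p p₂ =>
    refine ⟨rfl, Set.subset_union_left.trans hn, fun v v' hv' => ⟨⟨?_, ?_⟩, ?_⟩⟩
    · refine (p₂.need_mono ?_).trans (Set.subset_union_right.trans hn)
      rintro _ rfl
      exact ⟨v, trivial, hv'⟩
    · exact fun w hw => (hv v w ⟨v', hv', hw⟩).1
    · rintro ⟨w, hw, hK⟩
      exact (hv v w ⟨v', hv', hw⟩).2 hK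
  | unionL b p p₂ =>
    exact ⟨rfl, Set.subset_union_left.trans hn, fun v v' hv' => hv v v' (.inl hv')⟩

/-- The rules for answers are sound: the contexts are chosen such that an answer of a child is an
answer of its parent, or licensed for a request to its sibling (or to itself, below an iteration). -/
theorem ruleOK_ansRules (hs : Setting inp D Q rp T W) :
    ∀ r ∈ ansRules, RuleOK D Q T W inp rp r := by
  simp only [ansRules, List.forall_mem_cons, List.not_mem_nil, false_imp_iff, implies_true, and_true]
  refine ⟨?_, ?_, ?_, ?_, ?_, ?_, ?_⟩
  · refine ruleOK_once hs rfl fun q v p c ho ht hg _ =>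
      actOK_of hs rfl rfl ho ho hg.le hg.le ?_
    obtain ⟨v, rfl, hw, -, h⟩ := hg
    rintro ⟨w, hvw, -, hK⟩
    obtain rfl := D.nodeId.injective (Fin.ext hvw)
    exact ⟨v, rfl, hw, h ht hK⟩
  · refine ruleOK_up hs (by simp) (fun x q v p c p₁ c₁ d hx ho hg hk ht hd hp hl hr => ?_) rfl
    subst hx
    refine actOK_of hs rfl rfl ho ho hg.le hg.le ?_
    rintro ⟨v, rfl, hw, -⟩
    cases hk <;> simp [tag, ite_eq_iff] at ht
    exact ⟨v, rfl, hw, trivial⟩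
  · refine ruleOK_up hs (by simp) (fun x q v p c p₁ c₁ d hx ho hg hk ht hd hp hl hr => ?_) rfl
    subst hx
    cases hk <;> simp [tag, ite_eq_iff] at ht hd
    refine actOK_of hs rfl rfl ho (hr _ _ (.seqR ..)) hg.le hg.le ?_
    rintro ⟨v, rfl, hw, h, -⟩
    exact ⟨v, rfl, hw, h.1, fun v' hv' => ⟨h.2 v' hv', fun hK => ⟨v', hv', hK⟩⟩⟩
  · refine ruleOK_up hs (by simp) (fun x q v p c p₁ c₁ d hx ho hg hk ht hd hp hl hr => ?_) rfl
    subst hx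
    refine actOK_of hs rfl rfl ho hp hg.le hg.le ?_
    rintro ⟨v, rfl, hw, h, -⟩
    refine ⟨v, rfl, hw, ?_, fun ht' => by simp at ht ht'; omega⟩
    cases hk <;> simp [tag, ite_eq_iff] at ht hd
    exact h
  · refine ruleOK_up hs (by simp) (fun x q v p c p₁ c₁ d hx ho hg hk ht hd hp hl hr => ?_) rfl
    subst hx
    refine actOK_of hs rfl rfl ho hp hg.le hg.le ?_
    rintro ⟨v, rfl, hw, h, -⟩
    refine ⟨v, rfl, hw, ?_, fun ht' => by simp at ht ht'; omega⟩
    cases hk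
    case ex | seqL | seqR => simp [tag, ite_eq_iff] at ht
    case test | unionL | unionR => exact h
    case plus | goto => exact h.1
  · refine ruleOK_up hs (by simp) (fun x q v p c p₁ c₁ d hx ho hg hk ht hd hp hl hr => ?_) rfl
    subst hx
    refine actOK_of hs rfl rfl ho ho hg.le hg.le ?_
    rintro ⟨v, rfl, hw, h, -⟩
    cases hk <;> simp [tag, ite_eq_iff] at ht
    exact good_req_plus hw h.2
  · refine ruleOK_up hs (by simp) (fun x q v p c p₁ c₁ d hx ho hg hk ht hd hp hl hr => ?_) rfl
    subst hx
    refine actOK_of hs rfl rfl hp hp hg.le (Nat.zero_le _) ?_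
    cases hk <;> simp [tag, ite_eq_iff] at ht
    rintro ⟨v', rfl, -, hK⟩
    obtain ⟨w, hvw, hw, h, -⟩ := hg
    obtain rfl := D.nodeId.injective (Fin.ext hvw)
    exact ⟨rfl, fun u => ⟨v', h.2, hK⟩⟩

end RAM

namespace RAM

open Query

variable {L : Type*} {V : Type*} {G : LabeledGraph L V} {S : Set V} {D : Presentation G S}
  {Q : Query L} {T : Set (GFact L V)} {W : Set V} {inp : Input} {rp : ℕ → ℕ}

theorem ruleOK_endGoodRules (hs : Setting inp D Q rp T W) :
    ∀ r ∈ endGoodRules, RuleOK D Q T W inp rp r := by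
  simp only [endGoodRules, List.forall_mem_cons, List.not_mem_nil, false_imp_iff, implies_true,
    and_true]
  refine ⟨?_, ?_, ?_⟩
  · refine ruleOK_once hs rfl fun q v p c ho ht hg _ => ?_
    obtain ⟨p', c', hk⟩ := exists_right c (p := p) (by simp at ht ⊢; omega)
    refine actOK_of hs rfl rfl ho (occ_right hs ho hk) hg.le hg.le ?_
    rintro ⟨v, rfl, hw, hK⟩
    cases hk <;> simp [tag, ite_eq_iff] at ht
    exact ⟨v, rfl, hw, hK⟩
  · refine ruleOK_once hs rfl fun q v p c ho ht hg _ => ?_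
    obtain ⟨p', c', hk⟩ := exists_left c (p := p) (by simp at ht ⊢; omega)
    refine actOK_of hs rfl rfl ho (occ_left hs ho hk) hg.le hg.le ?_
    rintro ⟨v, rfl, hw, hK⟩
    refine ⟨v, rfl, hw, ?_⟩
    cases hk <;> simp [tag, ite_eq_iff] at ht
    · exact hK
    · exact .inl hK
    · exact hK
  · refine ruleOK_once hs rfl fun q v p c ho ht hg _ => ?_
    obtain ⟨p', c', hk⟩ := exists_right c (p := p) (by simp at ht ⊢; omega)
    refine actOK_of hs rfl rfl ho (occ_right hs ho hk) hg.le hg.le ?_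
    rintro ⟨v, rfl, hw, hK⟩
    cases hk <;> simp [tag, ite_eq_iff] at ht
    exact ⟨v, rfl, hw, hK⟩

theorem ruleOK_startGoodRules (hs : Setting inp D Q rp T W) :
    ∀ r ∈ startGoodRules, RuleOK D Q T W inp rp r := by
  simp only [startGoodRules, List.forall_mem_cons, List.not_mem_nil, false_imp_iff, implies_true,
    and_true]
  refine ⟨?_, ?_, ?_, ?_, ?_, ?_, ?_⟩
  all_goals
    refine ruleOK_up hs (by simp) (fun x q v p c p₁ c₁ d hx ho hg hk ht hd hp hl hr => ?_) rfl
    subst hx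
    cases hk <;> simp [tag, ite_eq_iff] at ht hd
  · refine actOK_of hs rfl rfl ho hp hg.le hg.le ?_
    rintro ⟨v, rfl, hw, h⟩
    exact ⟨v, rfl, hw, h.1, fun _ => h.2⟩
  · exact actOK_of hs rfl rfl ho hp hg.le hg.le id
  · exact actOK_of hs rfl rfl ho (hl _ _ (.seqL ..)) hg.le hg.le id
  · exact actOK_of hs rfl rfl ho hp hg.le hg.le id
  · exact actOK_of hs rfl rfl ho hp hg.le hg.le id
  · exact actOK_of hs rfl rfl ho hp hg.le hg.le id
  · refine actOK_of hs rfl rfl ho ho hg.le hg.le ?_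
    rintro ⟨v, rfl, hw, h⟩
    exact ⟨v, rfl, hw, .inr h⟩
  · refine actOK_of hs rfl rfl hp hp hg.le hg.le ?_
    obtain ⟨v, rfl, hw, w, h, hK⟩ := hg
    rintro ⟨v', hvv, -, -, h'⟩
    obtain rfl := D.nodeId.injective (Fin.ext hvv)
    exact ⟨v, rfl, hw, (h' w h).2 hK⟩
  · refine actOK_of hs rfl rfl hp hp (Nat.zero_le _) hg.le ?_
    obtain ⟨v, rfl, hw, w, h, hK⟩ := hg
    rintro ⟨-, -, h'⟩
    exact ⟨v, rfl, hw, (h' v w h).2 hK⟩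

/-- The length of a list that is embedded in a finite set of facts. -/
theorem length_le_ncard {α : Type*} {l : List α} (hl : l.Nodup) {X : Set (GFact L V)}
    (hX : X.Finite) (f : α → GFact L V) (hf : Function.Injective f) (h : ∀ a ∈ l, f a ∈ X) :
    l.length ≤ X.ncard := by
  classical
  rw [← List.toFinset_card_of_nodup hl, ← Finset.card_image_of_injective _ hf,
    ← Set.ncard_coe_finset]
  refine Set.ncard_le_ncard ?_ hX
  intro y hy
  simp only [Finset.coe_image, List.coe_toFinset, Set.mem_image, Set.mem_ofPred_eq] at hy
  obtain ⟨a, ha, rfl⟩ := hy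
  exact h a ha

theorem ncard_le_localSize : T.ncard ≤ localSize D T 0 := by
  unfold localSize
  rw [if_pos rfl]
  omega

/-- Enumerating all nodes is affordable if all node facts are needed. -/
theorem nodeCount_le (hT : T.Finite) (h : Set.range GFact.node ⊆ T) :
    D.nodeCount ≤ T.ncard := by
  have := length_le_ncard (List.nodup_finRange D.nodeCount) hT (fun i => .node (D.nodeId.symm i))
    (fun i j hij => D.nodeId.symm.injective (GFact.node.inj hij)) (fun i _ => h ⟨_, rfl⟩)
  simpa using this

theorem exists_nodes (hs : Setting inp D Q rp T W) {x : Item} {j : ℕ}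
    (hj : j < nodesLoop.length inp (env inp rp x)) :
    ∃ v, nodesLoop.val inp (env inp rp x) j - 1 = D.nodeId v := by
  have h := enum_nodes hs x
  have hj' : j < (List.range D.nodeCount).reverse.length := by rwa [h.length] at hj
  rw [h.val hj]
  have : (List.range D.nodeCount).reverse[j] ∈ (List.range D.nodeCount).reverse :=
    List.getElem_mem _
  rw [List.mem_reverse, List.mem_range] at this
  exact ⟨D.nodeId.symm ⟨_, this⟩, by simp⟩

theorem item_eq {y : Item} {k : Kind} {q v : ℕ} (hk : y.k = k) (hq : y.q = q) (hv : y.v = v) :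
    y = ⟨k, q, v⟩ := Item.ext hk hq hv

/-- Rules that enumerate a list of the input. -/
theorem ruleOK_own (hs : Setting inp D Q rp T W) {k : Kind} {tags : List ℕ} {l : Loop}
    {pk : Kind} {pp pn : Var} {ck : Kind} {cp cn : Var}
    (H : ∀ q v p c, Occ G T Q (rootCtx G S Q) q p c → p.tag ∈ tags → Good D T W p c v k →
      l.Ends inp (env inp rp ⟨k, q, v⟩) ∧
      l.length inp (env inp rp ⟨k, q, v⟩) ≤ localSize D T v ∧
      ∀ j < l.length inp (env inp rp ⟨k, q, v⟩), ActOK D Q T W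
        ((Rule.own k tags l pk pp pn ck cp cn).inst inp (env inp rp ⟨k, q, v⟩) j)) :
    RuleOK D Q T W inp rp (.own k tags l pk pp pn ck cp cn) := by
  rintro ⟨k', q, v⟩ ⟨p, c, ho, hg⟩ ⟨h1, h2, -⟩
  obtain rfl : k' = k := Kind.code_injective h1
  have := H q v p c ho (by rw [← ho.tag_eq hs.desc]; exact h2) hg
  exact ⟨this.1, this.2.1.trans (Nat.le_add_left _ _), this.2.2⟩

/-- If every node starts a path of `P` and `[P]` is evaluated without start set, then all node facts
are needed. -/
theorem ruleOK_everyRules (hs : Setting inp D Q rp T W) (hT : T.Finite) :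
    ∀ r ∈ everyRules, RuleOK D Q T W inp rp r := by
  simp only [everyRules, List.forall_mem_cons, List.not_mem_nil, false_imp_iff, implies_true,
    and_true]
  refine ⟨?_, ?_, ?_, ?_⟩
  on_goal 4 =>
    refine ruleOK_own hs fun q v p c ho ht hg => ?_
    obtain ⟨rfl, ht, hn, hv⟩ := hg
    refine ⟨(enum_nodes hs _).ends, ?_, fun j hj => ?_⟩
    · rw [(enum_nodes hs _).length, List.length_reverse, List.length_range]
      exact (nodeCount_le hT hn).trans ncard_le_localSize
    · obtain ⟨v, e⟩ := exists_nodes hs hj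
      refine actOK_of hs rfl (item_eq rfl rfl e) ho ho (Nat.zero_le _) (nodeId_le v) fun _ => ?_
      exact ⟨v, rfl, hs.node v (hn ⟨v, rfl⟩), (hv v).1, fun _ => (hv v).2⟩
  all_goals
    refine ruleOK_up hs (by simp) (fun x q v p c p₁ c₁ d hx ho hg hk ht hd hp hl hr => ?_) rfl
    subst hx
    cases hk <;> simp [tag, ite_eq_iff] at ht hd
  · refine actOK_of hs rfl rfl hp hp (Nat.zero_le _) (Nat.zero_le _) ?_
    rintro ⟨-, hn, h⟩
    have hv : ∀ v, ∃ v', p.sem G v v' := fun v => (hg.2 v).imp fun w hw => hw.1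
    refine ⟨rfl, rfl, ?_, fun v => h v v ⟨rfl, hv v⟩⟩
    rintro _ ⟨v, rfl⟩
    exact hn (.inl ⟨v, hv v, rfl⟩)
  · refine actOK_of hs rfl rfl ho hp hg.le (Nat.zero_le _) fun _ => ⟨rfl, fun v => ?_⟩
    obtain ⟨v', hv', w, hw, hK⟩ := hg.2 v
    exact ⟨w, ⟨v', hv', hw⟩, hK⟩
  · exact actOK_of hs rfl rfl ho hp hg.le (Nat.zero_le _) fun _ => ⟨rfl, hg.2⟩
  · refine actOK_of hs rfl rfl ho hp hg.le (Nat.zero_le _) fun _ => ⟨rfl, fun v => ?_⟩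
    obtain ⟨v', hv', hK | ⟨w, hw, hK⟩⟩ := hg.2 v
    · exact ⟨v', .single hv', hK⟩
    · exact ⟨w, .head hv' hw, hK⟩
  · refine actOK_of hs rfl rfl ho hp hg.le (Nat.zero_le _) fun _ => ⟨rfl, fun v => ?_⟩
    obtain ⟨v', hv', hK⟩ := hg.2 v
    exact ⟨v', .inl hv', hK⟩
  · refine actOK_of hs rfl rfl ho hp hg.le (Nat.zero_le _) fun _ => ⟨rfl, fun v => ?_⟩
    obtain ⟨v', hv', hK⟩ := hg.2 v
    exact ⟨v', .inr hv', hK⟩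

/-- The start set is enumerated only on behalf of subqueries for which all start nodes are needed
facts. -/
theorem ruleOK_spineRules (hs : Setting inp D Q rp T W) (hT : T.Finite) :
    ∀ r ∈ spineRules, RuleOK D Q T W inp rp r := by
  simp only [spineRules, List.forall_mem_cons, List.not_mem_nil, false_imp_iff, implies_true,
    and_true]
  refine ⟨?_, ?_, ?_, ?_⟩
  · refine ruleOK_once hs rfl fun q v p c ho ht hg _ => ?_
    obtain ⟨p', c', hk⟩ := exists_left c (p := p) (by simp at ht ⊢; omega)
    refine actOK_of hs rfl rfl ho (occ_left hs ho hk) hg.le (Nat.zero_le _) ?_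
    rintro ⟨-, h⟩
    refine ⟨rfl, ?_⟩
    cases hk <;> simp [tag, ite_eq_iff] at ht
    · exact h
    · exact (p'.need_mono Set.subset_union_left).trans h
    · exact Set.subset_union_left.trans h
    · exact Set.subset_union_left.trans h
  · refine ruleOK_once hs rfl fun q v p c ho ht hg _ => ?_
    obtain ⟨p', c', hk⟩ := exists_right c (p := p) (by simp at ht ⊢; omega)
    refine actOK_of hs rfl rfl ho (occ_right hs ho hk) hg.le (Nat.zero_le _) ?_
    rintro ⟨-, h⟩
    refine ⟨rfl, ?_⟩
    cases hk <;> simp [tag, ite_eq_iff] at ht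
    exact Set.subset_union_right.trans h
  · refine ruleOK_own hs fun q v p c ho ht hg => ?_
    obtain ⟨rfl, h⟩ := hg
    have hS : ∀ v ∈ S, GFact.node v ∈ T := by
      intro v hv
      cases p <;> simp [tag, ite_eq_iff] at ht
      case node => exact h ⟨v, hv, rfl⟩
      all_goals exact h (.inl ⟨v, hv, rfl⟩)
    refine ⟨(enum_start hs _).ends, ?_, fun j hj => ?_⟩
    · rw [(enum_start hs _).length, List.length_map]
      exact (length_le_ncard D.start_nodup hT GFact.node (fun _ _ h => GFact.node.inj h)
        fun v hv => hS v ((D.mem_start v).1 hv)).trans ncard_le_localSize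
    · obtain ⟨v, hv, e⟩ := (enum_start hs _).exists_node hj
      rw [D.mem_start] at hv
      exact actOK_of hs rfl (item_eq rfl rfl e) ho .root (Nat.zero_le _) (nodeId_le v) fun _ =>
        good_req_root hs hv (hs.node v (hS v hv))
  · refine ruleOK_once hs rfl fun q v p c ho ht hg hne => ?_
    obtain ⟨rfl, h⟩ := hg
    have hval : firstLoop.val inp (env inp rp ⟨.spine, q, 0⟩) 0 =
        entry (D.start.map fun v => (D.nodeId v : ℕ)) 0 := by
      rw [← hs.desc.start]; simp [Loop.val, firstLoop, env]
    rw [hval] at hne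
    rcases hst : D.start with - | ⟨v, l⟩
    · simp [hst, entry] at hne
    · have e : firstLoop.val inp (env inp rp ⟨.spine, q, 0⟩) 0 - 1 = D.nodeId v := by
        rw [hval, hst]; simp [entry]
      exact actOK_of hs rfl (item_eq rfl rfl e) ho .root (Nat.zero_le _) (nodeId_le v) fun _ =>
        good_req_root hs ((D.mem_start v).1 (by simp [hst])) (hs.first v (by simp [hst]))

end RAM

namespace RAM

open Query

variable {L : Type*} {V : Type*} {G : LabeledGraph L V} {S : Set V} {D : Presentation G S}
  {Q : Query L} {T : Set (GFact L V)} {W : Set V} {inp : Input} {rp : ℕ → ℕ}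

/-- Enumerating successors is affordable if the edges are needed facts. -/
theorem length_succ_le (hT : T.Finite) {a : L} {v : V}
    (h : ∀ w, (v, w) ∈ G.edge a → .edge a v w ∈ T) :
    (D.succ a v).length ≤ localSize D T (D.nodeId v) := by
  refine (length_le_ncard (D.succ_nodup a v)
    (X := {f | f ∈ T ∧ ∃ a u w, f = .edge a u w ∧ (D.nodeId v : ℕ) = D.nodeId u})
    (hT.subset (Set.sep_subset _ _)) (GFact.edge a v) (fun _ _ h => by simpa using h) fun w hw => ⟨h w ((D.mem_succ a v w).1 hw), a, v, w, rfl, rfl⟩).trans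
    ?_
  exact (Nat.le_add_right _ _).trans (Nat.le_add_right _ _)

theorem length_pred_le (hT : T.Finite) {a : L} {v : V}
    (h : ∀ w, (w, v) ∈ G.edge a → .edge a w v ∈ T) :
    (D.pred a v).length ≤ localSize D T (D.nodeId v) := by
  refine (length_le_ncard (D.pred_nodup a v)
    (X := {f | f ∈ T ∧ ∃ a u w, f = .edge a u w ∧ (D.nodeId v : ℕ) = D.nodeId w})
    (hT.subset (Set.sep_subset _ _))
    (fun w => GFact.edge a w v) (fun _ _ h => by simpa using h)
    fun w hw => ⟨h w ((D.mem_pred a v w).1 hw), a, w, v, rfl, rfl⟩).trans ?_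
  exact (Nat.le_add_left _ _).trans (Nat.le_add_right _ _)

theorem length_edges_le (hT : T.Finite) {a : L} (h : ∀ v w, (v, w) ∈ G.edge a → .edge a v w ∈ T) :
    (D.edges a).length ≤ localSize D T 0 :=
  (length_le_ncard (D.edges_nodup a) hT (fun e => GFact.edge a e.1 e.2)
    (fun _ _ h => by simpa [Prod.ext_iff] using h)
    fun _ he => h _ _ ((D.mem_edges a _).1 he)).trans ncard_le_localSize

theorem length_labeled_le (hT : T.Finite) {a : L} (h : ∀ v ∈ G.nodeLab a, .lab a v ∈ T) :
    (D.labeled a).length ≤ localSize D T 0 :=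
  (length_le_ncard (D.labeled_nodup a) hT (GFact.lab a) (fun _ _ h => by simpa using h)
    fun _ hv => h _ ((D.mem_labeled a _).1 hv)).trans ncard_le_localSize

theorem eq_edge_of_tag {p : Query L} (h : p.tag ∈ [8]) : ∃ a, p = .edge a := by
  cases p <;> simp [tag, ite_eq_iff] at h ⊢

theorem eq_inv_of_tag {p : Query L} (h : p.tag ∈ [9]) : ∃ a, p = .inv a := by
  cases p <;> simp [tag, ite_eq_iff] at h ⊢

theorem eq_lab_of_tag {p : Query L} (h : p.tag ∈ [3]) : ∃ a, p = .lab a := by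
  cases p <;> simp [tag, ite_eq_iff] at h ⊢

theorem eq_node_of_tag {p : Query L} (h : p.tag ∈ [2]) : p = .node := by
  cases p <;> simp [tag, ite_eq_iff] at h ⊢

/-- A request to `edge_a` at `v` is licensed, so that the edges at `v` are needed facts. -/
theorem ruleOK_reqRules (hs : Setting inp D Q rp T W) (hT : T.Finite) :
    ∀ r ∈ reqRules, RuleOK D Q T W inp rp r := by
  simp only [reqRules, List.forall_mem_cons, List.not_mem_nil, false_imp_iff, implies_true,
    and_true]
  refine ⟨?_, ?_, ?_, ?_, ?_, ?_, ?_, ?_, ?_, ?_⟩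
  · refine ruleOK_once hs rfl fun q v p c ho ht hg _ => ?_
    obtain ⟨p', c', hk⟩ := exists_left c (p := p) (by simp at ht ⊢; omega)
    exact actOK_of hs rfl rfl ho (occ_left hs ho hk) hg.le hg.le
      (good_req_left (by simp at ht; omega) hk)
  · refine ruleOK_once hs rfl fun q v p c ho ht hg _ => ?_
    obtain ⟨p', c', hk⟩ := exists_right c (p := p) (by simp at ht ⊢; omega)
    refine actOK_of hs rfl rfl ho (occ_right hs ho hk) hg.le hg.le ?_
    rintro ⟨v, rfl, hw, hn, hv⟩
    cases hk <;> simp [tag, ite_eq_iff] at ht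
    exact ⟨v, rfl, hw, Set.subset_union_right.trans hn, fun v' hv' => hv v' (.inr hv')⟩
  · refine ruleOK_once hs rfl fun q v p c ho ht hg _ => actOK_of hs rfl rfl ho ho hg.le hg.le ?_
    rintro ⟨v, rfl, hw, hn, hv⟩
    obtain rfl := eq_node_of_tag ht
    exact ⟨v, rfl, hw, (hv v rfl).1, fun _ => (hv v rfl).2⟩
  · refine ruleOK_once hs rfl fun q v p c ho ht hg hne => actOK_of hs rfl rfl ho ho hg.le hg.le ?_
    rintro ⟨v, rfl, hw, hn, hv⟩
    obtain ⟨a, rfl⟩ := eq_lab_of_tag ht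
    have hv := hv v ⟨rfl, ?_⟩
    · exact ⟨v, rfl, hw, hv.1, fun _ => hv.2⟩
    · rw [← hs.desc.hasLab, ← left_of_label hs ho (.inl rfl)]
      simpa [Loop.val, hasLabLoop, env] using hne
  · refine ruleOK_own hs fun q v p c ho ht hg => ?_
    obtain ⟨v, rfl, hw, hn, hv⟩ := id hg
    obtain ⟨a, rfl⟩ := eq_edge_of_tag ht
    have hl := enum_succ (x := ⟨.req, q, D.nodeId v⟩) hs (left_of_label hs ho (.inr (.inl rfl))) rfl
    have hn : ∀ w, (v, w) ∈ G.edge a → .edge a v w ∈ T := fun w h =>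
      hn (.inr ⟨v, w, rfl, h, .inl rfl⟩)
    refine ⟨hl.ends, ?_, fun j hj => ?_⟩
    · rw [hl.length, List.length_map]
      exact length_succ_le hT hn
    · obtain ⟨w, hvw, e⟩ := hl.exists_node hj
      rw [D.mem_succ] at hvw
      refine actOK_of hs rfl (item_eq rfl rfl e) ho ho hg.le (nodeId_le w) fun _ => ?_
      exact ⟨w, rfl, (hs.edge _ _ _ (hn w hvw)).2, (hv w hvw).1, fun h => by simp [tag] at h⟩
  · refine ruleOK_own hs fun q v p c ho ht hg => ?_
    obtain ⟨v, rfl, hw, hn, hv⟩ := id hg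
    obtain ⟨a, rfl⟩ := eq_edge_of_tag ht
    have hl := enum_succ (x := ⟨.req, q, D.nodeId v⟩) hs (left_of_label hs ho (.inr (.inl rfl))) rfl
    have hn : ∀ w, (v, w) ∈ G.edge a → .edge a v w ∈ T := fun w h =>
      hn (.inr ⟨v, w, rfl, h, .inl rfl⟩)
    refine ⟨hl.ends, ?_, fun j hj => ?_⟩
    · rw [hl.length, List.length_map]
      exact length_succ_le hT hn
    · obtain ⟨w, hvw, e⟩ := hl.exists_node hj
      rw [D.mem_succ] at hvw
      refine actOK_of hs (item_eq rfl rfl e) rfl ho ho (nodeId_le w) hg.le ?_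
      rintro ⟨u, hu, -, hK⟩
      obtain rfl := D.nodeId.injective (Fin.ext hu)
      exact ⟨v, rfl, hw, (hv w hvw).2 hK⟩
  · refine ruleOK_own hs fun q v p c ho ht hg => ?_
    obtain ⟨v, rfl, hw, hn, hv⟩ := id hg
    obtain ⟨a, rfl⟩ := eq_inv_of_tag ht
    have hl := enum_pred (x := ⟨.req, q, D.nodeId v⟩) hs (left_of_label hs ho (.inr (.inr rfl))) rfl
    have hn : ∀ w, (w, v) ∈ G.edge a → .edge a w v ∈ T := fun w h =>
      hn (.inr ⟨w, v, rfl, h, .inl rfl⟩)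
    refine ⟨hl.ends, ?_, fun j hj => ?_⟩
    · rw [hl.length, List.length_map]
      exact length_pred_le hT hn
    · obtain ⟨w, hvw, e⟩ := hl.exists_node hj
      rw [D.mem_pred] at hvw
      refine actOK_of hs rfl (item_eq rfl rfl e) ho ho hg.le (nodeId_le w) fun _ => ?_
      exact ⟨w, rfl, (hs.edge _ _ _ (hn w hvw)).1, (hv w hvw).1, fun h => by simp [tag] at h⟩
  · refine ruleOK_own hs fun q v p c ho ht hg => ?_
    obtain ⟨v, rfl, hw, hn, hv⟩ := id hg
    obtain ⟨a, rfl⟩ := eq_inv_of_tag ht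
    have hl := enum_pred (x := ⟨.req, q, D.nodeId v⟩) hs (left_of_label hs ho (.inr (.inr rfl))) rfl
    have hn : ∀ w, (w, v) ∈ G.edge a → .edge a w v ∈ T := fun w h =>
      hn (.inr ⟨w, v, rfl, h, .inl rfl⟩)
    refine ⟨hl.ends, ?_, fun j hj => ?_⟩
    · rw [hl.length, List.length_map]
      exact length_pred_le hT hn
    · obtain ⟨w, hvw, e⟩ := hl.exists_node hj
      rw [D.mem_pred] at hvw
      refine actOK_of hs (item_eq rfl rfl e) rfl ho ho (nodeId_le w) hg.le ?_
      rintro ⟨u, hu, -, hK⟩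
      obtain rfl := D.nodeId.injective (Fin.ext hu)
      exact ⟨v, rfl, hw, (hv w hvw).2 hK⟩
  · refine ruleOK_once hs rfl fun q v p c ho ht hg _ => ?_
    obtain ⟨p', c', hk⟩ := exists_left c (p := p) (by simp at ht ⊢; omega)
    refine actOK_of hs rfl rfl ho (occ_left hs ho hk) hg.le (Nat.zero_le _) ?_
    rintro ⟨v, rfl, hw, hn, hv⟩
    cases hk <;> simp [tag, ite_eq_iff] at ht
    exact ⟨rfl, hn, fun u v' hv' => ⟨⟨(hv v' ⟨u, hv'⟩).1, u, hv'⟩, fun h => h.elim⟩⟩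
  · refine ruleOK_once hs rfl fun q v p c ho ht hg _ =>
      actOK_of hs rfl rfl ho ho (Nat.zero_le _) hg.le ?_
    obtain ⟨v, rfl, hw, hn, hv⟩ := hg
    rintro ⟨-, h⟩
    obtain ⟨w, hvw, hK⟩ := h v
    exact ⟨v, rfl, hw, (hv w hvw).2 hK⟩

theorem ruleOK_allRules (hs : Setting inp D Q rp T W) (hT : T.Finite) :
    ∀ r ∈ allRules, RuleOK D Q T W inp rp r := by
  simp only [allRules, List.forall_mem_cons, List.not_mem_nil, false_imp_iff, implies_true,
    and_true]
  refine ⟨?_, ?_, ?_, ?_, ?_, ?_, ?_, ?_⟩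
  · refine ruleOK_once hs rfl fun q v p c ho ht hg _ => ?_
    obtain ⟨p', c', hk⟩ := exists_left c (p := p) ht
    exact actOK_of hs rfl rfl ho (occ_left hs ho hk) hg.le (Nat.zero_le _) (good_all_left hk)
  · refine ruleOK_once hs rfl fun q v p c ho ht hg _ => ?_
    obtain ⟨p', c', hk⟩ := exists_right c (p := p) (by simp at ht ⊢; omega)
    refine actOK_of hs rfl rfl ho (occ_right hs ho hk) hg.le (Nat.zero_le _) ?_
    rintro ⟨rfl, hn, hv⟩
    cases hk <;> simp [tag, ite_eq_iff] at ht
    exact ⟨rfl, Set.subset_union_right.trans hn, fun v v' hv' => hv v v' (.inr hv')⟩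
  · refine ruleOK_own hs fun q v p c ho ht hg => ?_
    obtain ⟨rfl, hn, hv⟩ := hg
    obtain rfl := eq_node_of_tag ht
    refine ⟨(enum_nodes hs _).ends, ?_, fun j hj => ?_⟩
    · rw [(enum_nodes hs _).length, List.length_reverse, List.length_range]
      exact (nodeCount_le hT hn).trans ncard_le_localSize
    · obtain ⟨v, e⟩ := exists_nodes hs hj
      refine actOK_of hs rfl (item_eq rfl rfl e) ho ho (Nat.zero_le _) (nodeId_le v) fun _ => ?_
      exact ⟨v, rfl, hs.node v (hn ⟨v, rfl⟩), (hv v v rfl).1, fun _ => (hv v v rfl).2⟩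
  · refine ruleOK_own hs fun q v p c ho ht hg => ?_
    obtain ⟨rfl, hn, hv⟩ := hg
    obtain ⟨a, rfl⟩ := eq_lab_of_tag ht
    have hl := enum_labeled (x := ⟨.all, q, 0⟩) hs (left_of_label hs ho (.inl rfl))
    refine ⟨hl.ends, ?_, fun j hj => ?_⟩
    · rw [hl.length, List.length_map]
      exact length_labeled_le hT fun v hv => hn ⟨v, hv, rfl⟩
    · obtain ⟨v, hva, e⟩ := hl.exists_node hj
      rw [D.mem_labeled] at hva
      refine actOK_of hs rfl (item_eq rfl rfl e) ho ho (Nat.zero_le _) (nodeId_le v) fun _ => ?_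
      exact ⟨v, rfl, hs.lab a v (hn ⟨v, hva, rfl⟩), (hv v v ⟨rfl, hva⟩).1,
        fun _ => (hv v v ⟨rfl, hva⟩).2⟩
  all_goals
    refine ruleOK_own hs fun q v p c ho ht hg => ?_
    obtain ⟨rfl, hn, hv⟩ := hg
  on_goal 1 => obtain ⟨a, rfl⟩ := eq_edge_of_tag ht
  on_goal 2 => obtain ⟨a, rfl⟩ := eq_edge_of_tag ht
  on_goal 3 => obtain ⟨a, rfl⟩ := eq_inv_of_tag ht
  on_goal 4 => obtain ⟨a, rfl⟩ := eq_inv_of_tag ht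
  all_goals
    have hleft := left_of_label hs ho (a := a) (by simp)
    have hl := enum_edges (x := ⟨.all, q, 0⟩) hs hleft
    have hn : ∀ v w, (v, w) ∈ G.edge a → .edge a v w ∈ T := fun v w h => hn ⟨v, w, h, rfl⟩
    refine ⟨hl.ends, ?_, fun j hj => ?_⟩
    · rw [hl.length, List.length_map]
      exact length_edges_le hT hn
    obtain ⟨v, w, he, e, e'⟩ := exists_edge (x := ⟨.all, q, 0⟩) hs hleft hj
    have hw := hs.edge _ _ _ (hn v w he)
  · refine actOK_of hs rfl (item_eq rfl rfl e') ho ho (Nat.zero_le _) (nodeId_le w) fun _ => ?_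
    exact ⟨w, rfl, hw.2, (hv v w he).1, fun h => by simp [tag] at h⟩
  · refine actOK_of hs (item_eq rfl rfl e') (item_eq rfl rfl e) ho ho (nodeId_le w) (nodeId_le v) ?_
    rintro ⟨u, hu, -, hK⟩
    obtain rfl := D.nodeId.injective (Fin.ext hu)
    exact ⟨v, rfl, hw.1, (hv v w he).2 hK⟩
  · refine actOK_of hs rfl (item_eq rfl rfl e) ho ho (Nat.zero_le _) (nodeId_le v) fun _ => ?_
    exact ⟨v, rfl, hw.1, (hv w v he).1, fun h => by simp [tag] at h⟩
  · refine actOK_of hs (item_eq rfl rfl e) (item_eq rfl rfl e') ho ho (nodeId_le v) (nodeId_le w) ?_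
    rintro ⟨u, hu, -, hK⟩
    obtain rfl := D.nodeId.injective (Fin.ext hu)
    exact ⟨w, rfl, hw.2, (hv w v he).2 hK⟩

/-- Soundness of the inference rules. -/
theorem ruleOK_queryRules (hs : Setting inp D Q rp T W) (hT : T.Finite) :
    ∀ r ∈ queryRules, RuleOK D Q T W inp rp r := by
  intro r hr
  simp only [queryRules, List.mem_append] at hr
  rcases hr with hr | hr | hr | hr | hr | hr | hr
  · exact ruleOK_spineRules hs hT r hr
  · exact ruleOK_reqRules hs hT r hr
  · exact ruleOK_allRules hs hT r hr
  · exact ruleOK_ansRules hs r hr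
  · exact ruleOK_endGoodRules hs r hr
  · exact ruleOK_startGoodRules hs r hr
  · exact ruleOK_everyRules hs hT r hr

end RAM

namespace RAM

open Query

variable {L : Type*} {V : Type*} {G : LabeledGraph L V} {S : Set V} {D : Presentation G S}
  {Q : Query L} {T : Set (GFact L V)} {W : Set V} {inp : Input} {rp : ℕ → ℕ}

/-! ### Completeness of the rules -/

/-- The set `M` of items is closed under the rules. -/
def Closed (inp : Input) (rp : ℕ → ℕ) (M : Set Item) : Prop :=
  ∀ x ∈ M, ∀ r ∈ queryRules, r.Fires (env inp rp x) → ∀ j < r.loop.length inp (env inp rp x),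
    (r.inst inp (env inp rp x) j).1 ∈ M → (r.inst inp (env inp rp x) j).2 ∈ M

variable {M : Set Item}

/-- Using a rule that depends on the tag of the position, at the element `j` of its enumeration. -/
theorem Closed.own (hM : Closed inp rp M) (hs : Setting inp D Q rp T W) {k : Kind}
    {tags : List ℕ} {l : Loop} {pk : Kind} {pp pn : Var} {ck : Kind} {cp cn : Var}
    (hr : Rule.own k tags l pk pp pn ck cp cn ∈ queryRules) {q v : ℕ} {p : Query L} {c : Ctx V}
    (ho : Occ G T Q (rootCtx G S Q) q p c) (ht : p.tag ∈ tags) (hx : ⟨k, q, v⟩ ∈ M) {j : ℕ}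
    (hj : j < l.length inp (env inp rp ⟨k, q, v⟩)) :
    ((Rule.own k tags l pk pp pn ck cp cn).inst inp (env inp rp ⟨k, q, v⟩) j).1 ∈ M →
    ((Rule.own k tags l pk pp pn ck cp cn).inst inp (env inp rp ⟨k, q, v⟩) j).2 ∈ M := by
  refine hM _ hx _ hr ⟨rfl, ?_, ?_⟩ j hj
  · show inp .tag q 0 0 ∈ tags
    rw [ho.tag_eq hs.desc]; exact ht
  · show (if rp q = 0 then 0 else 1) ∈ [0, 1]
    split_ifs <;> simp

theorem length_of_val_ne_zero {e : Var → ℕ} {l : Loop} (hl : l.once = true)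
    (h : l.val inp e 0 ≠ 0) : 0 < l.length inp e := by
  unfold Loop.length
  rw [if_pos hl, if_neg h]
  exact Nat.one_pos

theorem length_oneLoop (hs : Setting inp D Q rp T W) {x : Item} (hx : x.q < Q.size) :
    0 < oneLoop.length inp (env inp rp x) :=
  length_of_val_ne_zero rfl (by simpa [Loop.val, oneLoop, env] using (describes_tag hs.desc _).2 hx)

/-- Using a rule that depends on the tag of the position and does not enumerate. -/
theorem Closed.one (hM : Closed inp rp M) (hs : Setting inp D Q rp T W) {k : Kind}
    {tags : List ℕ} {pk : Kind} {pp pn : Var} {ck : Kind} {cp cn : Var}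
    (hr : Rule.own k tags oneLoop pk pp pn ck cp cn ∈ queryRules) {q v : ℕ} {p : Query L}
    {c : Ctx V} (ho : Occ G T Q (rootCtx G S Q) q p c) (ht : p.tag ∈ tags) (hx : ⟨k, q, v⟩ ∈ M) :
    ((Rule.own k tags oneLoop pk pp pn ck cp cn).inst inp (env inp rp ⟨k, q, v⟩) 0).1 ∈ M →
    ((Rule.own k tags oneLoop pk pp pn ck cp cn).inst inp (env inp rp ⟨k, q, v⟩) 0).2 ∈ M :=
  hM.own hs hr ho ht hx (length_oneLoop hs ho.lt)

/-- The position of a child. -/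
def childPos (inp : Input) (q : ℕ) (d : Bool) : ℕ :=
  match d with
  | true => inp .right q 0 0
  | false => inp .left q 0 0

/-- The variables that are used by rules that depend on the parent, when the item belongs to the child
on the side `d` of `q`. -/
def upEnv (inp : Input) (q : ℕ) (d : Bool) (v : ℕ) : Var → ℕ
  | .pos => childPos inp q d
  | .node => v
  | .par => q
  | .pleft => inp .left q 0 0
  | .pright => inp .right q 0 0
  | _ => 0

theorem childPos_eq (hs : Setting inp D Q rp T W) {q : ℕ} {p p' : Query L} {c c' : Ctx V} {d : Bool}
    (ho : Occ G T Q (rootCtx G S Q) q p c) (hk : IsKid G T p c d p' c') :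
    childPos inp q d = p.kidPos q d := by
  cases d
  · rw [hk.kidPos_eq]; exact ho.left_eq hs.desc hk
  · exact ho.right_eq hs.desc hk

/-- Using a rule that depends on the parent. -/
theorem Closed.up (hM : Closed inp rp M) (hs : Setting inp D Q rp T W) {k : Kind}
    {tags sides : List ℕ} {pk : Kind} {pp pn : Var} {ck : Kind} {cp cn : Var}
    (hr : Rule.up k tags sides pk pp pn ck cp cn ∈ queryRules) {q v : ℕ} {p p' : Query L}
    {c c' : Ctx V} {d : Bool} (ho : Occ G T Q (rootCtx G S Q) q p c) (hk : IsKid G T p c d p' c')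
    (ht : p.tag ∈ tags) (hd : (if d then 1 else 0) ∈ sides) (hx : ⟨k, childPos inp q d, v⟩ ∈ M)
    (hreg : [pp, pn, cp, cn] ⊆ [.pos, .node, .par, .pleft, .pright, .zero]) :
    (⟨pk, upEnv inp q d v pp, upEnv inp q d v pn⟩ : Item) ∈ M →
    (⟨ck, upEnv inp q d v cp, upEnv inp q d v cn⟩ : Item) ∈ M := by
  have hpos := childPos_eq hs ho hk
  have hpar : (if rp (childPos inp q d) = 0 then childPos inp q d - 1
      else rp (childPos inp q d) - 1) = q := by
    rw [hpos, ho.parent hs.desc hs.parent hk]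
    cases d
    · rw [hk.kidPos_eq]; simp
    · simp
  have henv : ∀ y ∈ [Var.pos, .node, .par, .pleft, .pright, .zero], ∀ j,
      (Rule.up k tags sides pk pp pn ck cp cn).loop.env inp
        (env inp rp ⟨k, childPos inp q d, v⟩) j y = upEnv inp q d v y := by
    intro y hy j
    fin_cases hy
    · rfl
    · rfl
    · exact hpar
    · show inp .left (if rp (childPos inp q d) = 0 then childPos inp q d - 1
        else rp (childPos inp q d) - 1) 0 0 = _
      rw [hpar]; rfl
    · show inp .right (if rp (childPos inp q d) = 0 then childPos inp q d - 1
        else rp (childPos inp q d) - 1) 0 0 = _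
      rw [hpar]; rfl
    · rfl
  have hfire : (Rule.up k tags sides pk pp pn ck cp cn).Fires
      (env inp rp ⟨k, childPos inp q d, v⟩) := by
    refine ⟨rfl, ?_, ?_⟩
    · show inp .tag (if rp (childPos inp q d) = 0 then childPos inp q d - 1
        else rp (childPos inp q d) - 1) 0 0 ∈ tags
      rw [hpar, ho.tag_eq hs.desc]; exact ht
    · show (if rp (childPos inp q d) = 0 then 0 else 1) ∈ sides
      rw [hpos, ho.parent hs.desc hs.parent hk]
      cases d <;> simpa using hd
  have := hM _ hx _ hr hfire 0 (length_oneLoop hs (by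
    show childPos inp q d < Q.size
    rw [hpos]; exact (ho.kid hk).lt))
  unfold Rule.inst at this
  have e : ∀ y ∈ [pp, pn, cp, cn], ∀ j, (Rule.up k tags sides pk pp pn ck cp cn).loop.env inp
      (env inp rp ⟨k, childPos inp q d, v⟩) j y = upEnv inp q d v y := fun y hy =>
    henv y (hreg hy)
  rw [← e pp (by simp) 0, ← e pn (by simp) 0, ← e cp (by simp) 0, ← e cn (by simp) 0]
  exact this

theorem Loop.Enumerates.exists_index {e : Var → ℕ} {l : Loop} {vs : List V}
    (h : l.Enumerates inp e (vs.map fun v => (D.nodeId v : ℕ))) {v : V} (hv : v ∈ vs) :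
    ∃ j, j < l.length inp e ∧ l.val inp e j - 1 = D.nodeId v := by
  obtain ⟨j, hj, rfl⟩ := List.mem_iff_getElem.1 hv
  have hj' : j < l.length inp e := by rwa [h.length, List.length_map]
  refine ⟨j, hj', ?_⟩
  rw [h.val hj']; simp

theorem exists_index_nodes (hs : Setting inp D Q rp T W) (x : Item) (v : V) :
    ∃ j, j < nodesLoop.length inp (env inp rp x) ∧
      nodesLoop.val inp (env inp rp x) j - 1 = D.nodeId v := by
  have h := enum_nodes hs x
  have hv : (D.nodeId v : ℕ) ∈ (List.range D.nodeCount).reverse := by simp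
  obtain ⟨j, hj, e⟩ := List.mem_iff_getElem.1 hv
  have hj' : j < nodesLoop.length inp (env inp rp x) := by rwa [h.length]
  exact ⟨j, hj', by rw [h.val hj', e]⟩

theorem exists_index_edges (hs : Setting inp D Q rp T W) {x : Item} {a : L}
    (hx : inp .left x.q 0 0 = D.labelId a) {v w : V} (hvw : (v, w) ∈ G.edge a) :
    ∃ j, j < edgesLoop.length inp (env inp rp x) ∧
      edgesLoop.val inp (env inp rp x) j - 1 = D.nodeId v ∧
      edgesLoop.val' inp (env inp rp x) j - 1 = D.nodeId w := by
  have h := enum_edges hs hx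
  rw [← D.mem_edges] at hvw
  obtain ⟨j, hj, e⟩ := List.mem_iff_getElem.1 hvw
  have hj' : j < edgesLoop.length inp (env inp rp x) := by rwa [h.length, List.length_map]
  refine ⟨j, hj', ?_, ?_⟩
  · rw [h.val hj']; simp [e]
  · have : edgesLoop.val' inp (env inp rp x) j =
        entry ((D.edges a).map fun e => (D.nodeId e.2 : ℕ)) j := by
      rw [← hs.desc.edgeTgt, ← hx]; simp [Loop.val', edgesLoop, env]
    rw [this, entry_of_lt (by simpa using hj)]; simp [e]

/-- The closed set `M` contains all that can be concluded about the query `p` at position `q`. -/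
structure Complete (D : Presentation G S) (M : Set Item) (q : ℕ) (p : Query L) : Prop where
  ans_of_req : ∀ {v v'}, ⟨.req, q, D.nodeId v⟩ ∈ M → p.sem G v v' → ⟨.ans, q, D.nodeId v'⟩ ∈ M
  good_of_req : ∀ {v v'}, ⟨.req, q, D.nodeId v⟩ ∈ M → p.sem G v v' →
    ⟨.endGood, q, D.nodeId v'⟩ ∈ M → ⟨.startGood, q, D.nodeId v⟩ ∈ M
  ans_of_all : ∀ {v v'}, ⟨.all, q, 0⟩ ∈ M → p.sem G v v' → ⟨.ans, q, D.nodeId v'⟩ ∈ M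
  good_of_all : ∀ {v v'}, ⟨.all, q, 0⟩ ∈ M → p.sem G v v' →
    ⟨.endGood, q, D.nodeId v'⟩ ∈ M → ⟨.startGood, q, D.nodeId v⟩ ∈ M ∨ ⟨.every, q, 0⟩ ∈ M

theorem mem_of_eq {y z : Item} (hy : y ∈ M) (hk : y.k = z.k) (hq : y.q = z.q) (hv : y.v = z.v) :
    z ∈ M := by
  rwa [← Item.ext hk hq hv]

end RAM

namespace RAM

open Query

variable {L : Type*} {V : Type*} {G : LabeledGraph L V} {S : Set V} {D : Presentation G S}
  {Q : Query L} {T : Set (GFact L V)} {W : Set V} {inp : Input} {rp : ℕ → ℕ} {M : Set Item}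

/- The members of the lists of rules are referred to by their indices; the rule itself is then found by
unification. -/

theorem spine_mem {r : Rule} (i : ℕ) (h : spineRules[i]? = some r) : r ∈ queryRules := by
  simp [queryRules, List.mem_of_getElem? h]

theorem req_mem {r : Rule} (i : ℕ) (h : reqRules[i]? = some r) : r ∈ queryRules := by
  simp [queryRules, List.mem_of_getElem? h]

theorem all_mem {r : Rule} (i : ℕ) (h : allRules[i]? = some r) : r ∈ queryRules := by
  simp [queryRules, List.mem_of_getElem? h]

theorem ans_mem {r : Rule} (i : ℕ) (h : ansRules[i]? = some r) : r ∈ queryRules := by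
  simp [queryRules, List.mem_of_getElem? h]

theorem endGood_mem {r : Rule} (i : ℕ) (h : endGoodRules[i]? = some r) : r ∈ queryRules := by
  simp [queryRules, List.mem_of_getElem? h]

theorem startGood_mem {r : Rule} (i : ℕ) (h : startGoodRules[i]? = some r) : r ∈ queryRules := by
  simp [queryRules, List.mem_of_getElem? h]

theorem every_mem {r : Rule} (i : ℕ) (h : everyRules[i]? = some r) : r ∈ queryRules := by
  simp [queryRules, List.mem_of_getElem? h]

variable {q : ℕ} {c : Ctx V}

/-- A filter that stays at its node. -/
theorem complete_of_diagonal (hM : Closed inp rp M) (hs : Setting inp D Q rp T W) {p : Query L}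
    (ho : Occ G T Q (rootCtx G S Q) q p c) (ht : p.tag ∈ [1, 2, 3])
    (hd : ∀ v v', p.sem G v v' → v = v')
    (h₁ : ∀ v v', ⟨.req, q, D.nodeId v⟩ ∈ M → p.sem G v v' → ⟨.ans, q, D.nodeId v'⟩ ∈ M)
    (h₂ : ∀ v v', ⟨.all, q, 0⟩ ∈ M → p.sem G v v' → ⟨.ans, q, D.nodeId v'⟩ ∈ M) :
    Complete D M q p := by
  refine ⟨h₁ _ _, fun {v v'} hR hv hE => ?_, h₂ _ _, fun {v v'} hR hv hE => .inl ?_⟩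
  · obtain rfl := hd v v' hv
    exact hM.one hs (ans_mem 0 rfl) ho ht (h₁ _ _ hR hv) hE
  · obtain rfl := hd v v' hv
    exact hM.one hs (ans_mem 0 rfl) ho ht (h₂ _ _ hR hv) hE

theorem complete_node (hM : Closed inp rp M) (hs : Setting inp D Q rp T W)
    (ho : Occ G T Q (rootCtx G S Q) q .node c) : Complete D M q (.node : Query L) := by
  refine complete_of_diagonal hM hs ho (by simp [tag]) (fun _ _ => id) ?_ ?_
  · rintro v _ hR rfl
    exact hM.one hs (req_mem 2 rfl) ho (by simp [tag]) hR hR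
  · rintro v _ hR rfl
    obtain ⟨j, hj, e⟩ := exists_index_nodes hs ⟨.all, q, 0⟩ v
    exact mem_of_eq (hM.own hs (all_mem 2 rfl) ho (by simp [tag]) hR hj hR) rfl rfl e

theorem complete_lab (hM : Closed inp rp M) (hs : Setting inp D Q rp T W) {a : L}
    (ho : Occ G T Q (rootCtx G S Q) q (.lab a) c) : Complete D M q (.lab a) := by
  have hleft := left_of_label hs ho (.inl rfl)
  refine complete_of_diagonal hM hs ho (by simp [tag]) (fun _ _ h => h.1) ?_ ?_
  · rintro v _ hR ⟨rfl, hv⟩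
    refine hM.own hs (req_mem 3 rfl) ho (by simp [tag]) hR (length_of_val_ne_zero rfl ?_) hR
    rw [← hs.desc.hasLab, ← hleft] at hv
    simpa [Loop.val, hasLabLoop, env] using hv
  · rintro v _ hR ⟨rfl, hv⟩
    rw [← D.mem_labeled] at hv
    obtain ⟨j, hj, e⟩ := (enum_labeled (x := ⟨.all, q, 0⟩) hs hleft).exists_index hv
    exact mem_of_eq (hM.own hs (all_mem 3 rfl) ho (by simp [tag]) hR hj hR) rfl rfl e

theorem complete_edge (hM : Closed inp rp M) (hs : Setting inp D Q rp T W) {a : L}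
    (ho : Occ G T Q (rootCtx G S Q) q (.edge a) c) : Complete D M q (.edge a) := by
  have hleft := left_of_label hs ho (.inr (.inl rfl))
  have hsucc : ∀ {v w}, (v, w) ∈ G.edge a → _ := fun {v w} hv =>
    (enum_succ (x := ⟨.req, q, D.nodeId v⟩) hs hleft rfl).exists_index ((D.mem_succ a v w).2 hv)
  have hedge : ∀ {v w}, (v, w) ∈ G.edge a → _ := fun {v w} hv =>
    exists_index_edges (x := ⟨.all, q, 0⟩) hs hleft hv
  refine ⟨fun hR hv => ?_, fun hR hv hE => ?_, fun hR hv => ?_, fun hR hv hE => .inl ?_⟩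
  · obtain ⟨j, hj, e⟩ := hsucc hv
    exact mem_of_eq (hM.own hs (req_mem 4 rfl) ho (by simp [tag]) hR hj hR) rfl rfl e
  · obtain ⟨j, hj, e⟩ := hsucc hv
    exact hM.own hs (req_mem 5 rfl) ho (by simp [tag]) hR hj (mem_of_eq hE rfl rfl e.symm)
  · obtain ⟨j, hj, e, e'⟩ := hedge hv
    exact mem_of_eq (hM.own hs (all_mem 4 rfl) ho (by simp [tag]) hR hj hR) rfl rfl e'
  · obtain ⟨j, hj, e, e'⟩ := hedge hv
    exact mem_of_eq (hM.own hs (all_mem 5 rfl) ho (by simp [tag]) hR hj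
      (mem_of_eq hE rfl rfl e'.symm)) rfl rfl e

theorem complete_inv (hM : Closed inp rp M) (hs : Setting inp D Q rp T W) {a : L}
    (ho : Occ G T Q (rootCtx G S Q) q (.inv a) c) : Complete D M q (.inv a) := by
  have hleft := left_of_label hs ho (.inr (.inr rfl))
  have hpred : ∀ {v w}, (w, v) ∈ G.edge a → _ := fun {v w} hv =>
    (enum_pred (x := ⟨.req, q, D.nodeId v⟩) hs hleft rfl).exists_index ((D.mem_pred a v w).2 hv)
  have hedge : ∀ {v w}, (v, w) ∈ G.edge a → _ := fun {v w} hv =>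
    exists_index_edges (x := ⟨.all, q, 0⟩) hs hleft hv
  refine ⟨fun hR hv => ?_, fun hR hv hE => ?_, fun hR hv => ?_, fun hR hv hE => .inl ?_⟩
  · obtain ⟨j, hj, e⟩ := hpred hv
    exact mem_of_eq (hM.own hs (req_mem 6 rfl) ho (by simp [tag]) hR hj hR) rfl rfl e
  · obtain ⟨j, hj, e⟩ := hpred hv
    exact hM.own hs (req_mem 7 rfl) ho (by simp [tag]) hR hj (mem_of_eq hE rfl rfl e.symm)
  · obtain ⟨j, hj, e, e'⟩ := hedge hv
    exact mem_of_eq (hM.own hs (all_mem 6 rfl) ho (by simp [tag]) hR hj hR) rfl rfl e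
  · obtain ⟨j, hj, e, e'⟩ := hedge hv
    exact mem_of_eq (hM.own hs (all_mem 7 rfl) ho (by simp [tag]) hR hj
      (mem_of_eq hE rfl rfl e.symm)) rfl rfl e'

/-- A path of `P` from `v` ends in an answer, which is good; so `v` is good as a start of `P`, or every
node is. -/
theorem complete_ex (hM : Closed inp rp M) (hs : Setting inp D Q rp T W) {p : Query L}
    (ho : Occ G T Q (rootCtx G S Q) q (.ex p) c) (h : Complete D M (inp .left q 0 0) p) :
    Complete D M q (.ex p) := by
  have hk := IsKid.ex (G := G) (T := T) p c
  have hE : ∀ {w}, ⟨.ans, inp .left q 0 0, D.nodeId w⟩ ∈ M →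
      (⟨.endGood, inp .left q 0 0, D.nodeId w⟩ : Item) ∈ M := fun hA =>
    hM.up hs (ans_mem 1 rfl) ho hk (by simp [tag]) (by simp) hA (by simp) hA
  have hA : ∀ {w}, ⟨.startGood, inp .left q 0 0, D.nodeId w⟩ ∈ M →
      (⟨.ans, q, D.nodeId w⟩ : Item) ∈ M := fun hG =>
    hM.up hs (startGood_mem 0 rfl) ho hk (by simp [tag]) (by simp) hG (by simp) hG
  refine complete_of_diagonal hM hs ho (by simp [tag]) (fun _ _ h => h.1) ?_ ?_
  · rintro v _ hR ⟨rfl, w, hw⟩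
    have hR' : (⟨.req, inp .left q 0 0, D.nodeId v⟩ : Item) ∈ M :=
      hM.one hs (req_mem 0 rfl) ho (by simp [tag]) hR hR
    exact hA (h.good_of_req hR' hw (hE (h.ans_of_req hR' hw)))
  · rintro v _ hR ⟨rfl, w, hw⟩
    have hR' : (⟨.all, inp .left q 0 0, 0⟩ : Item) ∈ M :=
      hM.one hs (all_mem 0 rfl) ho (by simp [tag]) hR hR
    rcases h.good_of_all hR' hw (hE (h.ans_of_all hR' hw)) with hG | hD
    · exact hA hG
    · have hX : (⟨.everyEx, q, 0⟩ : Item) ∈ M :=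
        hM.up hs (every_mem 0 rfl) ho hk (by simp [tag]) (by simp) hD (by simp) hR
      obtain ⟨j, hj, e⟩ := exists_index_nodes hs ⟨.everyEx, q, 0⟩ v
      exact mem_of_eq (hM.own hs (every_mem 3 rfl) ho (by simp [tag]) hX hj hX) rfl rfl e

theorem complete_test (hM : Closed inp rp M) (hs : Setting inp D Q rp T W) {p : Query L}
    (ho : Occ G T Q (rootCtx G S Q) q (.test p) c) (h : Complete D M (inp .left q 0 0) p) :
    Complete D M q (.test p) := by
  have hk := IsKid.test (G := G) (T := T) p c
  have hA : ∀ {w}, ⟨.ans, inp .left q 0 0, D.nodeId w⟩ ∈ M →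
      (⟨.ans, q, D.nodeId w⟩ : Item) ∈ M := fun hA =>
    hM.up hs (ans_mem 4 rfl) ho hk (by simp [tag]) (by simp) hA (by simp) hA
  have hE : ∀ {w}, ⟨.endGood, q, D.nodeId w⟩ ∈ M →
      (⟨.endGood, inp .left q 0 0, D.nodeId w⟩ : Item) ∈ M := fun hE =>
    hM.one hs (endGood_mem 1 rfl) ho (by simp [tag]) hE hE
  have hG : ∀ {w}, ⟨.startGood, inp .left q 0 0, D.nodeId w⟩ ∈ M →
      (⟨.startGood, q, D.nodeId w⟩ : Item) ∈ M := fun hG =>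
    hM.up hs (startGood_mem 3 rfl) ho hk (by simp [tag]) (by simp) hG (by simp) hG
  have hR : ∀ {w}, ⟨.req, q, D.nodeId w⟩ ∈ M → (⟨.req, inp .left q 0 0, D.nodeId w⟩ : Item) ∈ M :=
    fun hR => hM.one hs (req_mem 0 rfl) ho (by simp [tag]) hR hR
  have hAll : ⟨.all, q, 0⟩ ∈ M → (⟨.all, inp .left q 0 0, 0⟩ : Item) ∈ M :=
    fun hR => hM.one hs (all_mem 0 rfl) ho (by simp [tag]) hR hR
  have hD : ⟨.every, inp .left q 0 0, 0⟩ ∈ M → (⟨.every, q, 0⟩ : Item) ∈ M := fun hD =>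
    hM.up hs (every_mem 2 rfl) ho hk (by simp [tag]) (by simp) hD (by simp) hD
  exact ⟨fun h₁ hv => hA (h.ans_of_req (hR h₁) hv),
    fun h₁ hv h₂ => hG (h.good_of_req (hR h₁) hv (hE h₂)),
    fun h₁ hv => hA (h.ans_of_all (hAll h₁) hv),
    fun h₁ hv h₂ => (h.good_of_all (hAll h₁) hv (hE h₂)).imp hG hD⟩

theorem complete_union (hM : Closed inp rp M) (hs : Setting inp D Q rp T W) {b : Bool}
    {p p' : Query L} (ho : Occ G T Q (rootCtx G S Q) q (.union b p p') c)
    (h : Complete D M (inp .left q 0 0) p) (h' : Complete D M (inp .right q 0 0) p') :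
    Complete D M q (.union b p p') := by
  have hk := IsKid.unionL (G := G) (T := T) b p p' c
  have hk' := IsKid.unionR (G := G) (T := T) b p p' c
  have ht : (Query.union b p p').tag ∈ [5, 11] := by cases b <;> simp [tag]
  have ht1 : (Query.union b p p').tag ∈ [5, 7, 11] := by cases b <;> simp [tag]
  have ht2 : (Query.union b p p').tag ∈ [5, 7, 11, 12] := by cases b <;> simp [tag]
  have ht3 : (Query.union b p p').tag ∈ [5, 7, 11, 12, 13] := by cases b <;> simp [tag]
  have ht4 : (Query.union b p p').tag ∈ [1, 4, 5, 7, 10, 11, 12] := by cases b <;> simp [tag]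
  have ht5 : (Query.union b p p').tag ∈ [1, 4, 5, 7, 10, 11, 12, 13] := by cases b <;> simp [tag]
  have hA : ∀ {w}, ⟨.ans, inp .left q 0 0, D.nodeId w⟩ ∈ M →
      (⟨.ans, q, D.nodeId w⟩ : Item) ∈ M := fun hA =>
    hM.up hs (ans_mem 4 rfl) ho hk ht3 (by simp) hA (by simp) hA
  have hA' : ∀ {w}, ⟨.ans, inp .right q 0 0, D.nodeId w⟩ ∈ M →
      (⟨.ans, q, D.nodeId w⟩ : Item) ∈ M := fun hA =>
    hM.up hs (ans_mem 4 rfl) ho hk' ht3 (by simp) hA (by simp) hA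
  have hE : ∀ {w}, ⟨.endGood, q, D.nodeId w⟩ ∈ M →
      (⟨.endGood, inp .left q 0 0, D.nodeId w⟩ : Item) ∈ M := fun hE =>
    hM.one hs (endGood_mem 1 rfl) ho ht2 hE hE
  have hE' : ∀ {w}, ⟨.endGood, q, D.nodeId w⟩ ∈ M →
      (⟨.endGood, inp .right q 0 0, D.nodeId w⟩ : Item) ∈ M := fun hE =>
    hM.one hs (endGood_mem 2 rfl) ho ht hE hE
  have hG : ∀ {w}, ⟨.startGood, inp .left q 0 0, D.nodeId w⟩ ∈ M →
      (⟨.startGood, q, D.nodeId w⟩ : Item) ∈ M := fun hG =>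
    hM.up hs (startGood_mem 3 rfl) ho hk ht1 (by simp) hG (by simp) hG
  have hG' : ∀ {w}, ⟨.startGood, inp .right q 0 0, D.nodeId w⟩ ∈ M →
      (⟨.startGood, q, D.nodeId w⟩ : Item) ∈ M := fun hG =>
    hM.up hs (startGood_mem 3 rfl) ho hk' ht1 (by simp) hG (by simp) hG
  have hR : ∀ {w}, ⟨.req, q, D.nodeId w⟩ ∈ M → (⟨.req, inp .left q 0 0, D.nodeId w⟩ : Item) ∈ M :=
    fun hR => hM.one hs (req_mem 0 rfl) ho ht4 hR hR
  have hR' : ∀ {w}, ⟨.req, q, D.nodeId w⟩ ∈ M →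
      (⟨.req, inp .right q 0 0, D.nodeId w⟩ : Item) ∈ M :=
    fun hR => hM.one hs (req_mem 1 rfl) ho ht hR hR
  have hAll : ⟨.all, q, 0⟩ ∈ M → (⟨.all, inp .left q 0 0, 0⟩ : Item) ∈ M :=
    fun hR => hM.one hs (all_mem 0 rfl) ho ht5 hR hR
  have hAll' : ⟨.all, q, 0⟩ ∈ M → (⟨.all, inp .right q 0 0, 0⟩ : Item) ∈ M :=
    fun hR => hM.one hs (all_mem 1 rfl) ho ht hR hR
  have hD : ⟨.every, inp .left q 0 0, 0⟩ ∈ M → (⟨.every, q, 0⟩ : Item) ∈ M := fun hD =>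
    hM.up hs (every_mem 2 rfl) ho hk ht2 (by simp) hD (by simp) hD
  have hD' : ⟨.every, inp .right q 0 0, 0⟩ ∈ M → (⟨.every, q, 0⟩ : Item) ∈ M := fun hD =>
    hM.up hs (every_mem 2 rfl) ho hk' ht2 (by simp) hD (by simp) hD
  refine ⟨fun h₁ hv => ?_, fun h₁ hv h₂ => ?_, fun h₁ hv => ?_, fun h₁ hv h₂ => ?_⟩
  all_goals rcases hv with hv | hv
  · exact hA (h.ans_of_req (hR h₁) hv)
  · exact hA' (h'.ans_of_req (hR' h₁) hv)
  · exact hG (h.good_of_req (hR h₁) hv (hE h₂))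
  · exact hG' (h'.good_of_req (hR' h₁) hv (hE' h₂))
  · exact hA (h.ans_of_all (hAll h₁) hv)
  · exact hA' (h'.ans_of_all (hAll' h₁) hv)
  · exact (h.good_of_all (hAll h₁) hv (hE h₂)).imp hG hD
  · exact (h'.good_of_all (hAll' h₁) hv (hE' h₂)).imp hG' hD'

end RAM

namespace RAM

open Query

variable {L : Type*} {V : Type*} {G : LabeledGraph L V} {S : Set V} {D : Presentation G S}
  {Q : Query L} {T : Set (GFact L V)} {W : Set V} {inp : Input} {rp : ℕ → ℕ} {M : Set Item}
  {q : ℕ} {c : Ctx V}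

theorem complete_seq (hM : Closed inp rp M) (hs : Setting inp D Q rp T W) {b : Bool}
    {p p' : Query L} (ho : Occ G T Q (rootCtx G S Q) q (.seq b p p') c)
    (h : Complete D M (inp .left q 0 0) p) (h' : Complete D M (inp .right q 0 0) p') :
    Complete D M q (.seq b p p') := by
  have hk := IsKid.seqL (G := G) (T := T) b p p' c
  have hk' := IsKid.seqR (G := G) (T := T) b p p' c
  have ht : (Query.seq b p p').tag ∈ [4, 10] := by cases b <;> simp [tag]
  have ht4 : (Query.seq b p p').tag ∈ [1, 4, 5, 7, 10, 11, 12] := by cases b <;> simp [tag]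
  have ht5 : (Query.seq b p p').tag ∈ [1, 4, 5, 7, 10, 11, 12, 13] := by cases b <;> simp [tag]
  have hA : ∀ {w}, ⟨.ans, inp .left q 0 0, D.nodeId w⟩ ∈ M →
      (⟨.req, inp .right q 0 0, D.nodeId w⟩ : Item) ∈ M := fun hA =>
    hM.up hs (ans_mem 2 rfl) ho hk ht (by simp) hA (by simp) hA
  have hA' : ∀ {w}, ⟨.ans, inp .right q 0 0, D.nodeId w⟩ ∈ M →
      (⟨.ans, q, D.nodeId w⟩ : Item) ∈ M := fun hA =>
    hM.up hs (ans_mem 3 rfl) ho hk' ht (by simp) hA (by simp) hA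
  have hE' : ∀ {w}, ⟨.endGood, q, D.nodeId w⟩ ∈ M →
      (⟨.endGood, inp .right q 0 0, D.nodeId w⟩ : Item) ∈ M := fun hE =>
    hM.one hs (endGood_mem 0 rfl) ho ht hE hE
  have hG' : ∀ {w}, ⟨.startGood, inp .right q 0 0, D.nodeId w⟩ ∈ M →
      (⟨.endGood, inp .left q 0 0, D.nodeId w⟩ : Item) ∈ M := fun hG =>
    hM.up hs (startGood_mem 2 rfl) ho hk' ht (by simp) hG (by simp) hG
  have hG : ∀ {w}, ⟨.startGood, inp .left q 0 0, D.nodeId w⟩ ∈ M →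
      (⟨.startGood, q, D.nodeId w⟩ : Item) ∈ M := fun hG =>
    hM.up hs (startGood_mem 1 rfl) ho hk ht (by simp) hG (by simp) hG
  have hR : ∀ {w}, ⟨.req, q, D.nodeId w⟩ ∈ M → (⟨.req, inp .left q 0 0, D.nodeId w⟩ : Item) ∈ M :=
    fun hR => hM.one hs (req_mem 0 rfl) ho ht4 hR hR
  have hAll : ⟨.all, q, 0⟩ ∈ M → (⟨.all, inp .left q 0 0, 0⟩ : Item) ∈ M :=
    fun hR => hM.one hs (all_mem 0 rfl) ho ht5 hR hR
  have hD : ⟨.every, inp .left q 0 0, 0⟩ ∈ M → (⟨.every, q, 0⟩ : Item) ∈ M := fun hD =>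
    hM.up hs (every_mem 1 rfl) ho hk ht (by simp) hD (by simp) hD
  refine ⟨fun h₁ hv => ?_, fun h₁ hv h₂ => ?_, fun h₁ hv => ?_, fun h₁ hv h₂ => ?_⟩
  all_goals obtain ⟨w, hw, hv⟩ := hv
  · exact hA' (h'.ans_of_req (hA (h.ans_of_req (hR h₁) hw)) hv)
  · exact hG (h.good_of_req (hR h₁) hw
      (hG' (h'.good_of_req (hA (h.ans_of_req (hR h₁) hw)) hv (hE' h₂))))
  · exact hA' (h'.ans_of_req (hA (h.ans_of_all (hAll h₁) hw)) hv)
  · exact (h.good_of_all (hAll h₁) hw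
      (hG' (h'.good_of_req (hA (h.ans_of_all (hAll h₁) hw)) hv (hE' h₂)))).imp hG hD

theorem complete_plus (hM : Closed inp rp M) (hs : Setting inp D Q rp T W) {p : Query L}
    (ho : Occ G T Q (rootCtx G S Q) q (.plus p) c) (h : Complete D M (inp .left q 0 0) p) :
    Complete D M q (.plus p) := by
  have hk := IsKid.plus (G := G) (T := T) p c
  have hA : ∀ {w}, ⟨.ans, inp .left q 0 0, D.nodeId w⟩ ∈ M →
      (⟨.ans, q, D.nodeId w⟩ : Item) ∈ M := fun hA =>
    hM.up hs (ans_mem 4 rfl) ho hk (by simp [tag]) (by simp) hA (by simp) hA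
  have hAR : ∀ {w}, ⟨.ans, inp .left q 0 0, D.nodeId w⟩ ∈ M →
      (⟨.req, inp .left q 0 0, D.nodeId w⟩ : Item) ∈ M := fun hA =>
    hM.up hs (ans_mem 5 rfl) ho hk (by simp [tag]) (by simp) hA (by simp) hA
  have hE : ∀ {w}, ⟨.endGood, q, D.nodeId w⟩ ∈ M →
      (⟨.endGood, inp .left q 0 0, D.nodeId w⟩ : Item) ∈ M := fun hE =>
    hM.one hs (endGood_mem 1 rfl) ho (by simp [tag]) hE hE
  have hGE : ∀ {w}, ⟨.startGood, inp .left q 0 0, D.nodeId w⟩ ∈ M →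
      (⟨.endGood, inp .left q 0 0, D.nodeId w⟩ : Item) ∈ M := fun hG =>
    hM.up hs (startGood_mem 4 rfl) ho hk (by simp [tag]) (by simp) hG (by simp) hG
  have hR : ∀ {w}, ⟨.req, q, D.nodeId w⟩ ∈ M → (⟨.req, inp .left q 0 0, D.nodeId w⟩ : Item) ∈ M :=
    fun hR => hM.one hs (req_mem 0 rfl) ho (by simp [tag]) hR hR
  have hAll : ⟨.all, q, 0⟩ ∈ M → (⟨.all, inp .left q 0 0, 0⟩ : Item) ∈ M :=
    fun hR => hM.one hs (all_mem 0 rfl) ho (by simp [tag]) hR hR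
  have hD : ⟨.every, inp .left q 0 0, 0⟩ ∈ M → (⟨.every, q, 0⟩ : Item) ∈ M := fun hD =>
    hM.up hs (every_mem 2 rfl) ho hk (by simp [tag]) (by simp) hD (by simp) hD
  -- Answers are propagated forwards along a path, and good nodes backwards.
  have hans : ∀ {v v'}, ⟨.req, inp .left q 0 0, D.nodeId v⟩ ∈ M → Relation.TransGen (p.sem G) v v' →
      (⟨.ans, inp .left q 0 0, D.nodeId v'⟩ : Item) ∈ M := by
    intro v v' h₁ hv
    induction hv with
    | single hw => exact h.ans_of_req h₁ hw
    | tail _ hw ih => exact h.ans_of_req (hAR ih) hw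
  have hgood : ∀ {v v'}, ⟨.req, inp .left q 0 0, D.nodeId v⟩ ∈ M →
      Relation.TransGen (p.sem G) v v' → ⟨.endGood, inp .left q 0 0, D.nodeId v'⟩ ∈ M →
      (⟨.startGood, inp .left q 0 0, D.nodeId v⟩ : Item) ∈ M := by
    intro v v' h₁ hv h₂
    induction hv using Relation.TransGen.head_induction_on with
    | single hw => exact h.good_of_req h₁ hw h₂
    | head hw _ ih => exact h.good_of_req h₁ hw (hGE (ih (hAR (h.ans_of_req h₁ hw))))
  refine ⟨fun h₁ hv => hA (hans (hR h₁) hv), fun {v v'} h₁ hv h₂ => ?_, fun {v v'} h₁ hv => hA ?_,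
    fun {v v'} h₁ hv h₂ => ?_⟩
  · have hG := hgood (hR h₁) hv (hE h₂)
    exact hM.up hs (startGood_mem 5 rfl) ho hk (by simp [tag]) (by simp) hG (by simp) h₁
  · rcases Relation.TransGen.head'_iff.1 hv with ⟨w, hw, hv⟩
    have hw := h.ans_of_all (hAll h₁) hw
    rcases Relation.reflTransGen_iff_eq_or_transGen.1 hv with rfl | hv
    · exact hw
    · exact hans (hAR hw) hv
  · rcases Relation.TransGen.head'_iff.1 hv with ⟨w, hw, hv⟩
    have hEw : (⟨.endGood, inp .left q 0 0, D.nodeId w⟩ : Item) ∈ M := by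
      rcases Relation.reflTransGen_iff_eq_or_transGen.1 hv with rfl | hv
      · exact hE h₂
      · exact hGE (hgood (hAR (h.ans_of_all (hAll h₁) hw)) hv (hE h₂))
    refine (h.good_of_all (hAll h₁) hw hEw).imp (fun hG => ?_) hD
    exact hM.up hs (startGood_mem 6 rfl) ho hk (by simp [tag]) (by simp) hG (by simp) h₁

theorem complete_goto (hM : Closed inp rp M) (hs : Setting inp D Q rp T W) {p : Query L}
    (ho : Occ G T Q (rootCtx G S Q) q (.goto p) c) (h : Complete D M (inp .left q 0 0) p) :
    Complete D M q (.goto p) := by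
  have hk := IsKid.goto (G := G) (T := T) p c
  have hA : ∀ {w}, ⟨.ans, inp .left q 0 0, D.nodeId w⟩ ∈ M →
      (⟨.ans, q, D.nodeId w⟩ : Item) ∈ M := fun hA =>
    hM.up hs (ans_mem 4 rfl) ho hk (by simp [tag]) (by simp) hA (by simp) hA
  have hD : ∀ {w}, ⟨.ans, inp .left q 0 0, D.nodeId w⟩ ∈ M → ⟨.endGood, q, D.nodeId w⟩ ∈ M →
      (⟨.every, q, 0⟩ : Item) ∈ M := fun hA hE =>
    hM.up hs (ans_mem 6 rfl) ho hk (by simp [tag]) (by simp) hA (by simp) hE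
  have hR : ∀ {w}, ⟨.req, q, D.nodeId w⟩ ∈ M → (⟨.all, inp .left q 0 0, 0⟩ : Item) ∈ M :=
    fun hR => hM.one hs (req_mem 8 rfl) ho (by simp [tag]) hR hR
  have hAll : ⟨.all, q, 0⟩ ∈ M → (⟨.all, inp .left q 0 0, 0⟩ : Item) ∈ M :=
    fun hR => hM.one hs (all_mem 0 rfl) ho (by simp [tag]) hR hR
  refine ⟨fun h₁ ⟨w, hv⟩ => hA (h.ans_of_all (hR h₁) hv), fun h₁ ⟨w, hv⟩ h₂ => ?_,
    fun h₁ ⟨w, hv⟩ => hA (h.ans_of_all (hAll h₁) hv),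
    fun h₁ ⟨w, hv⟩ h₂ => .inr (hD (h.ans_of_all (hAll h₁) hv) h₂)⟩
  exact hM.one hs (req_mem 9 rfl) ho (by simp [tag]) h₁ (hD (h.ans_of_all (hR h₁) hv) h₂)

/-- Completeness of the inference rules. -/
theorem complete (hM : Closed inp rp M) (hs : Setting inp D Q rp T W) {p : Query L}
    (ho : Occ G T Q (rootCtx G S Q) q p c) : Complete D M q p := by
  induction p generalizing q c with
  | ex p ih => exact complete_ex hM hs ho (ih (occ_left hs ho (.ex ..)))
  | node => exact complete_node hM hs ho
  | lab a => exact complete_lab hM hs ho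
  | test p ih => exact complete_test hM hs ho (ih (occ_left hs ho (.test ..)))
  | edge a => exact complete_edge hM hs ho
  | inv a => exact complete_inv hM hs ho
  | seq b p p' ih ih' =>
    exact complete_seq hM hs ho (ih (occ_left hs ho (.seqL ..)))
      (ih' (occ_right hs ho (.seqR ..)))
  | union b p p' ih ih' =>
    exact complete_union hM hs ho (ih (occ_left hs ho (.unionL ..)))
      (ih' (occ_right hs ho (.unionR ..)))
  | plus p ih => exact complete_plus hM hs ho (ih (occ_left hs ho (.plus ..)))
  | goto p ih => exact complete_goto hM hs ho (ih (occ_left hs ho (.goto ..)))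

/-- The whole query is evaluated from all start nodes, unless its answers do not depend on the start
node, in which case one start node is enough. -/
theorem spine_complete (hM : Closed inp rp M) (hs : Setting inp D Q rp T W) {p : Query L}
    (ho : Occ G T Q (rootCtx G S Q) q p c) (hq : ⟨.spine, q, 0⟩ ∈ M) :
    (∀ s ∈ S, (⟨.req, 0, D.nodeId s⟩ : Item) ∈ M) ∨
      (∃ s ∈ S, (⟨.req, 0, D.nodeId s⟩ : Item) ∈ M) ∧
        ∀ s s' v, p.sem G s v → p.sem G s' v := by
  have hleaf : ∀ {q p c}, Occ G T Q (rootCtx G S Q) q p c → p.tag ∈ [1, 2, 3, 8, 9] →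
      ⟨.spine, q, 0⟩ ∈ M → ∀ s ∈ S, (⟨.req, 0, D.nodeId s⟩ : Item) ∈ M := by
    intro q p c ho ht hq s hS
    obtain ⟨j, hj, e⟩ := (enum_start hs ⟨.spine, q, 0⟩).exists_index ((D.mem_start s).2 hS)
    exact mem_of_eq (hM.own hs (spine_mem 2 rfl) ho ht hq hj hq) rfl rfl e
  have hleft : ∀ {q p c}, Occ G T Q (rootCtx G S Q) q p c → p.tag ∈ [4, 5, 7, 10, 11, 12] →
      ⟨.spine, q, 0⟩ ∈ M → (⟨.spine, inp .left q 0 0, 0⟩ : Item) ∈ M :=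
    fun ho ht hq => hM.one hs (spine_mem 0 rfl) ho ht hq hq
  induction p generalizing q c with
  | ex p ih => exact .inl (hleaf ho (by simp [tag]) hq)
  | node => exact .inl (hleaf ho (by simp [tag]) hq)
  | lab a => exact .inl (hleaf ho (by simp [tag]) hq)
  | edge a => exact .inl (hleaf ho (by simp [tag]) hq)
  | inv a => exact .inl (hleaf ho (by simp [tag]) hq)
  | test p ih => exact ih (occ_left hs ho (.test ..)) (hleft ho (by simp [tag]) hq)
  | seq b p p' ih ih' =>
    refine (ih (occ_left hs ho (.seqL ..)) (hleft ho (by cases b <;> simp [tag]) hq)).imp id ?_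
    rintro ⟨h, hp⟩
    exact ⟨h, fun s s' v ⟨w, hw, hv⟩ => ⟨w, hp s s' w hw, hv⟩⟩
  | union b p p' ih ih' =>
    rcases ih (occ_left hs ho (.unionL ..)) (hleft ho (by cases b <;> simp [tag]) hq) with
      h | ⟨h, hp⟩
    · exact .inl h
    have hq' : (⟨.spine, inp .right q 0 0, 0⟩ : Item) ∈ M :=
      hM.one hs (spine_mem 1 rfl) ho (by cases b <;> simp [tag]) hq hq
    refine (ih' (occ_right hs ho (.unionR ..)) hq').imp id ?_
    rintro ⟨-, hp'⟩
    exact ⟨h, fun s s' v hv => hv.imp (hp s s' v) (hp' s s' v)⟩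
  | plus p ih =>
    refine (ih (occ_left hs ho (.plus ..)) (hleft ho (by simp [tag]) hq)).imp id ?_
    rintro ⟨h, hp⟩
    refine ⟨h, fun s s' v hv => ?_⟩
    obtain ⟨w, hw, hv⟩ := Relation.TransGen.head'_iff.1 hv
    exact Relation.TransGen.head'_iff.2 ⟨w, hp s s' w hw, hv⟩
  | goto p ih =>
    rcases hst : D.start with - | ⟨s, l⟩
    · refine .inl fun s hS => ?_
      rw [← D.mem_start, hst] at hS
      simp at hS
    · have hval : firstLoop.val inp (env inp rp ⟨.spine, q, 0⟩) 0 = D.nodeId s + 1 := by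
        have : firstLoop.val inp (env inp rp ⟨.spine, q, 0⟩) 0 =
            entry (D.start.map fun v => (D.nodeId v : ℕ)) 0 := by
          rw [← hs.desc.start]; simp [Loop.val, firstLoop, env]
        rw [this, hst]; simp [entry]
      refine .inr ⟨⟨s, (D.mem_start s).1 (by simp [hst]), ?_⟩, fun s s' v hv => hv⟩
      refine mem_of_eq (hM.own hs (spine_mem 3 rfl) ho (by simp [tag]) hq
        (length_of_val_ne_zero rfl (by rw [hval]; omega)) hq) rfl rfl ?_
      show firstLoop.val inp (env inp rp ⟨.spine, q, 0⟩) 0 - 1 = _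
      rw [hval, Nat.add_sub_cancel]

/-- All answers of the whole query are derived. -/
theorem ans_mem_of_mem_answers (hM : Closed inp rp M) (hs : Setting inp D Q rp T W)
    (hfirst : firstItem ∈ M) {v : V} (hv : v ∈ Q.answers G S) :
    (⟨.ans, 0, D.nodeId v⟩ : Item) ∈ M := by
  obtain ⟨s, hS, hv⟩ := hv
  have hc := complete hM hs (.root : Occ G T Q (rootCtx G S Q) 0 Q _)
  rcases spine_complete hM hs .root hfirst with h | ⟨⟨s', -, h⟩, hp⟩
  · exact hc.ans_of_req (h s hS) hv
  · exact hc.ans_of_req h (hp s s' v hv)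

end RAM

namespace RAM

open Query

/-! ### The number of steps -/

section

variable {L : Type*} {V : Type*} {G : LabeledGraph L V} {S : Set V} {D : Presentation G S}
  {Q : Query L} {T : Set (GFact L V)} {W : Set V} {inp : Input} {rp : ℕ → ℕ} {M : Set Item}

/-- The first node of a fact. -/
def factSrc : GFact L V → V
  | .node v => v
  | .lab _ v => v
  | .edge _ v _ => v

/-- The last node of a fact. -/
def factTgt : GFact L V → V
  | .node v => v
  | .lab _ v => v
  | .edge _ _ w => w

/-- The nodes that the machine may visit. -/
def visited (D : Presentation G S) (T : Set (GFact L V)) : Set V :=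
  factSrc '' T ∪ factTgt '' T ∪ {v | D.start.head? = some v}

theorem finite_visited (hT : T.Finite) : (visited D T).Finite := by
  refine ((hT.image _).union (hT.image _)).union (Set.Subsingleton.finite ?_)
  intro v hv w hw
  exact Option.some.inj (hv.symm.trans hw)

theorem ncard_visited_le (hT : T.Finite) : (visited D T).ncard ≤ 2 * T.ncard + 1 := by
  have h1 : {v | D.start.head? = some v}.ncard ≤ 1 := by
    have hsub : {v | D.start.head? = some v}.Subsingleton := fun v hv w hw =>
      Option.some.inj (hv.symm.trans hw)
    exact (Set.ncard_le_one hsub.finite).2 fun v hv w hw => hsub hv hw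
  have h2 := Set.ncard_union_le (factSrc '' T ∪ factTgt '' T) {v | D.start.head? = some v}
  have h3 := Set.ncard_union_le (factSrc '' T) (factTgt '' T)
  have h4 := Set.ncard_image_le (f := factSrc) hT
  have h5 := Set.ncard_image_le (f := factTgt) hT
  unfold visited
  omega

/-- A fact that is in relation to at most one number is counted at most once. -/
theorem sum_ncard_le (hT : T.Finite) (s : Finset ℕ) (R : ℕ → GFact L V → Prop)
    (hR : ∀ i j f, R i f → R j f → i = j) : ∑ i ∈ s, {f | f ∈ T ∧ R i f}.ncard ≤ T.ncard := by
  classical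
  have hc : ∀ i, {f | f ∈ T ∧ R i f}.ncard = (hT.toFinset.filter (R i)).card := by
    intro i
    rw [← Set.ncard_coe_finset]
    congr 1
    ext f
    simp
  rw [Finset.sum_congr rfl fun i _ => hc i, ← Finset.card_biUnion, Set.ncard_eq_toFinset_card T hT]
  · refine Finset.card_le_card ?_
    intro f hf
    obtain ⟨i, -, hf⟩ := Finset.mem_biUnion.1 hf
    exact (Finset.mem_filter.1 hf).1
  · intro i _ j _ hij
    refine Finset.disjoint_left.2 fun f h1 h2 => hij ?_
    exact hR i j f (Finset.mem_filter.1 h1).2 (Finset.mem_filter.1 h2).2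

/-- Every edge fact is counted at its two nodes. -/
theorem sum_localSize_le (hT : T.Finite) (s : Finset ℕ) :
    ∑ i ∈ s, localSize D T i ≤ 3 * T.ncard := by
  unfold localSize
  rw [Finset.sum_add_distrib, Finset.sum_add_distrib]
  have h1 := sum_ncard_le hT s (fun i f => ∃ a v w, f = .edge a v w ∧ i = D.nodeId v) (by
    rintro i j _ ⟨a, v, w, rfl, rfl⟩ ⟨a', v', w', h, rfl⟩
    cases h; rfl)
  have h2 := sum_ncard_le hT s (fun i f => ∃ a v w, f = .edge a v w ∧ i = D.nodeId w) (by
    rintro i j _ ⟨a, v, w, rfl, rfl⟩ ⟨a', v', w', h, rfl⟩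
    cases h; rfl)
  have h3 : ∑ i ∈ s, (if i = 0 then T.ncard else 0) ≤ T.ncard := by
    rw [Finset.sum_ite_eq']
    split_ifs <;> simp
  omega

/-- All kinds of items. -/
def Kind.list : Finset Kind :=
  {.req, .ans, .endGood, .startGood, .all, .every, .everyEx, .spine}

/-- All items with positions below `N` and node numbers in `s`. -/
def itemBox (N : ℕ) (s : Finset ℕ) : Finset Item :=
  (Kind.list ×ˢ Finset.range N ×ˢ s).image fun t => ⟨t.1, t.2.1, t.2.2⟩

theorem sum_itemBox (N : ℕ) (s : Finset ℕ) (f : ℕ → ℕ) :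
    ∑ x ∈ itemBox N s, f x.v = 8 * (N * ∑ i ∈ s, f i) := by
  unfold itemBox
  rw [Finset.sum_image, Finset.sum_product, Finset.sum_congr rfl fun k _ => Finset.sum_product _ _ _]
  · simp only [Finset.sum_const, Finset.card_range, smul_eq_mul]
    rfl
  · rintro ⟨k, q, v⟩ - ⟨k', q', v'⟩ - h
    simp only [Item.mk.injEq] at h
    obtain ⟨rfl, rfl, rfl⟩ := h
    rfl

theorem Good.exists_node {p : Query L} {c : Ctx V} {x : ℕ} {k : Kind} (h : Good D T W p c x k) :
    x = 0 ∨ ∃ v ∈ W, x = D.nodeId v := by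
  cases k
  case req | ans | endGood | startGood => obtain ⟨v, hx, hw, -⟩ := h; exact .inr ⟨v, hw, hx⟩
  case all | every | everyEx | spine => exact .inl h.1

/-- A rule of the list contributes one implication for every element of its enumeration. -/
theorem length_acts_le (hs : Setting inp D Q rp T W) (hT : T.Finite) {x : Item}
    (hx : Sound D Q T W x) :
    (acts inp rp queryRules x).length ≤ queryRules.length * (1 + localSize D T x.v) := by
  unfold acts ruleActs
  rw [List.length_flatMap]
  refine (List.sum_le_card_nsmul _ (1 + localSize D T x.v) ?_).trans (by simp)
  intro m hm
  obtain ⟨r, hr, rfl⟩ := List.mem_map.1 hm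
  unfold Rule.acts
  split_ifs with h
  · rw [List.length_map, List.length_range]
    exact (ruleOK_queryRules hs hT r hr x hx h).2.1
  · simp

theorem mem_acts {x : Item} {py : Item × Item} : py ∈ acts inp rp queryRules x ↔
    ∃ r ∈ queryRules, r.Fires (env inp rp x) ∧ ∃ j < r.loop.length inp (env inp rp x),
      r.inst inp (env inp rp x) j = py := by
  unfold acts ruleActs
  rw [List.mem_flatMap]
  refine exists_congr fun r => and_congr_right fun _ => ?_
  unfold Rule.acts
  split_ifs with h
  · simp [h]
  · simp [h]

/-- A bound for the number of steps, up to the factors `Q.size` and `max 1 T.ncard`. -/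
def stepBound : ℕ :=
  130 + 8 * (4 * (stepCost queryRules + 2 + 260 * queryRules.length) +
    3 * (260 * queryRules.length))

/-- The sound items, and the time that the engine needs for them. -/
theorem exists_items (hs : Setting inp D Q rp T W) (hT : T.Finite) (hW : W.Finite)
    (hcard : W.ncard ≤ 2 * T.ncard + 1) : ∃ U : Finset Item, (∀ x, Sound D Q T W x → x ∈ U) ∧
      30 * Q.size + ∑ x ∈ U, itemCost inp rp queryRules x + 100 ≤
        stepBound * (Q.size * max 1 T.ncard) := by
  classical
  set s : Finset ℕ := insert 0 (hW.toFinset.image fun v => (D.nodeId v : ℕ)) with hsdef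
  have hbox : ∀ x, Sound D Q T W x → x ∈ itemBox Q.size s := by
    rintro ⟨k, q, v⟩ hx
    have hq : q < Q.size := hx.valid.1
    have hv : v ∈ s := by
      obtain ⟨p, c, -, hg⟩ := hx
      rcases hg.exists_node with h | ⟨w, hw, h⟩
      · simp only [] at h
        simp [hsdef, h]
      · simp only [] at h
        simp only [hsdef, h, Finset.mem_insert, Finset.mem_image, Set.Finite.mem_toFinset]
        exact .inr ⟨w, hw, rfl⟩
    refine Finset.mem_image.2 ⟨(k, q, v), ?_, rfl⟩
    simp only [Finset.mem_product, Finset.mem_range]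
    exact ⟨by cases k <;> simp [Kind.list], hq, hv⟩
  refine ⟨(itemBox Q.size s).filter fun x => Sound D Q T W x,
    fun x hx => Finset.mem_filter.2 ⟨hbox x hx, hx⟩, ?_⟩
  have hcost : ∑ x ∈ (itemBox Q.size s).filter (fun x => Sound D Q T W x),
      itemCost inp rp queryRules x ≤ ∑ x ∈ itemBox Q.size s,
        (stepCost queryRules + 2 + 260 * queryRules.length +
          260 * queryRules.length * localSize D T x.v) := by
    refine (Finset.sum_le_sum fun x hx => ?_).trans
      (Finset.sum_le_sum_of_subset (Finset.filter_subset _ _))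
    have := length_acts_le hs hT (Finset.mem_filter.1 hx).2
    unfold itemCost
    nlinarith
  rw [sum_itemBox Q.size s fun i => stepCost queryRules + 2 + 260 * queryRules.length +
    260 * queryRules.length * localSize D T i, Finset.sum_add_distrib, Finset.sum_const,
    ← Finset.mul_sum, smul_eq_mul] at hcost
  have hlocal := sum_localSize_le (D := D) hT s
  have hscard : s.card ≤ 2 * T.ncard + 2 := by
    refine (Finset.card_insert_le _ _).trans ?_
    have := Finset.card_image_le (s := hW.toFinset) (f := fun v => (D.nodeId v : ℕ))
    rw [← Set.ncard_eq_toFinset_card W hW] at this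
    omega
  have hN := Q.size_pos
  unfold stepBound
  generalize stepCost queryRules + 2 + 260 * queryRules.length = A at *
  generalize 260 * queryRules.length = B at *
  generalize Q.size = N at *
  have h1 : 1 ≤ max 1 T.ncard := le_max_left _ _
  have h2 : T.ncard ≤ max 1 T.ncard := le_max_right _ _
  generalize max 1 T.ncard = m at *
  have e1 : s.card * A ≤ 4 * m * A := Nat.mul_le_mul_right _ (by omega)
  have e2 : B * ∑ i ∈ s, localSize D T i ≤ B * (3 * m) := Nat.mul_le_mul_left _ (by omega)
  have e3 : N ≤ N * m := Nat.le_mul_of_pos_right _ h1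
  have e4 : 8 * (N * (s.card * A + B * ∑ i ∈ s, localSize D T i)) ≤
      8 * (N * (4 * m * A + B * (3 * m))) :=
    Nat.mul_le_mul_left _ (Nat.mul_le_mul_left _ (Nat.add_le_add e1 e2))
  calc _ ≤ 30 * (N * m) + 8 * (N * (4 * m * A + B * (3 * m))) + 100 * (N * m) := by omega
    _ = _ := by ring

/-! ### The program -/

/-- The program evaluates the query of the input. -/
theorem evaluates (D : Presentation G S) (Q : Query L) (T : Set (GFact L V)) (hT : T.Finite)
    (hneed : Q.need G (some S) ⊆ T) (hD : Describes inp D Q) :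
    ∃ out : List V, out.Nodup ∧ (∀ v, v ∈ out ↔ v ∈ Q.answers G S) ∧
      HaltsWithin ((engineCmd queryRules).code 0) inp (stepBound * (Q.size * max 1 T.ncard))
        (out.map fun v => (D.nodeId v : ℕ)) := by
  obtain ⟨rp, hrp⟩ := exists_isRightParent hD
  have hs : Setting inp D Q rp T (visited D T) := by
    refine ⟨hD, hrp, hneed, fun v h => .inl (.inl ⟨_, h, rfl⟩), fun a v h => .inl (.inl ⟨_, h, rfl⟩),
      fun a v w h => ⟨.inl (.inl ⟨_, h, rfl⟩), .inl (.inr ⟨_, h, rfl⟩)⟩, fun v h => .inr h⟩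
  obtain ⟨U, hU, hbound⟩ := exists_items hs hT (finite_visited hT) (ncard_visited_le hT)
  obtain ⟨t, s', hexec, ht, done, hnd, hfirst, hsound, hclosed, hout⟩ :=
    tri_engineCmd (rules := queryRules) (S := Sound D Q T (visited D T)) Q.size_pos hrp
      (describes_tag hD) (hD.nodeCount 0 0 0) wf_queryRules
      (fun x hx r hr hf => (ruleOK_queryRules hs hT r hr x hx hf).1)
      (fun x hx py hpy => by
        obtain ⟨r, hr, hf, j, hj, rfl⟩ := mem_acts.1 hpy
        exact (ruleOK_queryRules hs hT r hr x hx hf).2.2 j hj)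
      ⟨Q, _, .root, rfl, hneed⟩ U hU
  have hM : Closed inp rp {x | x ∈ done} := fun x hx r hr hf j hj =>
    hclosed x hx _ (mem_acts.2 ⟨r, hr, hf, j, hj, rfl⟩)
  have hmem : ∀ v : V, (⟨.ans, 0, D.nodeId v⟩ : Item) ∈ done → v ∈ Q.answers G S := by
    intro v hv
    obtain ⟨p, c, ho, w, hvw, -, hw, -⟩ := hsound _ hv
    obtain ⟨rfl, rfl⟩ := ho.unique hD .root
    obtain rfl := D.nodeId.injective (Fin.ext hvw)
    exact hw
  obtain ⟨out, hout'⟩ : (done.filter fun x => x.k = .ans ∧ x.q = 0) ∈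
      Set.range (List.map fun v : V => (⟨.ans, 0, D.nodeId v⟩ : Item)) := by
    rw [Set.range_list_map]
    rintro ⟨k, q, v⟩ hx
    simp only [List.mem_filter, decide_eq_true_eq] at hx
    obtain ⟨hx, rfl, rfl⟩ := hx
    obtain ⟨p, c, -, w, hvw, -⟩ := hsound _ hx
    exact ⟨w, Item.ext rfl rfl hvw.symm⟩
  have hinj : Function.Injective fun v : V => (⟨.ans, 0, D.nodeId v⟩ : Item) := by
    intro v w h
    simp only [Item.mk.injEq, true_and] at h
    exact D.nodeId.injective (Fin.ext h)
  refine ⟨out, ?_, fun v => ?_, ?_⟩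
  · refine List.Nodup.of_map (fun v : V => (⟨.ans, 0, D.nodeId v⟩ : Item)) ?_
    rw [hout']
    exact hnd.filter _
  · rw [← List.mem_map_of_injective hinj, hout']
    simp only [List.mem_filter, decide_eq_true_eq, and_true]
    exact ⟨hmem v, ans_mem_of_mem_answers hM hs hfirst⟩
  · have := hexec.haltsWithin (ht.trans hbound)
    rw [hout, ← hout', List.map_map] at this
    exact this

end

theorem finite_facts (L V : Type*) [Finite L] [Finite V] (T : Set (GFact L V)) : T.Finite := by
  have : Function.Injective fun f : GFact L V => (match f with
      | .node v => .inl v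
      | .lab a v => .inr (.inl (a, v))
      | .edge a v w => .inr (.inr (a, v, w)) : V ⊕ L × V ⊕ L × V × V) := by
    intro f g h
    cases f <;> cases g <;> simp_all
  have := Finite.of_injective _ this
  exact T.toFinite

end RAM

theorem mainTheorem1 :
    ∃ (prog : RAM.Program) (C : ℕ),
      ∀ (L : Type*) (V : Type*) [Finite L] [Finite V] (G : LabeledGraph L V) (S : Set V)
        (P : NPath L), P.NegFree →
        ∀ D : Presentation G S,
          ∃ out : List V,
            out.Nodup ∧ (∀ v, v ∈ out ↔ v ∈ P.answers G S) ∧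
            RAM.HaltsWithin prog (RAM.Input.ofQuery D P)
              (C * (P.size * max 1 (P.tdn G S).ncard))
              (out.map fun v => (D.nodeId v : ℕ)) := by
  refine ⟨(RAM.engineCmd RAM.queryRules).code 0, RAM.stepBound, fun L V _ _ G S P hP D => ?_⟩
  have := RAM.evaluates D P.toQuery (P.tdn G S) (RAM.finite_facts L V _)
    ((P.need_toQuery G hP).1 S).le (RAM.describes_ofQuery D P hP)
  rwa [P.answers_toQuery G hP S, P.size_toQuery hP] at this
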